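/- Let $A$ be a unital simple AF $C^*$-algebra and let $\alpha=(\alpha_t)_{t\in\mathbb R}$ be a one-parameter group of $*$-automorphisms of $A$ such that $t\mapsto\alpha_t(x)$ is norm continuous for every $x\in A$. Let $\delta_\alpha(x)=\lim_{t\to0}(\alpha_t(x)-x)/t$ be its generator, with domain $\mathcal D(\delta_\alpha)$ the set of all $x\in A$ for which the limit exists; $\mathcal D(\delta_\alpha)$ is normed by the graph norm $\|x\|+\|\delta_\alpha(x)\|$. A maximal abelian AF $C^*$-subalgebra $C$ of $A$ is called a canonical AF masa if there is an increasing sequence $(A_n)_{n\ge1}$ of finite-dimensional $C^*$-subalgebras of $A$ with $\bigcup_nA_n$ dense in $A$ such that, with $A_0=0$, $C\cap A_n\cap A_{n-1}'$ is a maximal abelian $C^*$-subalgebra of $A_n\cap A_{n-1}'$ for all $n\ge1$. A one-parameter automorphism group $\beta$ of $A$ is called AF locally representable if there is an increasing sequence $(A_n)$ of finite-dimensional $C^*$-subalgebras of $A$ with dense union such that $\beta_t(A_n)=A_n$ for all $n$ and $t$. For $h=h^*\in A$ write $(\mathrm{ad}\,ih)(x)=i(hx-xh)$; the inner perturbation $\delta_\alpha+\mathrm{ad}\,ih$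 has domain $\mathcal D(\delta_\alpha)$. Then the following conditions are equivalent: 1. $\mathcal D(\delta_\alpha)$ contains a canonical AF masa of $A$. 2. There are $h=h^*\in A$ and an increasing sequence $(A_n)$ of finite-dimensional $C^*$-subalgebras of $A$, contained in $\mathcal D(\delta_\alpha)$, such that $\bigcup_nA_n$ is dense in $\mathcal D(\delta_\alpha)$ and $(\delta_\alpha+\mathrm{ad}\,ih)(A_n)\subseteq A_n$ for all $n$. 3. There is $h=h^*\in A$ such that $\delta_\alpha+\mathrm{ad}\,ih$ is the generator of an AF locally representable one-parameter automorphism group of $A$. -/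

import Mathlib

open Filter Topology

noncomputable section

namespace AFAction

section CStar

variable {A : Type*} [CStarAlgebra A]

/-- A C*-algebra is simple if it is nonzero and has no closed two-sided ideals
other than zero and itself. -/
def IsSimpleCStar (A : Type*) [CStarAlgebra A] : Prop :=
  Nontrivial A ∧ ∀ I : TwoSidedIdeal A, IsClosed (I : Set A) → I = ⊥ ∨ I = ⊤

/-- An increasing (not necessarily strictly) sequence of finite-dimensional C*-subalgebras of `A`.
They need not contain the unit of `A`. Finite-dimensional *-subalgebras are
automatically closed. -/
def IsIncreasingFinDim (F : ℕ → NonUnitalStarSubalgebra ℂ A) : Prop :=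
  Monotone F ∧ ∀ n, FiniteDimensional ℂ (F n)

/-- A C*-subalgebra `C` of `A` is AF if it is the closure of the union of an increasing sequence
of finite-dimensional C*-subalgebras. -/
def IsAFSubalgebra (C : NonUnitalStarSubalgebra ℂ A) : Prop :=
  ∃ F : ℕ → NonUnitalStarSubalgebra ℂ A,
    IsIncreasingFinDim F ∧ closure (⋃ n, (F n : Set A)) = (C : Set A)

/-- `A` is an AF algebra. -/
def IsAFAlgebra (A : Type*) [CStarAlgebra A] : Prop :=
  IsAFSubalgebra (⊤ : NonUnitalStarSubalgebra ℂ A)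

/-- `C` is a masa of `B`: a maximal element among the abelian C*-subalgebras of `B`. -/
def IsMasaIn (C B : NonUnitalStarSubalgebra ℂ A) : Prop :=
  Maximal (fun D : NonUnitalStarSubalgebra ℂ A =>
    IsClosed (D : Set A) ∧ D ≤ B ∧ ∀ x ∈ D, ∀ y ∈ D, x * y = y * x) C

/-- The relative commutant `B ∩ B₀'`, where `B₀'` is the commutant of `B₀` in `A`. -/
def relCommutant (B B₀ : NonUnitalStarSubalgebra ℂ A) : NonUnitalStarSubalgebra ℂ A :=
  B ⊓ NonUnitalStarSubalgebra.centralizer ℂ (B₀ : Set A)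

/-- `C` is a canonical AF masa of `A`: a maximal abelian AF C*-subalgebra for which there is an
increasing sequence `0 = A₀ ⊆ A₁ ⊆ A₂ ⊆ ⋯` of finite-dimensional C*-subalgebras with dense union
in `A` such that `C ∩ Aₙ ∩ Aₙ₋₁'` is a masa of `Aₙ ∩ Aₙ₋₁'` for all `n ≥ 1`. -/
def IsCanonicalAFMasa (C : NonUnitalStarSubalgebra ℂ A) : Prop :=
  IsMasaIn C ⊤ ∧ IsAFSubalgebra C ∧
    ∃ F : ℕ → NonUnitalStarSubalgebra ℂ A,
      IsIncreasingFinDim F ∧ F 0 = ⊥ ∧ Dense (⋃ n, (F n : Set A)) ∧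
        ∀ n, IsMasaIn (C ⊓ relCommutant (F (n + 1)) (F n)) (relCommutant (F (n + 1)) (F n))

end CStar

/-- A (strongly continuous) one-parameter group of *-automorphisms of `A`. -/
structure OneParamAutGroup (A : Type*) [CStarAlgebra A] where
  toFun : ℝ → (A ≃⋆ₐ[ℂ] A)
  map_zero' : ∀ a, toFun 0 a = a
  map_add' : ∀ s t a, toFun (s + t) a = toFun s (toFun t a)
  continuous' : ∀ a, Continuous fun t => toFun t a

variable {A : Type*} [CStarAlgebra A]

instance : CoeFun (OneParamAutGroup A) (fun _ => ℝ → (A ≃⋆ₐ[ℂ] A)) := ⟨OneParamAutGroup.toFun⟩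

/-- The (infinitesimal) generator `δ_α` of `α`: the unbounded operator
`δ_α(x) = lim_{t → 0} (α_t(x) - x) / t`, whose domain consists of all `x` for which the limit
exists. -/
def OneParamAutGroup.generator (α : OneParamAutGroup A) : A →ₗ.[ℂ] A where
  domain :=
    { carrier := {x | DifferentiableAt ℝ (fun t : ℝ => α t x) 0}
      add_mem' := by
        intro x y hx hy
        simp only [Set.mem_ofPred_eq, map_add] at *
        exact hx.add hy
      zero_mem' := by simp
      smul_mem' := by
        intro c x hx
        simp only [Set.mem_ofPred_eq, map_smul] at *
        exact hx.const_smul c }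
  toFun :=
    { toFun := fun x => deriv (fun t : ℝ => α t (x : A)) 0
      map_add' := by
        rintro ⟨x, hx⟩ ⟨y, hy⟩
        have hx' : DifferentiableAt ℝ (fun t : ℝ => α t x) 0 := hx
        have hy' : DifferentiableAt ℝ (fun t : ℝ => α t y) 0 := hy
        simp only [Submodule.coe_add, map_add]
        exact (hx'.hasDerivAt.add hy'.hasDerivAt).deriv
      map_smul' := by
        rintro c ⟨x, hx⟩
        have hx' : DifferentiableAt ℝ (fun t : ℝ => α t x) 0 := hx
        simp only [Submodule.coe_smul, map_smul, RingHom.id_apply]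
        exact (hx'.hasDerivAt.const_smul c).deriv }

/-- Membership in the domain and the value of the generator are given by the limit of the
difference quotients. -/
theorem OneParamAutGroup.generator_spec (α : OneParamAutGroup A) (x y : A) :
    (∃ hx : x ∈ α.generator.domain, α.generator ⟨x, hx⟩ = y) ↔
      Tendsto (fun t : ℝ => t⁻¹ • (α t x - x)) (𝓝[≠] 0) (𝓝 y) := by
  have key : HasDerivAt (fun t : ℝ => α t x) y 0 ↔
      Tendsto (fun t : ℝ => t⁻¹ • (α t x - x)) (𝓝[≠] 0) (𝓝 y) := by
    rw [hasDerivAt_iff_tendsto_slope_zero]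
    simp [α.map_zero']
  rw [← key]
  constructor
  · rintro ⟨hx, rfl⟩
    exact DifferentiableAt.hasDerivAt hx
  · intro h
    exact ⟨h.differentiableAt, h.deriv⟩

/-- The bounded inner derivation `ad ih`, `x ↦ i (h x - x h)`. -/
def adI (h : A) : A →ₗ[ℂ] A :=
  Complex.I • (LinearMap.mulLeft ℂ h - LinearMap.mulRight ℂ h)

/-- The perturbation `δ + ad ih`, with the same domain as `δ`. -/
def innerPerturbation (δ : A →ₗ.[ℂ] A) (h : A) : A →ₗ.[ℂ] A where
  domain := δ.domain
  toFun := δ.toFun + (adI h).comp δ.domain.subtype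

/-- `S` is contained in the domain of `δ` and is dense in it for the graph norm
`‖x‖ + ‖δ x‖`. This norm is equivalent to the norm of the matrix `(x, δ x; 0, x)` in `M₂(A)`,
which lies between `max ‖x‖ ‖δ x‖` and `‖x‖ + ‖δ x‖`. -/
def IsDenseInDomain (δ : A →ₗ.[ℂ] A) (S : Set A) : Prop :=
  S ⊆ δ.domain ∧ ∀ x : δ.domain, ∀ ε > (0 : ℝ), ∃ y : δ.domain,
    (y : A) ∈ S ∧ ‖(x : A) - y‖ + ‖δ x - δ y‖ < ε

/-- `δ` leaves the subalgebra `B` invariant: `B` lies in the domain of `δ` and `δ(B) ⊆ B`. -/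
def LeavesInvariant (δ : A →ₗ.[ℂ] A) (B : NonUnitalStarSubalgebra ℂ A) : Prop :=
  (B : Set A) ⊆ δ.domain ∧ ∀ x : δ.domain, (x : A) ∈ B → δ x ∈ B

/-- `β` is AF locally representable: it leaves invariant each member of an increasing sequence
of finite-dimensional C*-subalgebras whose union is dense in `A`. -/
def IsAFLocallyRepresentable (β : OneParamAutGroup A) : Prop :=
  ∃ F : ℕ → NonUnitalStarSubalgebra ℂ A,
    IsIncreasingFinDim F ∧ Dense (⋃ n, (F n : Set A)) ∧
      ∀ n t, (fun x => β t x) '' (F n : Set A) = (F n : Set A)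

end AFAction

end

/-! Write `δ` for the generator. Conditions 2 and 3 are equivalent because invariant
finite-dimensional algebras with dense union form a core. A finite-dimensional subspace invariant
under a group lies in the domain of its generator (`exists_hasGen_of_invariant`). The operator `δ +
ad ih` is dissipative, so `1 - (δ + ad ih)` is bijective on every invariant finite-dimensional
subspace, and this gives density for the graph norm (`isDenseInDomain_of_invariant`). In the other
direction, derivations of finite-dimensional algebras are inner (`IsMatrixUnits.derivation_eq`), so
`δ + ad ih` is `ad ik_n` on the `n`-th algebra, with `k_n` in that algebra. The groups `Ad
e^{itk_n}` stabilize along the tower, and their limit has the same core, hence the right generator.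

For 2 → 1, choose in each relative commutant `A_{n+1} ∩ A_n'` a masa containing `k_{n+1} - k_n`. The
C*-algebra generated by these masas is a canonical masa annihilated by `δ + ad ih`, and the kernel
of that operator lies in the domain (`exists_canonicalAFMasa_of_invariant`).

The deep implication is 1 → 2. If the masa `C` lies in the domain, uniform boundedness gives
`‖α_t(c) - c‖ ≤ M|t|‖c‖` on `C`, so for small `t` the automorphism `σ = α_t` moves each unitary of
`C` by at most `1/2`. Simplicity makes this bound improve along the tower. Take a unitary `u` of `C`
and a unitary `v` of `C` commuting with a late stage. Spectral points of `σ(u)u*` and `σ(v)v*` can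
then nearly be realized on a common nonzero element, so displacements add up: if both were close to
the maximal displacement, `uv` would exceed it (`IsMasaTower.tail_improve`). Hence `σ` is
asymptotically trivial on the tails `C ∩ A_n'`, and the sums `∑ σ(e) e` over the minimal projections
of `C ∩ A_n` converge to an element `z` close to `1` with `σ(c) z = z c`
(`IsMasaTower.exists_tendsto_twist`).

The polar parts `w_t` of these `z_t` satisfy the cocycle identity up to unitaries in `C' = C`. Their
logarithms form an additive 2-cocycle, which is a coboundary by averaging, so `w` can be corrected
to a local cocycle `y` (`IsMasaTower.exists_cocycle`). The conjugated group `Ad y_t* ∘ α_t` fixes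
`C` pointwise. On a matrix unit `v` of `A_n` it acts as multiplication by a norm-continuous
semigroup in `C`, so it is differentiable there, and its generator on `A_n` is `ad ih_n` with `h_n ∈
C` (`IsLocalCocycle.exists_adI_eq`). Approximating `h_{n+1} - h_n` by elements of finite stages with
summable errors produces one `k ∈ C` such that, after subtracting `ad ik`, the algebras generated by
`A_n` and a later stage of `C` are invariant (`IsMasaTower.exists_invariant_algebras`). Finally `y`
is cohomologous, through a unitary `U`, to a differentiable cocycle
(`exists_differentiable_cocycle`), and conjugation by `U` carries everything back to `α`. -/

noncomputable section

namespace AFAction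

variable {A : Type*} [CStarAlgebra A]

/-! ### Generators of one-parameter groups: closedness and regularization. -/

namespace OneParamAutGroup

variable (α : OneParamAutGroup A)

theorem norm_map (t : ℝ) (x : A) : ‖α t x‖ = ‖x‖ :=
  NonUnitalStarAlgHom.norm_map (α t) (α t).injective x

theorem map_map_neg (t : ℝ) (x : A) : α t (α (-t) x) = x := by
  rw [← α.map_add', add_neg_cancel, α.map_zero']

/-- `α t` as a continuous linear map. -/
def clm (t : ℝ) : A →L[ℂ] A :=
  LinearMap.mkContinuous ((α t : A →ₗ[ℂ] A)) 1 fun x => by simp [α.norm_map t x]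

@[simp] theorem clm_apply (t : ℝ) (x : A) : α.clm t x = α t x := rfl

/-- `x` lies in the domain of the generator, which maps it to `y`. -/
def HasGen (x y : A) : Prop := HasDerivAt (fun t : ℝ => α t x) y 0

variable {α}

theorem hasGen_iff {x y : A} :
    α.HasGen x y ↔ ∃ hx : x ∈ α.generator.domain, α.generator ⟨x, hx⟩ = y := by
  constructor
  · intro h
    exact ⟨h.differentiableAt, h.deriv⟩
  · rintro ⟨hx, rfl⟩
    exact DifferentiableAt.hasDerivAt hx

theorem hasGen_generator (x : α.generator.domain) : α.HasGen x (α.generator x) :=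
  hasGen_iff.2 ⟨x.2, rfl⟩

theorem HasGen.unique {x y z : A} (h : α.HasGen x y) (h' : α.HasGen x z) : y = z :=
  HasDerivAt.unique h h'

theorem HasGen.add {x y x' y' : A} (h : α.HasGen x y) (h' : α.HasGen x' y') :
    α.HasGen (x + x') (y + y') := by
  have := HasDerivAt.add h h'
  simpa [HasGen, Pi.add_def] using this

theorem HasGen.sub {x y x' y' : A} (h : α.HasGen x y) (h' : α.HasGen x' y') :
    α.HasGen (x - x') (y - y') := by
  have := HasDerivAt.sub h h'
  simpa [HasGen, Pi.sub_def] using this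

theorem HasGen.smul {x y : A} (c : ℂ) (h : α.HasGen x y) : α.HasGen (c • x) (c • y) := by
  have := HasDerivAt.const_smul c h
  simpa [HasGen, Pi.smul_def] using this

theorem HasGen.star {x y : A} (h : α.HasGen x y) : α.HasGen (star x) (star y) := by
  have := HasDerivAt.star h
  simpa [HasGen, map_star] using this

theorem HasGen.mul {x y x' y' : A} (h : α.HasGen x y) (h' : α.HasGen x' y') :
    α.HasGen (x * x') (y * x' + x * y') := by
  have := HasDerivAt.mul h h'
  simpa [HasGen, Pi.mul_def, α.map_zero'] using this

theorem hasGen_algebraMap (c : ℂ) : α.HasGen (algebraMap ℂ A c) 0 := by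
  have : (fun t : ℝ => α t (algebraMap ℂ A c)) = fun _ => algebraMap ℂ A c := by
    funext t; rw [Algebra.algebraMap_eq_smul_one, map_smul, map_one]
  rw [HasGen, this]
  exact hasDerivAt_const _ _

theorem HasGen.hasDerivAt {x y : A} (h : α.HasGen x y) (t : ℝ) :
    HasDerivAt (fun s : ℝ => α s x) (α t y) t := by
  have h1 : HasDerivAt (fun s : ℝ => α (s - t) x) y t := by
    have : HasDerivAt (fun t : ℝ => α t x) y (t - t) := by rw [sub_self]; exact h
    simpa using this.comp_sub_const t t
  have h2 := ((α.clm t).restrictScalars ℝ).hasFDerivAt.comp_hasDerivAt t h1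
  refine h2.congr_deriv rfl |>.congr_of_eventuallyEq (Eventually.of_forall fun s => ?_)
  simp [Function.comp, ← α.map_add']

/-- Mean value inequality for `s ↦ α s x - s • y`, whose derivative is `α s y - y`. -/
theorem HasGen.norm_sub_le {x y : A} (h : α.HasGen x y) (t : ℝ) {C : ℝ}
    (hC : ∀ s, |s| ≤ |t| → ‖α s y - y‖ ≤ C) : ‖α t x - x - t • y‖ ≤ C * |t| := by
  have hd : ∀ s ∈ Set.uIcc 0 t, HasDerivWithinAt (fun s : ℝ => α s x - s • y)
      (α s y - y) (Set.uIcc 0 t) s := by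
    intro s _
    have := (h.hasDerivAt s).sub ((hasDerivAt_id s).smul_const y)
    simpa [Pi.sub_def] using this.hasDerivWithinAt
  have := (convex_uIcc (0 : ℝ) t).norm_image_sub_le_of_norm_hasDerivWithin_le (C := C) hd
    (fun s hs => hC s (by simpa using Set.abs_sub_left_of_mem_uIcc hs))
    Set.left_mem_uIcc Set.right_mem_uIcc
  simpa [α.map_zero', sub_right_comm] using this

/-- The oscillation of the orbit of `y i` is that of the limit `y'` up to `2 * ‖y i - y'‖`, so
`norm_sub_le` holds with a constant that survives the limit. This is closedness of the generator. -/
theorem HasGen.of_tendsto {ι : Type*} {l : Filter ι} [l.NeBot] {x y : ι → A} {x' y' : A}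
    (h : ∀ i, α.HasGen (x i) (y i)) (hx : Tendsto x l (𝓝 x')) (hy : Tendsto y l (𝓝 y')) :
    α.HasGen x' y' := by
  rw [HasGen, hasDerivAt_iff_isLittleO_nhds_zero, Asymptotics.isLittleO_iff]
  intro c hc
  have hcont : Tendsto (fun s => ‖α s y' - y'‖) (𝓝 0) (𝓝 0) := by
    have := ((α.continuous' y').sub (continuous_const (y := y'))).norm.tendsto 0
    simpa [α.map_zero'] using this
  obtain ⟨r, hr, hr'⟩ := Metric.eventually_nhds_iff.1 (hcont.eventually_lt_const hc)
  refine Metric.eventually_nhds_iff.2 ⟨r, hr, fun t ht => ?_⟩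
  have key : ∀ i, ‖α t (x i) - x i - t • y i‖ ≤ (c + 2 * ‖y i - y'‖) * |t| := by
    intro i
    refine (h i).norm_sub_le t fun s hs => ?_
    have h1 : ‖α s y' - y'‖ < c := hr' (by
      simp only [dist_zero_right, Real.norm_eq_abs] at ht ⊢; exact hs.trans_lt ht)
    calc ‖α s (y i) - y i‖ = ‖α s (y i - y') + (α s y' - y') - (y i - y')‖ := by
          rw [map_sub]; congr 1; abel
      _ ≤ ‖α s (y i - y')‖ + ‖α s y' - y'‖ + ‖y i - y'‖ := by
          refine (_root_.norm_sub_le _ _).trans ?_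
          gcongr
          exact norm_add_le _ _
      _ ≤ _ := by rw [α.norm_map]; linarith
  have hl : Tendsto (fun i => ‖α t (x i) - x i - t • y i‖) l (𝓝 ‖α t x' - x' - t • y'‖) := by
    have h1 : Tendsto (fun i => α t (x i)) l (𝓝 (α t x')) :=
      ((α.clm t).continuous.tendsto x').comp hx
    exact ((h1.sub hx).sub (hy.const_smul t)).norm
  have hr : Tendsto (fun i => (c + 2 * ‖y i - y'‖) * |t|) l (𝓝 ((c + 2 * ‖y' - y'‖) * |t|)) :=
    ((((hy.sub_const y').norm).const_mul 2).const_add c).mul_const _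
  have := le_of_tendsto_of_tendsto' hl hr key
  simpa [α.map_zero'] using this

/-- Averages of orbits over short intervals. -/
def smooth (α : OneParamAutGroup A) (ε : ℝ) (x : A) : A := ε⁻¹ • ∫ s in (0 : ℝ)..ε, α s x

/-- Applying `α t` shifts the interval of integration, so the orbit of the average is a difference
of two primitives of `s ↦ α s x`. -/
theorem hasGen_smooth (ε : ℝ) (x : A) : α.HasGen (α.smooth ε x) (ε⁻¹ • (α ε x - x)) := by
  have hc := α.continuous' x
  have e : ∀ t : ℝ, α t (α.smooth ε x) = ε⁻¹ • ((∫ s in (0 : ℝ)..(t + ε), α s x) -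
      ∫ s in (0 : ℝ)..t, α s x) := by
    intro t
    have h1 : α t (∫ s in (0 : ℝ)..ε, α s x) = ∫ s in (0 : ℝ)..ε, α t (α s x) :=
      (((α.clm t).restrictScalars ℝ).intervalIntegral_comp_comm
        (hc.intervalIntegrable 0 ε)).symm
    have h3 : α t (α.smooth ε x) = ε⁻¹ • α t (∫ s in (0 : ℝ)..ε, α s x) :=
      ((α.clm t).restrictScalars ℝ).map_smul _ _
    rw [h3, h1, intervalIntegral.integral_interval_sub_left (hc.intervalIntegrable _ _)
      (hc.intervalIntegrable _ _)]
    congr 1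
    simp_rw [← α.map_add']
    have := intervalIntegral.integral_comp_add_left (a := 0) (b := ε) (fun s => α s x) t
    simpa using this
  rw [HasGen]
  simp_rw [e]
  have h1 : HasDerivAt (fun t : ℝ => ∫ s in (0 : ℝ)..(t + ε), α s x) (α ε x) 0 := by
    have : HasDerivAt (fun t : ℝ => ∫ s in (0 : ℝ)..t, α s x) (α (0 + ε) x) (0 + ε) :=
      hc.integral_hasStrictDerivAt 0 (0 + ε) |>.hasDerivAt
    simpa using this.comp_add_const 0 ε
  have h2 : HasDerivAt (fun t : ℝ => ∫ s in (0 : ℝ)..t, α s x) x 0 := by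
    have := (hc.integral_hasStrictDerivAt 0 0).hasDerivAt
    simpa [α.map_zero'] using this
  exact (h1.sub h2).const_smul _

theorem tendsto_smooth (x : A) : Tendsto (fun ε => α.smooth ε x) (𝓝[≠] 0) (𝓝 x) := by
  have hc := α.continuous' x
  have h2 : HasDerivAt (fun t : ℝ => ∫ s in (0 : ℝ)..t, α s x) x 0 := by
    have := (hc.integral_hasStrictDerivAt 0 0).hasDerivAt
    simpa [α.map_zero'] using this
  have := hasDerivAt_iff_tendsto_slope_zero.1 h2
  simpa [smooth] using this

theorem smooth_mem {K : Submodule ℂ A} (hK : IsClosed (K : Set A)) {x : A}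
    (hx : ∀ s, α s x ∈ K) (ε : ℝ) : α.smooth ε x ∈ K := by
  have hc : CompleteSpace (K.restrictScalars ℝ) := IsClosed.completeSpace_coe (hs := hK)
  refine (K.restrictScalars ℝ).smul_mem _ ?_
  have hcont : Continuous fun s : ℝ => (⟨α s x, hx s⟩ : K.restrictScalars ℝ) :=
    (α.continuous' x).subtype_mk _
  have := ((K.restrictScalars ℝ).subtypeL).intervalIntegral_comp_comm
    (hcont.intervalIntegrable (μ := MeasureTheory.volume) 0 ε)
  have e : ∫ s in (0 : ℝ)..ε, α s x =
      ∫ s in (0 : ℝ)..ε, (K.restrictScalars ℝ).subtypeL ⟨α s x, hx s⟩ := rfl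
  rw [e, this]
  exact Subtype.prop _

theorem dense_domain : Dense (α.generator.domain : Set A) := fun x =>
  mem_closure_of_tendsto (tendsto_smooth (α := α) x)
    (Eventually.of_forall fun ε => (hasGen_iff.1 (hasGen_smooth ε x)).1)

/-- A finite-dimensional subspace invariant under the group lies in the domain of the generator,
which leaves it invariant. -/
theorem exists_hasGen_of_invariant (K : Submodule ℂ A) [FiniteDimensional ℂ K]
    (hK : ∀ t, ∀ x ∈ K, α t x ∈ K) {x : A} (hx : x ∈ K) : ∃ y ∈ K, α.HasGen x y := by
  have hcl : IsClosed (K : Set A) := K.closed_of_finiteDimensional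
  have hfd : FiniteDimensional ℂ (K ⊓ α.generator.domain : Submodule ℂ A) :=
    Submodule.finiteDimensional_of_le inf_le_left
  have hcl' : IsClosed ((K ⊓ α.generator.domain : Submodule ℂ A) : Set A) :=
    Submodule.closed_of_finiteDimensional _
  -- Averages of the orbit lie in `K` and in the domain. The intersection is finite-dimensional,
  -- hence closed, so it contains their limit `x`.
  have hmem : x ∈ (K ⊓ α.generator.domain : Submodule ℂ A) :=
    hcl'.mem_of_tendsto (tendsto_smooth (α := α) x) (Eventually.of_forall fun ε =>
      ⟨smooth_mem hcl (fun s => hK s x hx) ε, (hasGen_iff.1 (hasGen_smooth ε x)).1⟩)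
  have hg := hasGen_generator (α := α) ⟨x, hmem.2⟩
  refine ⟨_, ?_, hg⟩
  have ht := hasDerivAt_iff_tendsto_slope_zero.1 hg
  refine hcl.mem_of_tendsto ht (Eventually.of_forall fun t => ?_)
  simp only [zero_add, α.map_zero']
  exact (K.restrictScalars ℝ).smul_mem _ (K.sub_mem (hK t x hx) hx)

end OneParamAutGroup

/-! ### Inner perturbations, dissipativity and cores. -/

open OneParamAutGroup

@[simp] theorem adI_apply (h x : A) : adI h x = Complex.I • (h * x - x * h) := rfl

/-- `x` lies in the domain of `δ_α + ad ih`, which maps it to `y`. -/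
def HasPert (α : OneParamAutGroup A) (h x y : A) : Prop := α.HasGen x (y - adI h x)

variable {α : OneParamAutGroup A} {h : A}

theorem hasPert_iff {x y : A} : HasPert α h x y ↔
    ∃ hx : x ∈ (innerPerturbation α.generator h).domain,
      innerPerturbation α.generator h ⟨x, hx⟩ = y := by
  rw [HasPert, hasGen_iff]
  have : ∀ hx : x ∈ α.generator.domain, innerPerturbation α.generator h ⟨x, hx⟩ =
    α.generator ⟨x, hx⟩ + adI h x := fun _ => rfl
  constructor
  · rintro ⟨hx, e⟩
    exact ⟨hx, by rw [this, e]; abel⟩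
  · rintro ⟨hx, e⟩
    exact ⟨hx, by rw [← e, this hx, add_sub_cancel_right]⟩

theorem hasPert_innerPerturbation (x : (innerPerturbation α.generator h).domain) :
    HasPert α h x (innerPerturbation α.generator h x) :=
  hasPert_iff.2 ⟨x.2, rfl⟩

theorem HasPert.unique {x y z : A} (H : HasPert α h x y) (H' : HasPert α h x z) : y = z := by
  have := OneParamAutGroup.HasGen.unique H H'
  simpa using this

theorem hasPert_zero {x y : A} : HasPert α 0 x y ↔ α.HasGen x y := by simp [HasPert]

theorem HasPert.add {x y x' y' : A} (H : HasPert α h x y) (H' : HasPert α h x' y') :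
    HasPert α h (x + x') (y + y') := by
  have := OneParamAutGroup.HasGen.add H H'
  rw [HasPert]; convert this using 1; rw [map_add]; abel

theorem HasPert.sub {x y x' y' : A} (H : HasPert α h x y) (H' : HasPert α h x' y') :
    HasPert α h (x - x') (y - y') := by
  have := OneParamAutGroup.HasGen.sub H H'
  rw [HasPert]; convert this using 1; rw [map_sub]; abel

theorem HasPert.smul {x y : A} (c : ℂ) (H : HasPert α h x y) :
    HasPert α h (c • x) (c • y) := by
  have := OneParamAutGroup.HasGen.smul c H
  rw [HasPert]; convert this using 1; rw [map_smul, smul_sub]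

theorem HasPert.mul {x y x' y' : A} (H : HasPert α h x y) (H' : HasPert α h x' y') :
    HasPert α h (x * x') (y * x' + x * y') := by
  have := OneParamAutGroup.HasGen.mul H H'
  rw [HasPert]; convert this using 1
  simp only [adI_apply, sub_mul, mul_sub, smul_mul_assoc, mul_smul_comm, smul_sub, mul_assoc]
  abel

theorem HasPert.star {x y : A} (hh : IsSelfAdjoint h) (H : HasPert α h x y) :
    HasPert α h (star x) (star y) := by
  have := OneParamAutGroup.HasGen.star H
  rw [HasPert]; convert this using 1
  simp only [adI_apply, star_sub, star_smul, star_mul, hh.star_eq, Complex.star_def,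
    Complex.conj_I, neg_smul, smul_sub]
  abel

theorem hasPert_algebraMap (c : ℂ) : HasPert α h (algebraMap ℂ A c) 0 := by
  have := hasGen_algebraMap (α := α) c
  rw [HasPert]; convert this using 1
  simp [adI_apply, Algebra.commutes c h]

theorem continuous_adI (h : A) : Continuous fun x => adI h x := by
  simp only [adI_apply]; fun_prop

theorem HasPert.of_tendsto {ι : Type*} {l : Filter ι} [l.NeBot] {x y : ι → A} {x' y' : A}
    (H : ∀ i, HasPert α h (x i) (y i)) (hx : Tendsto x l (𝓝 x')) (hy : Tendsto y l (𝓝 y')) :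
    HasPert α h x' y' :=
  HasGen.of_tendsto H hx (hy.sub (((continuous_adI h).tendsto x').comp hx))

/-- The perturbed generator is dissipative. -/
theorem HasPert.norm_le (hh : IsSelfAdjoint h) {x y : A} (H : HasPert α h x y) :
    ‖x‖ ≤ ‖x - y‖ := by
  -- `y` is the derivative at `0` of the curve `e^{ith} α_t(x) e^{-ith}`, which has constant norm.
  have h1 : HasDerivAt (fun t : ℝ => NormedSpace.exp (t • (Complex.I • h)))
      (Complex.I • h) 0 := by
    simpa using hasDerivAt_exp_smul_const (𝕂 := ℝ) (Complex.I • h) (0 : ℝ)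
  have h2 : HasDerivAt (fun t : ℝ => NormedSpace.exp (t • -(Complex.I • h)))
      (-(Complex.I • h)) 0 := by
    simpa using hasDerivAt_exp_smul_const (𝕂 := ℝ) (-(Complex.I • h)) (0 : ℝ)
  have h3 := (h1.mul H).mul h2
  have h4 : HasDerivAt (fun t : ℝ => NormedSpace.exp (t • (Complex.I • h)) * α t x *
      NormedSpace.exp (t • -(Complex.I • h))) y 0 := by
    refine h3.congr_deriv ?_
    simp only [zero_smul, NormedSpace.exp_zero, α.map_zero', adI_apply, Pi.mul_apply, mul_one,
      one_mul, mul_neg,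
      mul_smul_comm, smul_mul_assoc, smul_sub]
    abel
  have hiso : ∀ t : ℝ, ‖NormedSpace.exp (t • (Complex.I • h)) * α t x *
      NormedSpace.exp (t • -(Complex.I • h))‖ = ‖x‖ := by
    intro t
    have e : t • (Complex.I • h) = Complex.I • (t • h) := smul_comm _ _ _
    have e' : t • -(Complex.I • h) = Complex.I • ((-t) • h) := by
      rw [neg_smul, smul_neg, smul_neg, smul_comm]
    have hu := (selfAdjoint.expUnitary ⟨t • h, (IsSelfAdjoint.all t).smul hh⟩).2
    have hu' := (selfAdjoint.expUnitary ⟨(-t) • h, (IsSelfAdjoint.all (-t)).smul hh⟩).2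
    rw [selfAdjoint.expUnitary_coe] at hu hu'
    rw [e, e', CStarRing.norm_mul_mem_unitary _ hu', CStarRing.norm_mem_unitary_mul _ hu,
      α.norm_map]
  have h5 := hasDerivAt_iff_tendsto_slope_zero.1 h4
  simp only [zero_add, zero_smul, NormedSpace.exp_zero, α.map_zero', one_mul, mul_one] at h5
  have h6 : Tendsto (fun t : ℝ => ‖x - t⁻¹ • (NormedSpace.exp (t • (Complex.I • h)) * α t x *
      NormedSpace.exp (t • -(Complex.I • h)) - x)‖) (𝓝[<] 0) (𝓝 ‖x - y‖) :=
    ((h5.mono_left (nhdsWithin_mono _ fun t ht => ne_of_lt ht)).const_sub x).norm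
  -- For small negative `t` put `s = -t⁻¹ > 1`. Then `x - t⁻¹ (z - x) = s z - (s - 1) x` has norm at
  -- least `s ‖x‖ - (s - 1) ‖x‖ = ‖x‖`.
  refine ge_of_tendsto h6 ?_
  filter_upwards [Ioo_mem_nhdsLT (show (-1 : ℝ) < 0 by norm_num)] with t ht
  set z := NormedSpace.exp (t • (Complex.I • h)) * α t x *
      NormedSpace.exp (t • -(Complex.I • h)) with hz
  have hs : 1 < -t⁻¹ := by
    rw [← inv_neg]; exact (one_lt_inv₀ (by linarith [ht.2])).2 (by linarith [ht.1])
  have e : x - t⁻¹ • (z - x) = (-t⁻¹) • z - (-t⁻¹ - 1) • x := by module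
  rw [e]
  refine le_trans (le_of_eq ?_) (norm_sub_norm_le _ _)
  rw [norm_smul, norm_smul, hiso t, Real.norm_of_nonneg (by linarith),
    Real.norm_of_nonneg (by linarith)]
  ring

/-- Invariant finite-dimensional subspaces with dense union are dense for the graph norm. -/
theorem isDenseInDomain_of_invariant (hh : IsSelfAdjoint h) {F : ℕ → Submodule ℂ A}
    (hfd : ∀ n, FiniteDimensional ℂ (F n)) (hd : Dense (⋃ n, (F n : Set A)))
    (hF : ∀ n, ∀ x ∈ F n, ∃ y ∈ F n, HasPert α h x y) :
    IsDenseInDomain α.generator (⋃ n, (F n : Set A)) := by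
  have hmem : ∀ {x y : A}, HasPert α h x y → x ∈ α.generator.domain :=
    fun H => (hasGen_iff.1 H).1
  refine ⟨Set.iUnion_subset fun n x hx => ?_, fun x ε hε => ?_⟩
  · obtain ⟨y, -, hy⟩ := hF n x hx
    exact hmem hy
  have hx : HasPert α h x (α.generator x + adI h x) := by
    rw [HasPert, add_sub_cancel_right]; exact hasGen_generator x
  set y : A := α.generator x + adI h x with hy
  set K : ℝ := 1 + (2 + 2 * ‖h‖) with hK
  have hK0 : 0 < K := by positivity
  -- With `y` the value of the perturbed generator at `x`, it suffices to approximate `x - y` by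
  -- some `z` and solve `u - δu = z` for the perturbed `δ`: dissipativity makes `u` close to `x`,
  -- and then `δu = u - z` is close to `y`. The constant `K` collects these errors and that of
  -- undoing the perturbation.
  obtain ⟨z, hz, hzd⟩ := hd.exists_dist_lt ((x : A) - y) (div_pos hε hK0)
  obtain ⟨n, hzn⟩ := Set.mem_iUnion.1 hz
  -- Dissipativity makes `1 - δ` injective on `F n`, hence surjective by finite dimension.
  have hex : ∃ u ∈ F n, HasPert α h u (u - z) := by
    choose g hg hgp using hF n
    let T : F n →ₗ[ℂ] F n :=
      { toFun := fun u => u - ⟨g u u.2, hg u u.2⟩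
        map_add' := by
          intro u v
          have := (hgp (u + v) (u + v).2).unique ((hgp u u.2).add (hgp v v.2))
          ext
          simp only [Submodule.coe_add, AddSubgroupClass.coe_sub] at this ⊢
          rw [this]; abel
        map_smul' := by
          intro c u
          have := (hgp (c • u) (c • u).2).unique ((hgp u u.2).smul c)
          ext
          simp only [Submodule.coe_smul, AddSubgroupClass.coe_sub, RingHom.id_apply] at this ⊢
          rw [this, smul_sub] }
    have hT : Function.Injective T := by
      rw [← LinearMap.ker_eq_bot, LinearMap.ker_eq_bot']
      intro u hu
      have h1 := (hgp u u.2).norm_le hh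
      have h2 : (u : A) - g u u.2 = 0 := congrArg Subtype.val hu
      rw [h2, norm_zero, norm_le_zero_iff] at h1
      exact Subtype.ext h1
    obtain ⟨u, hu⟩ := (LinearMap.injective_iff_surjective.1 hT) ⟨z, hzn⟩
    refine ⟨u, u.2, ?_⟩
    have h2 : (u : A) - g u u.2 = z := congrArg Subtype.val hu
    rw [← h2, sub_sub_cancel]
    exact hgp u u.2
  obtain ⟨u, hu, hup⟩ := hex
  have h1 := (hx.sub hup).norm_le hh
  have e1 : (x : A) - u - (y - (u - z)) = x - y - z := by abel
  rw [e1, ← dist_eq_norm _ z] at h1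
  refine ⟨⟨u, hmem hup⟩, Set.mem_iUnion.2 ⟨n, hu⟩, ?_⟩
  have h2 : α.generator ⟨u, hmem hup⟩ = u - z - adI h u :=
    (hasGen_generator ⟨u, hmem hup⟩).unique hup
  rw [h2]
  have h3 : α.generator x - (u - z - adI h u) = ((x : A) - u) - (x - y - z) - adI h (x - u) := by
    rw [hy, map_sub]; abel
  have h4 : ‖adI h ((x : A) - u)‖ ≤ 2 * ‖h‖ * ‖(x : A) - u‖ := by
    rw [adI_apply, norm_smul, Complex.norm_I, one_mul]
    refine (norm_sub_le _ _).trans ?_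
    have a1 := norm_mul_le h ((x : A) - u)
    have a2 := norm_mul_le ((x : A) - u) h
    linarith
  have h5 : ‖((x : A) - u) - (x - y - z) - adI h (x - u)‖ ≤
      ‖(x : A) - u‖ + ‖x - y - z‖ + 2 * ‖h‖ * ‖(x : A) - u‖ := by
    refine (norm_sub_le _ _).trans (add_le_add (norm_sub_le _ _) h4)
  rw [h3]
  calc _ ≤ ‖(x : A) - u‖ + (‖(x : A) - u‖ + ‖x - y - z‖ + 2 * ‖h‖ * ‖(x : A) - u‖) := by
        simp only; linarith
    _ ≤ K * dist ((x : A) - y) z := by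
        rw [← dist_eq_norm ((x : A) - y) z]
        have : 2 * ‖h‖ * ‖(x : A) - u‖ ≤ 2 * ‖h‖ * dist ((x : A) - y) z := by gcongr
        rw [hK]; nlinarith
    _ < ε := by
        rw [lt_div_iff₀ hK0] at hzd; linarith

theorem IsDenseInDomain.dense {S : Set A} (hS : IsDenseInDomain α.generator S) : Dense S := by
  refine Metric.dense_iff.2 fun x r hr => ?_
  obtain ⟨y, hy, hyd⟩ := (dense_domain (α := α)).exists_dist_lt x (half_pos hr)
  obtain ⟨z, hz, hzd⟩ := hS.2 ⟨y, hy⟩ (r / 2) (half_pos hr)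
  refine ⟨z, ?_, hz⟩
  rw [Metric.mem_ball]
  have h1 : dist y (z : A) < r / 2 := by
    rw [dist_eq_norm]; exact lt_of_le_of_lt (le_add_of_nonneg_right (norm_nonneg _)) hzd
  calc dist (z : A) x ≤ dist (z : A) y + dist y x := dist_triangle _ _ _
    _ < r := by rw [dist_comm _ y, dist_comm y x]; linarith

/-- Finite-dimensional subalgebras that the perturbed generator leaves invariant. -/
theorem invariant_of_hasPert (hh : IsSelfAdjoint h) {F : ℕ → NonUnitalStarSubalgebra ℂ A}
    (hF : IsIncreasingFinDim F) (hd : Dense (⋃ n, (F n : Set A)))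
    (key : ∀ n, ∀ x ∈ F n, ∃ y ∈ F n, HasPert α h x y) :
    IsDenseInDomain α.generator (⋃ n, (F n : Set A)) ∧
      ∀ n, LeavesInvariant (innerPerturbation α.generator h) (F n) := by
  refine ⟨isDenseInDomain_of_invariant hh (F := fun n => (F n).toSubmodule) (fun n => hF.2 n) hd
    key,
    fun n => ⟨fun x hx => ?_, fun x hx => ?_⟩⟩
  · obtain ⟨y, -, hy⟩ := key n x hx
    exact (hasPert_iff.1 hy).1
  · obtain ⟨y, hy, hy'⟩ := key n x hx
    rw [(hasPert_innerPerturbation x).unique hy']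
    exact hy

/-- AF locally representable perturbations leave finite-dimensional subalgebras invariant. -/
theorem exists_invariant_of_locallyRepresentable (hh : IsSelfAdjoint h) {β : OneParamAutGroup A}
    (hβ : β.generator = innerPerturbation α.generator h) (hrep : IsAFLocallyRepresentable β) :
    ∃ F : ℕ → NonUnitalStarSubalgebra ℂ A, IsIncreasingFinDim F ∧
      IsDenseInDomain α.generator (⋃ n, (F n : Set A)) ∧
      ∀ n, LeavesInvariant (innerPerturbation α.generator h) (F n) := by
  obtain ⟨F, hF, hd, hinv⟩ := hrep
  have key : ∀ n, ∀ x ∈ F n, ∃ y ∈ F n, HasPert α h x y := by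
    intro n x hx
    have := hF.2 n
    have hfd : FiniteDimensional ℂ (F n).toSubmodule := this
    obtain ⟨y, hy, hg⟩ := exists_hasGen_of_invariant (α := β) (F n).toSubmodule
      (fun t x hx => by
        have : β t x ∈ (fun x => β t x) '' (F n : Set A) := ⟨x, hx, rfl⟩
        rw [hinv n t] at this
        exact this) hx
    refine ⟨y, hy, ?_⟩
    rw [hasGen_iff, hβ] at hg
    exact hasPert_iff.2 hg
  exact ⟨F, hF, invariant_of_hasPert hh hF hd key⟩

/-! ### Maximal abelian subalgebras and commutants. -/

section Masa

theorem commute_of_mem_double_centralizer {S : Set A} (hS : ∀ x ∈ S, ∀ y ∈ S, x * y = y * x)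
    {x y : A} (hx : x ∈ S.centralizer.centralizer) (hy : y ∈ S.centralizer.centralizer) :
    x * y = y * x :=
  Set.centralizer_centralizer_comm_of_comm hS x hx y hy

/-- A property of selfadjoint elements that passes to real and imaginary parts. -/
theorem mem_of_selfAdjoint_of_commute {S : Set A} (hstar : ∀ y ∈ S, star y ∈ S)
    {B C : Submodule ℂ A} (hB : ∀ x ∈ B, star x ∈ B)
    (H : ∀ x ∈ B, IsSelfAdjoint x → (∀ y ∈ S, x * y = y * x) → x ∈ C)
    {x : A} (hx : x ∈ B) (hc : ∀ y ∈ S, x * y = y * x) : x ∈ C := by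
  have hc' : ∀ y ∈ S, star x * y = y * star x := fun y hy => by
    have := congrArg star (hc _ (hstar y hy))
    simpa using this.symm
  have h1 : x + star x ∈ C := H _ (B.add_mem hx (hB x hx)) (.add_star_self x) fun y hy => by
    rw [add_mul, mul_add, hc y hy, hc' y hy]
  have h2 : Complex.I • (x - star x) ∈ C := by
    refine H _ (B.smul_mem _ (B.sub_mem hx (hB x hx))) ?_ fun y hy => ?_
    · rw [IsSelfAdjoint, star_smul, star_sub, star_star, Complex.star_def, Complex.conj_I]
      module
    · rw [smul_mul_assoc, mul_smul_comm, sub_mul, mul_sub, hc y hy, hc' y hy]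
  have : x = (2⁻¹ : ℂ) • ((x + star x) + (-Complex.I) • (Complex.I • (x - star x))) := by
    rw [smul_smul]; simp only [neg_mul, Complex.I_mul_I, neg_neg, one_smul]; module
  rw [this]
  exact C.smul_mem _ (C.add_mem h1 (C.smul_mem _ h2))

/-- A masa of `B` contains all elements of `B` that commute with it. -/
theorem IsMasaIn.mem_of_commute {C B : NonUnitalStarSubalgebra ℂ A} (hB : IsClosed (B : Set A))
    (h : IsMasaIn C B) {x : A} (hx : x ∈ B) (hc : ∀ y ∈ C, x * y = y * x) : x ∈ C := by
  refine mem_of_selfAdjoint_of_commute (S := C) (B := B.toSubmodule) (C := C.toSubmodule)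
    (fun y hy => star_mem hy) (fun y hy => star_mem (s := B) hy) (fun x hx hsa hc => ?_) hx hc
  set S : Set A := (C : Set A) ∪ {x} with hS
  have hxB : x ∈ B := hx
  have hcomm : ∀ a ∈ S, ∀ b ∈ S, a * b = b * a := by
    rintro a (ha | rfl) b (hb | rfl)
    · exact h.prop.2.2 a ha b hb
    · exact (hc a ha).symm
    · exact hc b hb
    · rfl
  have hstar : ∀ a ∈ S, star a ∈ S := by
    rintro a (ha | rfl)
    · exact Or.inl (star_mem (s := C) ha)
    · exact Or.inr hsa
  have hSS : S ∪ star S = S := Set.union_eq_self_of_subset_right fun a ha => by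
    simpa using hstar _ ha
  -- The double commutant of the self-adjoint commuting set `C ∪ {x}` is closed and commutative, so
  -- cutting it down to `B` gives a competitor to `C`.
  set T := NonUnitalStarSubalgebra.centralizer ℂ
    (NonUnitalStarSubalgebra.centralizer ℂ S : Set A) with hT
  have hTS : (T : Set A) = S.centralizer.centralizer := by
    rw [hT, NonUnitalStarSubalgebra.coe_centralizer, StarMemClass.star_coe_eq, Set.union_self,
      NonUnitalStarSubalgebra.coe_centralizer, hSS]
  have hST : S ⊆ T := by rw [hTS]; exact Set.subset_centralizer_centralizer
  have hle := h.2 (y := B ⊓ T) ⟨?_, inf_le_left, ?_⟩ (fun c hcC => ⟨h.prop.2.1 hcC,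
    hST (Or.inl hcC)⟩)
  · exact hle ⟨hxB, hST (Or.inr rfl)⟩
  · rw [NonUnitalStarAlgebra.coe_inf, hTS]
    exact hB.inter (Set.isClosed_centralizer _)
  · rintro a ⟨-, ha⟩ b ⟨-, hb⟩
    have ha' : a ∈ (T : Set A) := ha
    have hb' : b ∈ (T : Set A) := hb
    rw [hTS] at ha' hb'
    exact commute_of_mem_double_centralizer hcomm ha' hb'

theorem isMasaIn_of_commutant {C B : NonUnitalStarSubalgebra ℂ A} (hC : IsClosed (C : Set A))
    (hle : C ≤ B) (hcomm : ∀ x ∈ C, ∀ y ∈ C, x * y = y * x)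
    (h : ∀ x ∈ B, (∀ y ∈ C, x * y = y * x) → x ∈ C) : IsMasaIn C B :=
  ⟨⟨hC, hle, hcomm⟩, fun _D hD hCD x hx => h x (hD.2.1 hx) fun y hy => hD.2.2 x hx y (hCD hy)⟩

/-- `D` is a commutative unital star subalgebra of `G` that contains its commutant in `G`. -/
structure IsMaxAb (D G : StarSubalgebra ℂ A) : Prop where
  le : D ≤ G
  comm : ∀ x ∈ D, ∀ y ∈ D, x * y = y * x
  mem : ∀ x ∈ G, (∀ y ∈ D, x * y = y * x) → x ∈ D

/-- The double commutant of `D ∪ {k}` is commutative; intersect it with `G`. This is the enlargement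
step behind the existence of masas. -/
theorem StarSubalgebra.exists_comm_of_selfAdjoint {G D : StarSubalgebra ℂ A} (hD : D ≤ G)
    (hcomm : ∀ x ∈ D, ∀ y ∈ D, x * y = y * x) {k : A} (hk : k ∈ G) (hsa : IsSelfAdjoint k)
    (hc : ∀ y ∈ D, k * y = y * k) :
    ∃ E : StarSubalgebra ℂ A, E ≤ G ∧ D ≤ E ∧ k ∈ E ∧ ∀ x ∈ E, ∀ y ∈ E, x * y = y * x := by
  set S : Set A := (D : Set A) ∪ {k} with hS
  have hScomm : ∀ a ∈ S, ∀ b ∈ S, a * b = b * a := by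
    rintro a (ha | rfl) b (hb | rfl)
    · exact hcomm a ha b hb
    · exact (hc a ha).symm
    · exact hc b hb
    · rfl
  have hstar : ∀ a ∈ S, star a ∈ S := by
    rintro a (ha | rfl)
    · exact Or.inl (star_mem (s := D) ha)
    · exact Or.inr hsa
  have hSS : S ∪ star S = S := Set.union_eq_self_of_subset_right fun a ha => by
    simpa using hstar _ ha
  set T := StarSubalgebra.centralizer ℂ (StarSubalgebra.centralizer ℂ S : Set A) with hT
  have hTS : (T : Set A) = S.centralizer.centralizer := by
    rw [hT, StarSubalgebra.coe_centralizer_centralizer, hSS]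
  have hST : S ⊆ T := by rw [hTS]; exact Set.subset_centralizer_centralizer
  refine ⟨G ⊓ T, inf_le_left, fun c hcC => ⟨hD hcC, hST (Or.inl hcC)⟩, ⟨hk, hST (Or.inr rfl)⟩, ?_⟩
  rintro a ⟨-, ha⟩ b ⟨-, hb⟩
  have ha' : a ∈ (T : Set A) := ha
  have hb' : b ∈ (T : Set A) := hb
  rw [hTS] at ha' hb'
  exact commute_of_mem_double_centralizer hScomm ha' hb'

/-- Every selfadjoint element of a finite-dimensional star subalgebra lies in a masa. -/
theorem exists_isMaxAb (G : StarSubalgebra ℂ A) [FiniteDimensional ℂ G] {k : A} (hk : k ∈ G)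
    (hsa : IsSelfAdjoint k) : ∃ D, IsMaxAb D G ∧ k ∈ D := by
  -- Maximality is obtained by maximizing the dimension, which is bounded by that of `G`.
  let P : ℕ → Prop := fun n => ∃ D : StarSubalgebra ℂ A, D ≤ G ∧ k ∈ D ∧
    (∀ x ∈ D, ∀ y ∈ D, x * y = y * x) ∧ Module.finrank ℂ D = n
  have hfd : ∀ D : StarSubalgebra ℂ A, D ≤ G → FiniteDimensional ℂ D := fun D hD =>
    Submodule.finiteDimensional_of_le (S₁ := Subalgebra.toSubmodule D.toSubalgebra)
      (S₂ := Subalgebra.toSubmodule G.toSubalgebra) hD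
  have hbd : ∀ n, P n → n ≤ Module.finrank ℂ G := by
    rintro n ⟨D, hD, -, -, rfl⟩
    exact Submodule.finrank_mono (s := Subalgebra.toSubmodule D.toSubalgebra)
      (t := Subalgebra.toSubmodule G.toSubalgebra) hD
  have h0 : ∃ n, P n := by
    obtain ⟨E, hE, -, hkE, hEc⟩ := StarSubalgebra.exists_comm_of_selfAdjoint (G := G) (D := ⊥)
      bot_le (by
        rintro x ⟨a, rfl⟩ y ⟨b, rfl⟩
        exact Algebra.commutes _ _) hk hsa (by
        rintro y ⟨b, rfl⟩
        exact (Algebra.commutes _ _).symm)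
    exact ⟨_, E, hE, hkE, hEc, rfl⟩
  classical
  obtain ⟨n, hn, hmax⟩ : ∃ n, P n ∧ ∀ m, P m → m ≤ n := by
    obtain ⟨n0, hn0⟩ := h0
    exact ⟨_, Nat.findGreatest_spec (P := P) (hbd n0 hn0) hn0,
      fun m hm => Nat.le_findGreatest (hbd m hm) hm⟩
  obtain ⟨D, hD, hkD, hDc, hDn⟩ := hn
  refine ⟨D, ⟨hD, hDc, fun x hx hc => ?_⟩, hkD⟩
  refine mem_of_selfAdjoint_of_commute (S := D) (B := Subalgebra.toSubmodule G.toSubalgebra)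
    (C := Subalgebra.toSubmodule D.toSubalgebra)
    (fun y hy => star_mem (s := D) hy) (fun y hy => star_mem (s := G) hy)
    (fun x hx hsa hc => ?_) hx hc
  obtain ⟨E, hE, hDE, hxE, hEc⟩ := StarSubalgebra.exists_comm_of_selfAdjoint hD hDc hx hsa hc
  have hEfd := hfd E hE
  have : FiniteDimensional ℂ (Subalgebra.toSubmodule E.toSubalgebra) := hEfd
  have := Submodule.eq_of_le_of_finrank_le (S₁ := Subalgebra.toSubmodule D.toSubalgebra)
      (S₂ := Subalgebra.toSubmodule E.toSubalgebra) hDE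
      ((hmax _ ⟨E, hE, hDE hkD, hEc, rfl⟩).trans hDn.ge)
  rw [this]
  exact hxE

end Masa

/-! ### Minimal projections, matrix units and inner derivations. -/

section MatrixUnits

theorem isClosed_of_finiteDimensional (D : StarSubalgebra ℂ A) [FiniteDimensional ℂ D] :
    IsClosed (D : Set A) :=
  Submodule.closed_of_finiteDimensional (Subalgebra.toSubmodule D.toSubalgebra)

/-- A finite-dimensional commutative star subalgebra is spanned by orthogonal projections. -/
theorem exists_projections (D : StarSubalgebra ℂ A) [hfd : FiniteDimensional ℂ D]
    (hc : ∀ x ∈ D, ∀ y ∈ D, x * y = y * x) :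
    ∃ (n : ℕ) (e : Fin n → A), (∀ i, e i ∈ D) ∧ (∀ i, e i ≠ 0) ∧ (∀ i, IsSelfAdjoint (e i)) ∧
      (∀ i, e i * e i = e i) ∧ (∀ i j, i ≠ j → e i * e j = 0) ∧ ∑ i, e i = 1 ∧
      ∀ d ∈ D, ∀ i, ∃ μ : ℂ, d * e i = μ • e i := by
  have hcl : IsClosed (D : Set A) := isClosed_of_finiteDimensional D
  let _ : CommCStarAlgebra D :=
    { (inferInstance : CStarAlgebra D) with
      mul_comm := fun x y => Subtype.ext (hc x x.2 y y.2) }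
  -- Distinct characters are linearly independent functionals on a finite-dimensional space.
  have hfin : Finite (WeakDual.characterSpace ℂ D) := by
    have h1 := linearIndependent_monoidHom D ℂ
    have h2 : LinearIndependent ℂ (fun χ : WeakDual.characterSpace ℂ D => (χ : D → ℂ)) :=
      h1.comp (fun χ : WeakDual.characterSpace ℂ D => ((χ : D →ₐ[ℂ] ℂ) : D →* ℂ))
        (fun χ ψ hχ => by
          ext x
          exact DFunLike.congr_fun hχ x)
    have h3 : LinearIndependent ℂ (fun χ : WeakDual.characterSpace ℂ D =>
        ((χ : D →ₐ[ℂ] ℂ) : D →ₗ[ℂ] ℂ)) :=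
      LinearIndependent.of_comp (LinearMap.ltoFun ℂ D ℂ ℂ) h2
    exact h3.finite
  have hdisc : DiscreteTopology (WeakDual.characterSpace ℂ D) := inferInstance
  classical
  have := Fintype.ofFinite (WeakDual.characterSpace ℂ D)
  let Γ := gelfandStarTransform D
  -- The spectrum is finite and discrete, so indicator functions of points are continuous; their
  -- Gelfand preimages are the projections.
  let p : WeakDual.characterSpace ℂ D → C(WeakDual.characterSpace ℂ D, ℂ) := fun χ =>
    ⟨Pi.single χ 1, continuous_of_discreteTopology⟩
  let q : WeakDual.characterSpace ℂ D → D := fun χ => Γ.symm (p χ)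
  let eqv := (Fintype.equivFin (WeakDual.characterSpace ℂ D)).symm
  have hpp : ∀ χ, p χ * p χ = p χ := fun χ => by
    ext ψ; by_cases h : ψ = χ <;> simp [p, h]
  have hpq : ∀ χ ψ, χ ≠ ψ → p χ * p ψ = 0 := fun χ ψ hne => by
    ext φ
    by_cases h : φ = χ
    · subst h; simp [p, hne]
    · simp [p, h]
  refine ⟨_, fun i => (q (eqv i) : A), fun i => (q _).2, fun i h0 => ?_, fun i => ?_, fun i => ?_,
    fun i j hij => ?_, ?_, fun d hd i => ?_⟩
  · have h1 : q (eqv i) = 0 := Subtype.ext h0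
    have h2 : p (eqv i) = 0 := by simpa [q] using h1
    have := DFunLike.congr_fun h2 (eqv i)
    simp [p] at this
  · have h1 : star (q (eqv i)) = q (eqv i) := by
      rw [← map_star]; congr 1
      ext ψ; by_cases h : ψ = eqv i <;> simp [p, h]
    exact congrArg Subtype.val h1
  · have h1 : q (eqv i) * q (eqv i) = q (eqv i) := by rw [← map_mul, hpp]
    exact congrArg Subtype.val h1
  · have h1 : q (eqv i) * q (eqv j) = 0 := by
      rw [← map_mul, hpq _ _ (fun h => hij (eqv.injective h)), map_zero]
    exact congrArg Subtype.val h1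
  · have h1 : ∑ i, q (eqv i) = 1 := by
      rw [Equiv.sum_comp eqv q, ← map_sum, ← map_one Γ.symm]
      congr 1
      ext ψ
      simp [p, Pi.single_apply]
    simpa using congrArg Subtype.val h1
  · refine ⟨Γ ⟨d, hd⟩ (eqv i), ?_⟩
    have h1 : (⟨d, hd⟩ : D) * q (eqv i) = (Γ ⟨d, hd⟩ (eqv i)) • q (eqv i) := by
      apply EquivLike.injective Γ
      rw [map_mul, map_smul]
      ext ψ
      by_cases h : ψ = eqv i
      · subst h; simp [q, p]
      · simp [q, p, h]
    exact congrArg Subtype.val h1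

/-- Partial isometries `v i` in `G` whose products `v i * star (v j)` are matrix units of `G`,
normalizing the masa `D`. -/
structure IsMatrixUnits (G D : StarSubalgebra ℂ A) {n : ℕ} (v : Fin n → A) : Prop where
  mem : ∀ i, v i ∈ G
  orth : ∀ i j, i ≠ j → star (v i) * v j = 0
  sum_eq : ∑ i, v i * star (v i) = 1
  mul_star_mul : ∀ i, v i * star (v i) * v i = v i
  range_mem : ∀ i, v i * star (v i) ∈ D
  eq_smul : ∀ x ∈ G, ∀ i j, ∃ c : ℂ, star (v i) * x * v j = c • (star (v i) * v i) ∧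
    star (v i) * x * v j = c • (star (v j) * v j)
  mul_left : ∀ d ∈ D, ∀ i, ∃ c : ℂ, d * v i = c • v i
  mul_right : ∀ d ∈ D, ∀ i, ∃ c : ℂ, v i * d = c • v i

/-- By maximality of `D`, its minimal projections `e i` satisfy `e i * G * e i = ℂ e i`. Being
linked by `e i * G * e j ≠ 0` is then an equivalence relation. In each class a representative is
fixed, and `v i` is a partial isometry from the representative's projection onto `e i`, obtained by
normalizing a nonzero element of the corner. -/
theorem exists_matrixUnits {G D : StarSubalgebra ℂ A} [hfd : FiniteDimensional ℂ G]
    (hD : IsMaxAb D G) : ∃ (n : ℕ) (v : Fin n → A), IsMatrixUnits G D v := by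
  have hDfd : FiniteDimensional ℂ D :=
    Submodule.finiteDimensional_of_le (S₁ := Subalgebra.toSubmodule D.toSubalgebra)
      (S₂ := Subalgebra.toSubmodule G.toSubalgebra) hD.le
  obtain ⟨n, e, heD, he0, hesa, hee, heo, hsum, hmul⟩ := exists_projections D hD.comm
  have heG : ∀ i, e i ∈ G := fun i => hD.le (heD i)
  have hmul' : ∀ d ∈ D, ∀ i, ∃ μ : ℂ, d * e i = μ • e i ∧ e i * d = μ • e i := fun d hd i => by
    obtain ⟨μ, hμ⟩ := hmul d hd i
    exact ⟨μ, hμ, by rw [hD.comm _ (heD i) _ hd, hμ]⟩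
  have hmin : ∀ x ∈ G, ∀ i, ∃ c : ℂ, e i * x * e i = c • e i := by
    intro x hx i
    have hy : e i * x * e i ∈ D := by
      refine hD.mem _ (mul_mem (mul_mem (heG i) hx) (heG i)) fun d hd => ?_
      obtain ⟨μ, h1, h2⟩ := hmul' d hd i
      calc e i * x * e i * d = e i * x * (e i * d) := by simp only [mul_assoc]
        _ = (d * e i) * x * e i := by rw [h2, h1]; simp
        _ = _ := by simp only [mul_assoc]
    obtain ⟨c, hc⟩ := hmul _ hy i
    exact ⟨c, by rw [← hc, mul_assoc _ (e i) (e i), hee]⟩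
  have hsq : ∀ x ∈ G, ∀ i j, ∃ c : ℂ, star (e i * x * e j) * (e i * x * e j) = c • e j := by
    intro x hx i j
    obtain ⟨c, hc⟩ := hmin (star x * e i * x)
      (mul_mem (mul_mem (star_mem hx) (heG i)) hx) j
    refine ⟨c, ?_⟩
    rw [← hc, star_mul, star_mul, (hesa i).star_eq, (hesa j).star_eq]
    calc _ = e j * (star x * (e i * e i) * x) * e j := by simp only [mul_assoc]
      _ = _ := by rw [hee]
  let R : Setoid (Fin n) :=
    { r := fun i j => ∃ x ∈ G, e i * x * e j ≠ 0
      iseqv :=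
        { refl := fun i => ⟨1, one_mem G, by rw [mul_one, hee]; exact he0 i⟩
          symm := by
            rintro i j ⟨x, hx, h⟩
            refine ⟨star x, star_mem hx, fun h0 => h ?_⟩
            have := congrArg star h0
            simpa [(hesa i).star_eq, (hesa j).star_eq, mul_assoc] using this
          trans := by
            rintro i j k ⟨x, hx, h⟩ ⟨y, hy, h'⟩
            refine ⟨x * e j * y, mul_mem (mul_mem hx (heG j)) hy, fun h0 => ?_⟩
            obtain ⟨c, hc⟩ := hsq x hx i j
            have hc0 : c ≠ 0 := by
              rintro rfl
              rw [zero_smul, CStarRing.star_mul_self_eq_zero_iff] at hc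
              exact h hc
            -- A nonzero element of the corner `e i * G * e j` has `star a * a` equal to a nonzero
            -- multiple of `e j`, so it can be cancelled on the left.
            have h1 : star (e i * x * e j) * (e i * (x * e j * y) * e k) =
                c • (e j * y * e k) := by
              calc _ = star (e i * x * e j) * (e i * x * (e j * e j)) * y * e k := by
                    rw [hee]; simp only [mul_assoc]
                _ = star (e i * x * e j) * (e i * x * e j) * e j * y * e k := by
                    simp only [mul_assoc]
                _ = _ := by
                    rw [hc]; simp only [smul_mul_assoc, hee]
            rw [h0, mul_zero] at h1
            exact h' ((smul_eq_zero.1 h1.symm).resolve_left hc0) } }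
  let r : Fin n → Fin n := fun i => (Quotient.mk R i).out
  have hr : ∀ i, ∃ x ∈ G, e i * x * e (r i) ≠ 0 := fun i =>
    R.symm (Quotient.mk_out (s := R) i)
  have hv : ∀ i, ∃ w ∈ G, e i * w = w ∧ w * e (r i) = w ∧ star w * w = e (r i) ∧
      w * star w = e i := by
    intro i
    obtain ⟨x, hx, h0⟩ := hr i
    set a := e i * x * e (r i) with ha
    have haG : a ∈ G := mul_mem (mul_mem (heG _) hx) (heG _)
    obtain ⟨c, hc⟩ := hsq x hx i (r i)
    rw [← ha] at hc
    have hc0 : c ≠ 0 := by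
      rintro rfl
      rw [zero_smul, CStarRing.star_mul_self_eq_zero_iff] at hc
      exact h0 hc
    have hreal : (starRingEnd ℂ) c = c := by
      have h1 := congrArg star hc
      rw [star_mul, star_star, star_smul, (hesa _).star_eq, hc] at h1
      have h2 : (c - star c) • e (r i) = 0 := by rw [sub_smul, h1, sub_self]
      exact (sub_eq_zero.1 ((smul_eq_zero.1 h2).resolve_right (he0 _))).symm
    obtain ⟨s, hs⟩ : ∃ s : ℝ, (s : ℂ) = c := Complex.conj_eq_iff_real.1 hreal |>.imp fun _ h =>
      h.symm
    have hs0 : 0 ≤ s := by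
      apply spectrum_star_mul_self_nonneg (b := a)
      rw [hc, ← hs, spectrum.mem_iff]
      intro hu
      refine he0 (r i) (hu.mul_left_cancel ?_)
      rw [mul_zero, sub_mul, Algebra.algebraMap_eq_smul_one, smul_mul_assoc, one_mul,
        smul_mul_assoc, hee, Complex.coe_smul, sub_self]
    have hs1 : 0 < s := lt_of_le_of_ne hs0 (fun h => hc0 (by rw [← hs, ← h]; simp))
    set t : ℝ := (Real.sqrt s)⁻¹ with ht
    have htt : (t : ℂ) * t * c = 1 := by
      rw [← hs, ht]; norm_cast
      rw [← mul_inv, Real.mul_self_sqrt hs0, inv_mul_cancel₀ hs1.ne']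
    have h1 : star ((t : ℂ) • a) * ((t : ℂ) • a) = e (r i) := by
      rw [star_smul, smul_mul_smul_comm, hc, smul_smul, Complex.star_def, Complex.conj_ofReal, htt,
        one_smul]
    have h2 : e i * ((t : ℂ) • a) = (t : ℂ) • a := by
      rw [mul_smul_comm, ha, ← mul_assoc, ← mul_assoc, hee]
    have h3 : ((t : ℂ) • a) * e (r i) = (t : ℂ) • a := by
      rw [smul_mul_assoc, ha, mul_assoc, hee]
    have hwG : (t : ℂ) • a ∈ G := SMulMemClass.smul_mem _ haG
    generalize (t : ℂ) • a = w at *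
    refine ⟨w, hwG, h2, h3, h1, ?_⟩
    -- Minimality gives `w * star w = κ • e i`, and `w = w * star w * w` forces `κ = 1`.
    obtain ⟨κ, hκ⟩ := hmin (w * star w) (mul_mem hwG (star_mem hwG)) i
    have h4 : e i * (w * star w) * e i = w * star w := by
      have : star w * e i = star w := by
        have := congrArg star h2
        simpa [(hesa i).star_eq] using this
      rw [← mul_assoc, h2, mul_assoc, this]
    rw [h4] at hκ
    have h5 : w = κ • w := by
      calc w = w * (star w * w) := by rw [h1, h3]
        _ = κ • w := by rw [← mul_assoc, hκ, smul_mul_assoc, h2]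
    have hw0 : w ≠ 0 := by
      rintro rfl
      exact he0 (r i) (by rw [← h1]; simp)
    have h6 : (1 - κ) • w = 0 := by rw [sub_smul, one_smul, ← h5, sub_self]
    have h7 : κ = 1 := (sub_eq_zero.1 ((smul_eq_zero.1 h6).resolve_right hw0)).symm
    rw [hκ, h7, one_smul]
  choose v hvG h1 h2 h3 h4 using hv
  refine ⟨n, v, hvG, fun i j hij => ?_, ?_, fun i => ?_, fun i => ?_, fun x hx i j => ?_, fun d hd
    i => ?_,
    fun d hd i => ?_⟩
  · have := congrArg star (h1 i)
    rw [star_mul, (hesa i).star_eq] at this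
    rw [← this, ← h1 j, mul_assoc, ← mul_assoc (e i), heo i j hij, zero_mul, mul_zero]
  · rw [← hsum]; exact Finset.sum_congr rfl fun i _ => h4 i
  · rw [h4, h1]
  · rw [h4]; exact heD i
  · have hform : star (v i) * x * v j = e (r i) * (star (v i) * x * v j) * e (r j) := by
      have : e (r i) * star (v i) = star (v i) := by
        have := congrArg star (h2 i)
        simpa [(hesa _).star_eq] using this
      rw [mul_assoc (e (r i)), mul_assoc (star (v i) * x), h2, ← mul_assoc, ← mul_assoc, this]
    have hG : star (v i) * x * v j ∈ G := mul_mem (mul_mem (star_mem (hvG i)) hx) (hvG j)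
    by_cases hij : r i = r j
    · obtain ⟨c, hc⟩ := hmin _ hG (r i)
      refine ⟨c, ?_, ?_⟩
      · rw [hform, h3, ← hij, hc]
      · rw [hform, h3, ← hij, hc]
    · have h0 : star (v i) * x * v j = 0 := by
        by_contra hne
        rw [hform] at hne
        apply hij
        have hrel : R (r i) (r j) := ⟨_, hG, hne⟩
        have : Quotient.mk R (r i) = Quotient.mk R (r j) := Quotient.sound hrel
        simp only [r, Quotient.out_eq] at this ⊢
        rw [this]
      exact ⟨0, by simp [h0], by simp [h0]⟩
  · obtain ⟨c, hc, -⟩ := hmul' d hd i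
    exact ⟨c, by rw [← h1 i, ← mul_assoc, hc, smul_mul_assoc]⟩
  · obtain ⟨c, -, hc⟩ := hmul' d hd (r i)
    refine ⟨c, ?_⟩
    nth_rewrite 1 [← h2 i]
    rw [mul_assoc, hc, mul_smul_comm, h2]

/-- For matrix units of `G`, a map onto the commutant of `G` that is the identity there. -/
def toCommutant {n : ℕ} (v : Fin n → A) (y : A) : A := ∑ i, v i * y * star (v i)

namespace IsMatrixUnits

variable {G D : StarSubalgebra ℂ A} {n : ℕ} {v : Fin n → A}

theorem star_mul_mul_star (hv : IsMatrixUnits G D v) (i : Fin n) :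
    star (v i) * v i * star (v i) = star (v i) := by
  have := congrArg star (hv.mul_star_mul i)
  simpa [mul_assoc] using this

theorem mul_sum (hv : IsMatrixUnits G D v) (x : A) :
    x = ∑ j, x * v j * star (v j) := by
  simp_rw [mul_assoc, ← Finset.mul_sum, hv.sum_eq, mul_one]

theorem sum_mul (hv : IsMatrixUnits G D v) (x : A) :
    x = ∑ i, v i * (star (v i) * x) := by
  simp_rw [← mul_assoc, ← Finset.sum_mul, hv.sum_eq, one_mul]

/-- Derivations of a finite-dimensional algebra are inner. -/
theorem derivation_eq (hv : IsMatrixUnits G D v) (d : G →ₗ[ℂ] A)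
    (hd : ∀ x y : G, d (x * y) = d x * y + x * d y) (x : G) :
    (∑ i, d ⟨v i, hv.mem i⟩ * star (v i)) * x - x * ∑ i, d ⟨v i, hv.mem i⟩ * star (v i) = d x := by
  choose c hc hc' using hv.eq_smul x x.2
  set w : Fin n → G := fun i => ⟨v i, hv.mem i⟩ with hw
  have h1 : (∑ i, d (w i) * star (v i)) * x = ∑ i, ∑ j, c i j • (d (w i) * star (v j)) := by
    rw [Finset.sum_mul]
    refine Finset.sum_congr rfl fun i _ => ?_
    rw [mul_assoc, hv.mul_sum (star (v i) * x), Finset.mul_sum]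
    refine Finset.sum_congr rfl fun j _ => ?_
    rw [hc', smul_mul_assoc, hv.star_mul_mul_star, mul_smul_comm]
  have h2 : ∀ j, x * w j = ∑ i, c i j • w i := by
    intro j
    ext
    rw [AddSubmonoidClass.coe_finsetSum]
    change (x : A) * v j = ∑ i, c i j • v i
    rw [hv.sum_mul ((x : A) * v j)]
    refine Finset.sum_congr rfl fun i _ => ?_
    rw [← mul_assoc (star (v i)), hc, mul_smul_comm, ← mul_assoc, hv.mul_star_mul]
  -- Apply the Leibniz rule to `x * v j = ∑ i, c i j • v i` and multiply by `star (v j)`; the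
  -- remaining double sum is the one in `h1`, and cancels.
  have h3 : (x : A) * ∑ i, d (w i) * star (v i) =
      (∑ j, ∑ i, c i j • (d (w i) * star (v j))) - d x := by
    have : ∀ j, (x : A) * (d (w j) * star (v j)) = (∑ i, c i j • (d (w i) * star (v j))) -
        d x * v j * star (v j) := by
      intro j
      have h4 := hd x (w j)
      rw [h2, map_sum] at h4
      simp only [map_smul] at h4
      have h5 : (x : A) * d (w j) = (∑ i, c i j • d (w i)) - d x * v j := by
        rw [h4]; simp [hw]
      rw [← mul_assoc, h5, sub_mul, Finset.sum_mul]
      simp only [smul_mul_assoc]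
    rw [Finset.mul_sum, Finset.sum_congr rfl fun j _ => this j, Finset.sum_sub_distrib,
      ← hv.mul_sum]
  rw [h1, h3, Finset.sum_comm]
  abel

/-- If `h` implements a *-preserving derivation, so does `-star h`, hence also the average of the
two, which is skew-adjoint. The last clause locates the implementing element: it lies in any star
subalgebra containing the terms of the explicit sum for `h`. -/
theorem exists_adI (hv : IsMatrixUnits G D v) (d : G →ₗ[ℂ] A)
    (hd : ∀ x y : G, d (x * y) = d x * y + x * d y) (hds : ∀ x : G, d (star x) = star (d x)) :
    ∃ k : A, IsSelfAdjoint k ∧ (∀ x : G, adI k x = d x) ∧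
      ∀ S : StarSubalgebra ℂ A, (∀ i, d ⟨v i, hv.mem i⟩ * star (v i) ∈ S) → k ∈ S := by
  set h := ∑ i, d ⟨v i, hv.mem i⟩ * star (v i) with hh
  have h1 := hv.derivation_eq d hd
  rw [← hh] at h1
  refine ⟨(-Complex.I / 2) • (h - star h), ?_, fun x => ?_, fun S hS => ?_⟩
  · rw [IsSelfAdjoint, star_smul, star_sub, star_star]
    have : star (-Complex.I / 2) = Complex.I / 2 := by simp
    rw [this]; module
  · have h2 : star h * x - x * star h = - d x := by
      have := congrArg star (h1 (star x))
      rw [hds, star_star, star_sub, star_mul, star_mul] at this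
      rw [← this]; simp
    rw [adI_apply, smul_mul_assoc, mul_smul_comm, ← smul_sub, smul_smul, sub_mul, mul_sub]
    have h3 : Complex.I * (-Complex.I / 2) = 1 / 2 := by
      rw [mul_div_assoc', mul_neg, Complex.I_mul_I, neg_neg]
    have h4 : h * (x : A) - star h * x - (x * h - x * star h) = (2 : ℂ) • d x := by
      have : h * (x : A) - star h * x - (x * h - x * star h) =
        (h * x - x * h) - (star h * x - x * star h) := by abel
      rw [this, h1, h2, sub_neg_eq_add, two_smul]
    rw [h3, h4, smul_smul]; norm_num
  · have : h ∈ S := sum_mem fun i _ => hS i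
    exact SMulMemClass.smul_mem _ (sub_mem this (star_mem this))

/-- The coefficients of `star (v i) * x * v j` describe both left multiplication of `x` on the `v j`
and right multiplication on the `star (v i)`, so both products are the same double sum. -/
theorem toCommutant_comm (hv : IsMatrixUnits G D v) (y : A) {x : A} (hx : x ∈ G) :
    toCommutant v y * x = x * toCommutant v y := by
  choose c hc hc' using hv.eq_smul x hx
  have h1 : toCommutant v y * x = ∑ i, ∑ j, c i j • (v i * y * star (v j)) := by
    rw [toCommutant, Finset.sum_mul]
    refine Finset.sum_congr rfl fun i _ => ?_
    rw [mul_assoc, hv.mul_sum (star (v i) * x), Finset.mul_sum]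
    refine Finset.sum_congr rfl fun j _ => ?_
    rw [hc', smul_mul_assoc, hv.star_mul_mul_star, mul_smul_comm]
  have h2 : x * toCommutant v y = ∑ j, ∑ i, c i j • (v i * y * star (v j)) := by
    rw [toCommutant, Finset.mul_sum]
    refine Finset.sum_congr rfl fun j _ => ?_
    have : x * v j = ∑ i, c i j • v i := by
      rw [hv.sum_mul (x * v j)]
      refine Finset.sum_congr rfl fun i _ => ?_
      rw [← mul_assoc (star (v i)), hc, mul_smul_comm, ← mul_assoc, hv.mul_star_mul]
    rw [← mul_assoc, ← mul_assoc, this, Finset.sum_mul, Finset.sum_mul]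
    simp only [smul_mul_assoc]
  rw [h1, h2, Finset.sum_comm]

theorem toCommutant_eq_self (hv : IsMatrixUnits G D v) {y : A} (hy : ∀ x ∈ G, y * x = x * y) :
    toCommutant v y = y := by
  rw [toCommutant]
  conv_rhs => rw [hv.mul_sum y]
  exact Finset.sum_congr rfl fun i _ => by rw [hy _ (hv.mem i)]

theorem norm_toCommutant_le (v : Fin n → A) :
    ∃ K : ℝ, 0 < K ∧ ∀ y, ‖toCommutant v y‖ ≤ K * ‖y‖ := by
  refine ⟨1 + ∑ i, ‖v i‖ * ‖star (v i)‖, by positivity, fun y => ?_⟩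
  calc ‖toCommutant v y‖ ≤ ∑ i, ‖v i * y * star (v i)‖ := norm_sum_le _ _
    _ ≤ ∑ i, (‖v i‖ * ‖star (v i)‖) * ‖y‖ := by
        refine Finset.sum_le_sum fun i _ => ?_
        refine (norm_mul_le _ _).trans ?_
        calc _ ≤ ‖v i‖ * ‖y‖ * ‖star (v i)‖ := by gcongr; exact norm_mul_le _ _
          _ = _ := by ring
    _ ≤ _ := by rw [← Finset.sum_mul]; gcongr; linarith

theorem toCommutant_sub (v : Fin n → A) (x y : A) :
    toCommutant v (x - y) = toCommutant v x - toCommutant v y := by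
  simp [toCommutant, mul_sub, sub_mul]

/-- An element commuting with the masa is assembled from elements of the commutant. -/
theorem eq_sum_of_commute (hv : IsMatrixUnits G D v) {y : A} (hy : ∀ d ∈ D, y * d = d * y) :
    y = ∑ i, v i * star (v i) * toCommutant v (star (v i) * y * v i) := by
  have key : ∀ i, v i * star (v i) * toCommutant v (star (v i) * y * v i) =
      y * v i * star (v i) := by
    intro i
    have hG : v i * star (v i) ∈ G := mul_mem (hv.mem i) (star_mem (hv.mem i))
    rw [← hv.toCommutant_comm _ hG, toCommutant, Finset.sum_mul, Finset.sum_eq_single i]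
    · calc v i * (star (v i) * y * v i) * star (v i) * (v i * star (v i))
          = (v i * star (v i)) * y * v i * (star (v i) * v i * star (v i)) := by
            simp only [mul_assoc]
        _ = y * (v i * star (v i) * v i) * star (v i) := by
            rw [hv.star_mul_mul_star, ← hy _ (hv.range_mem i)]; simp only [mul_assoc]
        _ = _ := by rw [hv.mul_star_mul]
    · intro j _ hji
      have h0 : star (v j) * (v i * star (v i)) = 0 := by
        rw [← mul_assoc, hv.orth j i hji, zero_mul]
      rw [mul_assoc, h0, mul_zero]
    · simp
  conv_lhs => rw [hv.mul_sum y]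
  exact Finset.sum_congr rfl fun i _ => (key i).symm

end IsMatrixUnits

end MatrixUnits

/-! ### Passage to unital towers. -/

section Unitize

theorem mem_adjoin_iff {F : NonUnitalStarSubalgebra ℂ A} {x : A} :
    x ∈ StarAlgebra.adjoin ℂ (F : Set A) ↔ ∃ c : ℂ, ∃ y ∈ F, x = algebraMap ℂ A c + y := by
  have h := StarAlgebra.adjoin_nonUnitalStarSubalgebra_eq_span F
  have h1 : x ∈ StarAlgebra.adjoin ℂ (F : Set A) ↔
      x ∈ (Submodule.span ℂ {1} ⊔ F.toSubmodule : Submodule ℂ A) := by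
    rw [← h]; rfl
  rw [h1, Submodule.mem_sup]
  constructor
  · rintro ⟨y, hy, z, hz, rfl⟩
    obtain ⟨c, rfl⟩ := Submodule.mem_span_singleton.1 hy
    exact ⟨c, z, hz, by rw [Algebra.algebraMap_eq_smul_one]⟩
  · rintro ⟨c, y, hy, rfl⟩
    exact ⟨_, Submodule.mem_span_singleton.2 ⟨c, rfl⟩, y, hy, by
      rw [Algebra.algebraMap_eq_smul_one]⟩

theorem finiteDimensional_adjoin (F : NonUnitalStarSubalgebra ℂ A) [FiniteDimensional ℂ F] :
    FiniteDimensional ℂ (StarAlgebra.adjoin ℂ (F : Set A)) := by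
  have h := StarAlgebra.adjoin_nonUnitalStarSubalgebra_eq_span F
  have h1 : FiniteDimensional ℂ F.toSubmodule := ‹_›
  have h2 : FiniteDimensional ℂ (Submodule.span ℂ {1} ⊔ F.toSubmodule : Submodule ℂ A) :=
    inferInstance
  rw [← h] at h2
  exact h2

/-- The unital algebras generated by an increasing sequence, preceded by the scalars. -/
def unitalTower (F : ℕ → NonUnitalStarSubalgebra ℂ A) : ℕ → StarSubalgebra ℂ A
  | 0 => ⊥
  | n + 1 => StarAlgebra.adjoin ℂ (F n : Set A)

/-- An increasing sequence of unital finite-dimensional subalgebras with dense union that starts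
with the scalars. -/
structure IsTower (G : ℕ → StarSubalgebra ℂ A) : Prop where
  mono : Monotone G
  zero : G 0 = ⊥
  finDim : ∀ n, FiniteDimensional ℂ (G n)
  dense : Dense (⋃ n, (G n : Set A))

theorem isTower_unitalTower {F : ℕ → NonUnitalStarSubalgebra ℂ A} (hF : IsIncreasingFinDim F)
    (hd : Dense (⋃ n, (F n : Set A))) : IsTower (unitalTower F) where
  mono := monotone_nat_of_le_succ fun n => by
    cases n with
    | zero => exact bot_le
    | succ n => exact StarAlgebra.adjoin_mono (hF.1 n.le_succ)
  zero := rfl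
  finDim := fun n => by
    cases n with
    | zero => exact inferInstanceAs (FiniteDimensional ℂ (⊥ : Subalgebra ℂ A))
    | succ n => have := hF.2 n; exact finiteDimensional_adjoin (F n)
  dense := hd.mono (Set.iUnion_subset fun n x hx => Set.mem_iUnion.2
    ⟨n + 1, StarAlgebra.subset_adjoin ℂ (F n : Set A) hx⟩)

theorem IsTower.commute_zero {G : ℕ → StarSubalgebra ℂ A} (hG : IsTower G) {x : A} (hx : x ∈ G 0)
    (y : A) : x * y = y * x := by
  rw [hG.zero] at hx
  obtain ⟨c, rfl⟩ := hx
  exact Algebra.commutes c y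

end Unitize

/-! ### Implementing elements on invariant algebras. -/

section Inner

variable {α : OneParamAutGroup A} {h : A}

/-- The derivation maps `G` into itself, so the terms of the implementing sum lie in `G`, and `k`
can be taken there. Any masa of `G` may supply the matrix units. -/
theorem exists_adI_of_hasPert (hh : IsSelfAdjoint h) (G : StarSubalgebra ℂ A)
    [FiniteDimensional ℂ G] (hG : ∀ x ∈ G, ∃ y ∈ G, HasPert α h x y) :
    ∃ k ∈ G, IsSelfAdjoint k ∧ ∀ x ∈ G, HasPert α h x (adI k x) := by
  choose g hg hgp using hG
  let d : G →ₗ[ℂ] A :=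
    { toFun := fun x => g x x.2
      map_add' := fun x y => (hgp _ (x + y).2).unique ((hgp x x.2).add (hgp y y.2))
      map_smul' := fun c x => (hgp _ (c • x).2).unique ((hgp x x.2).smul c) }
  obtain ⟨D, hD, -⟩ := exists_isMaxAb G (zero_mem G) (IsSelfAdjoint.zero A)
  obtain ⟨n, v, hv⟩ := exists_matrixUnits hD
  obtain ⟨k, hk, hkd, hkS⟩ := hv.exists_adI d
    (fun x y => (hgp _ (x * y).2).unique ((hgp x x.2).mul (hgp y y.2)))
    (fun x => (hgp _ (star x).2).unique ((hgp x x.2).star hh))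
  refine ⟨k, hkS G fun i => mul_mem (hg _ _) (star_mem (hv.mem i)), hk, fun x hx => ?_⟩
  rw [hkd ⟨x, hx⟩]
  exact hgp x hx

theorem exists_tower_of_invariant (hh : IsSelfAdjoint h) {F : ℕ → NonUnitalStarSubalgebra ℂ A}
    (hF : IsIncreasingFinDim F) (hd : IsDenseInDomain α.generator (⋃ n, (F n : Set A)))
    (hinv : ∀ n, LeavesInvariant (innerPerturbation α.generator h) (F n)) :
    ∃ G : ℕ → StarSubalgebra ℂ A, IsTower G ∧ ∃ k : ℕ → A, ∀ n, k n ∈ G n ∧ IsSelfAdjoint (k n) ∧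
      ∀ x ∈ G n, HasPert α h x (adI (k n) x) := by
  have hG := isTower_unitalTower hF hd.dense
  refine ⟨_, hG, ?_⟩
  have key : ∀ n, ∀ x ∈ unitalTower F n, ∃ y ∈ unitalTower F n, HasPert α h x y := by
    intro n x hx
    cases n with
    | zero =>
      obtain ⟨c, rfl⟩ := hx
      exact ⟨0, zero_mem _, hasPert_algebraMap c⟩
    | succ n =>
      obtain ⟨c, y, hy, rfl⟩ := mem_adjoin_iff.1 hx
      refine ⟨innerPerturbation α.generator h ⟨y, (hinv n).1 hy⟩,
        StarAlgebra.subset_adjoin ℂ (F n : Set A) ((hinv n).2 ⟨y, _⟩ hy), ?_⟩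
      have := (hasPert_algebraMap (α := α) (h := h) c).add
        (hasPert_innerPerturbation (α := α) (h := h) ⟨y, (hinv n).1 hy⟩)
      rwa [zero_add] at this
  have := fun n => (hG.finDim n)
  choose k hk using fun n => exists_adI_of_hasPert hh (unitalTower F n) (key n)
  exact ⟨k, hk⟩

end Inner

/-! ### Limits of inner groups and local representability. -/

section Flow

theorem exp_mem_of_mem {G : StarSubalgebra ℂ A} (hG : IsClosed (G : Set A)) {x : A} (hx : x ∈ G) :
    NormedSpace.exp x ∈ G := by
  have h := NormedSpace.exp_series_hasSum_exp' (𝕂 := ℂ) x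
  exact hG.mem_of_tendsto h (Eventually.of_forall fun s => sum_mem fun i _ =>
    SMulMemClass.smul_mem _ (pow_mem hx i))

/-- The automorphism group `Ad e^{itk}`. -/
def adExp (k : selfAdjoint A) (t : ℝ) : A ≃⋆ₐ[ℂ] A :=
  Unitary.conjStarAlgAut ℂ A (selfAdjoint.expUnitary (t • k))

theorem adExp_apply (k : selfAdjoint A) (t : ℝ) (x : A) :
    adExp k t x = NormedSpace.exp (t • (Complex.I • (k : A))) * x *
      NormedSpace.exp (t • -(Complex.I • (k : A))) := by
  have h1 : ((selfAdjoint.expUnitary (t • k) : unitary A) : A) =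
      NormedSpace.exp (t • (Complex.I • (k : A))) := by
    rw [selfAdjoint.expUnitary_coe]
    congr 1
    exact (smul_comm _ _ _)
  have h2 : star (NormedSpace.exp (t • (Complex.I • (k : A)))) =
      NormedSpace.exp (t • -(Complex.I • (k : A))) := by
    rw [NormedSpace.star_exp]
    congr 1
    rw [star_smul, star_smul, selfAdjoint.star_val_eq, Complex.star_def, Complex.conj_I]
    simp
  rw [adExp, Unitary.conjStarAlgAut_apply, h1, h2]

theorem adExp_zero (k : selfAdjoint A) (x : A) : adExp k 0 x = x := by
  simp [adExp]

theorem adExp_add (k : selfAdjoint A) (s t : ℝ) (x : A) :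
    adExp k (s + t) x = adExp k s (adExp k t x) := by
  have : selfAdjoint.expUnitary ((s + t) • k) =
      selfAdjoint.expUnitary (s • k) * selfAdjoint.expUnitary (t • k) := by
    rw [add_smul]
    exact Commute.expUnitary_add (((Commute.refl (k : A)).smul_left s).smul_right t)
  rw [adExp, this, Unitary.conjStarAlgAut_mul_apply]; rfl

theorem norm_adExp (k : selfAdjoint A) (t : ℝ) (x : A) : ‖adExp k t x‖ = ‖x‖ :=
  NonUnitalStarAlgHom.norm_map (adExp k t) (adExp k t).injective x

/-- `l - k` commutes with `k`, so `e^{itl} = e^{itk} e^{it(l-k)}`, and the second factor commutes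
with `x`. -/
theorem adExp_eq_of_commute {k l : selfAdjoint A} (hkl : ((l : A) - k) * k = k * (l - k)) (t : ℝ)
    {x : A} (hx : ((l : A) - k) * x = x * (l - k)) : adExp l t x = adExp k t x := by
  have h1 : l = k + (l - k) := by abel
  have h2 : selfAdjoint.expUnitary (t • l) =
      selfAdjoint.expUnitary (t • k) * selfAdjoint.expUnitary (t • (l - k)) := by
    nth_rewrite 1 [h1]
    rw [smul_add]
    refine Commute.expUnitary_add ?_
    have : Commute (k : A) ((l - k : selfAdjoint A) : A) := hkl.symm
    exact (this.smul_left t).smul_right t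
  rw [adExp, h2, Unitary.conjStarAlgAut_mul_apply]
  congr 1
  have hc : Commute (((l - k : selfAdjoint A) : A)) x := hx
  have h3 : Commute ((selfAdjoint.expUnitary (t • (l - k)) : unitary A) : A) x := by
    rw [selfAdjoint.expUnitary_coe]
    exact ((hc.smul_left t).smul_left Complex.I).exp_left
  rw [Unitary.conjStarAlgAut_apply, h3.eq, mul_assoc, Unitary.mul_star_self_of_mem
    (SetLike.coe_mem _), mul_one]

theorem hasDerivAt_adExp (k : selfAdjoint A) (x : A) :
    HasDerivAt (fun t => adExp k t x) (adI (k : A) x) 0 := by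
  have h1 : HasDerivAt (fun t : ℝ => NormedSpace.exp (t • (Complex.I • (k : A))))
      (Complex.I • (k : A)) 0 := by
    simpa using hasDerivAt_exp_smul_const (𝕂 := ℝ) (Complex.I • (k : A)) (0 : ℝ)
  have h2 : HasDerivAt (fun t : ℝ => NormedSpace.exp (t • -(Complex.I • (k : A))))
      (-(Complex.I • (k : A))) 0 := by
    simpa using hasDerivAt_exp_smul_const (𝕂 := ℝ) (-(Complex.I • (k : A))) (0 : ℝ)
  have h3 := (h1.mul_const x).mul h2
  have e : (fun t => adExp k t x) = fun t : ℝ => NormedSpace.exp (t • (Complex.I • (k : A))) * x *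
      NormedSpace.exp (t • -(Complex.I • (k : A))) := funext fun t => adExp_apply k t x
  rw [e]
  refine h3.congr_deriv ?_
  simp only [zero_smul, NormedSpace.exp_zero, adI_apply, one_mul, mul_one, mul_neg, smul_sub,
    smul_mul_assoc, mul_smul_comm]
  abel

theorem continuous_adExp (k : selfAdjoint A) (x : A) : Continuous fun t => adExp k t x := by
  have h : Continuous fun t : ℝ => ((selfAdjoint.expUnitary (t • k) : unitary A) : A) := by
    have : Continuous fun t : ℝ => t • k := by fun_prop
    exact continuous_subtype_val.comp (selfAdjoint.continuous_expUnitary.comp this)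
  exact (h.mul continuous_const).mul h.star

/-- The limit of inner automorphism groups that stabilize on an increasing dense sequence. -/
theorem exists_limit_group {G : ℕ → StarSubalgebra ℂ A} (hG : IsTower G) (k : ℕ → selfAdjoint A)
    (hk : ∀ n, (k n : A) ∈ G n)
    (hcomm : ∀ n m, n ≤ m → ∀ x ∈ G n, ((k m : A) - k n) * x = x * (k m - k n)) :
    ∃ β : OneParamAutGroup A, ∀ n, ∀ x ∈ G n, ∀ t, β t x = adExp (k n) t x := by
  have hstab : ∀ n m, n ≤ m → ∀ x ∈ G n, ∀ t, adExp (k m) t x = adExp (k n) t x :=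
    fun n m hnm x hx t => adExp_eq_of_commute (hcomm n m hnm _ (hk n)) t (hcomm n m hnm x hx)
  have hlim : ∀ t x, ∃ y, Tendsto (fun n => adExp (k n) t x) atTop (𝓝 y) := by
    intro t x
    refine cauchySeq_tendsto_of_complete (Metric.cauchySeq_iff'.2 fun ε hε => ?_)
    obtain ⟨y, hy, hyd⟩ := hG.dense.exists_dist_lt x (half_pos hε)
    obtain ⟨n, hn⟩ := Set.mem_iUnion.1 hy
    refine ⟨n, fun m hm => ?_⟩
    rw [dist_eq_norm] at hyd ⊢
    calc ‖adExp (k m) t x - adExp (k n) t x‖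
        = ‖adExp (k m) t (x - y) - adExp (k n) t (x - y)‖ := by
          rw [map_sub, map_sub, hstab n m hm y hn]; congr 1; abel
      _ ≤ ‖x - y‖ + ‖x - y‖ := by
          refine (norm_sub_le _ _).trans ?_
          rw [norm_adExp, norm_adExp]
      _ < ε := by linarith
  choose L hL using hlim
  have hadd : ∀ t x y, L t (x + y) = L t x + L t y := fun t x y =>
    tendsto_nhds_unique (hL t (x + y)) (by simpa only [map_add] using (hL t x).add (hL t y))
  have hmul : ∀ t x y, L t (x * y) = L t x * L t y := fun t x y =>
    tendsto_nhds_unique (hL t (x * y)) (by simpa only [map_mul] using (hL t x).mul (hL t y))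
  have hsmul : ∀ t (c : ℂ) x, L t (c • x) = c • L t x := fun t c x =>
    tendsto_nhds_unique (hL t (c • x)) (by simpa only [map_smul] using (hL t x).const_smul c)
  have hstar : ∀ t x, L t (star x) = star (L t x) := fun t x =>
    tendsto_nhds_unique (hL t (star x)) (by simpa only [map_star] using (hL t x).star)
  have hzero : ∀ x, L 0 x = x := fun x =>
    tendsto_nhds_unique (hL 0 x) (by simp only [adExp_zero]; exact tendsto_const_nhds)
  have hgrp : ∀ s t x, L (s + t) x = L s (L t x) := by
    intro s t x
    refine tendsto_nhds_unique (hL (s + t) x) ?_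
    -- All the maps are isometric, so the inner limit may be replaced by its value uniformly in `n`.
    have h1 : Tendsto (fun n => adExp (k n) s (adExp (k n) t x - L t x)) atTop (𝓝 0) := by
      rw [tendsto_zero_iff_norm_tendsto_zero]
      simp only [norm_adExp]
      rw [← tendsto_zero_iff_norm_tendsto_zero]
      simpa using (hL t x).sub_const (L t x)
    have h2 := h1.add (hL s (L t x))
    rw [zero_add] at h2
    refine h2.congr fun n => ?_
    rw [map_sub, sub_add_cancel, adExp_add]
  have hG' : ∀ n, ∀ x ∈ G n, ∀ t, L t x = adExp (k n) t x := fun n x hx t =>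
    tendsto_nhds_unique (hL t x) (tendsto_const_nhds.congr'
      ((eventually_ge_atTop n).mono fun m hm => (hstab n m hm x hx t).symm))
  have hnorm : ∀ t x, ‖L t x‖ = ‖x‖ := fun t x =>
    tendsto_nhds_unique (hL t x).norm (by simp only [norm_adExp]; exact tendsto_const_nhds)
  have hsub : ∀ t x y, L t (x - y) = L t x - L t y := fun t x y =>
    tendsto_nhds_unique (hL t (x - y)) (by simpa only [map_sub] using (hL t x).sub (hL t y))
  let β : OneParamAutGroup A :=
    { toFun := fun t =>
        { toFun := L t
          invFun := L (-t)
          left_inv := fun x => by rw [← hgrp, neg_add_cancel, hzero]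
          right_inv := fun x => by rw [← hgrp, add_neg_cancel, hzero]
          map_mul' := hmul t
          map_add' := hadd t
          map_star' := hstar t
          map_smul' := hsmul t }
      map_zero' := hzero
      map_add' := hgrp
      continuous' := fun x => by
        change Continuous fun t => L t x
        refine Metric.continuous_iff'.2 fun t ε hε => ?_
        obtain ⟨y, hy, hyd⟩ := hG.dense.exists_dist_lt x (show 0 < ε / 3 by positivity)
        obtain ⟨n, hn⟩ := Set.mem_iUnion.1 hy
        have hc : Continuous fun t => L t y := by
          simp only [hG' n y hn]; exact continuous_adExp (k n) y
        filter_upwards [Metric.continuous_iff'.1 hc t (ε / 3) (by positivity)] with s hs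
        have h1 : ∀ r, dist (L r x) (L r y) = dist x y := fun r => by
          rw [dist_eq_norm, ← hsub, hnorm, dist_eq_norm]
        calc dist (L s x) (L t x) ≤ dist (L s x) (L s y) + dist (L s y) (L t y) +
              dist (L t y) (L t x) := dist_triangle4 _ _ _ _
          _ < ε := by rw [dist_comm (L t y), h1, h1]; linarith }
  exact ⟨β, hG'⟩

variable {α : OneParamAutGroup A} {h : A}

theorem IsDenseInDomain.exists_seq {S : Set A} (hS : IsDenseInDomain α.generator S) {x y : A}
    (hxy : α.HasGen x y) : ∃ u w : ℕ → A, (∀ n, u n ∈ S ∧ α.HasGen (u n) (w n)) ∧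
      Tendsto u atTop (𝓝 x) ∧ Tendsto w atTop (𝓝 y) := by
  obtain ⟨hx, rfl⟩ := hasGen_iff.1 hxy
  choose u hu hud using fun n : ℕ => hS.2 ⟨x, hx⟩ (1 / (n + 1)) (by positivity)
  refine ⟨fun n => u n, fun n => α.generator (u n), fun n => ⟨hu n, hasGen_generator (u n)⟩, ?_, ?_⟩
  · refine tendsto_iff_norm_sub_tendsto_zero.2 (squeeze_zero (fun n => norm_nonneg _)
      (fun n => ?_) tendsto_one_div_add_atTop_nhds_zero_nat)
    rw [norm_sub_rev]
    exact (le_add_of_nonneg_right (norm_nonneg _)).trans (hud n).le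
  · refine tendsto_iff_norm_sub_tendsto_zero.2 (squeeze_zero (fun n => norm_nonneg _)
      (fun n => ?_) tendsto_one_div_add_atTop_nhds_zero_nat)
    rw [norm_sub_rev]
    exact (le_add_of_nonneg_left (norm_nonneg _)).trans (hud n).le

/-- Invariant finite-dimensional subalgebras give a locally representable group. -/
theorem exists_locallyRepresentable_of_invariant (hh : IsSelfAdjoint h)
    {F : ℕ → NonUnitalStarSubalgebra ℂ A}
    (hF : IsIncreasingFinDim F) (hd : IsDenseInDomain α.generator (⋃ n, (F n : Set A)))
    (hinv : ∀ n, LeavesInvariant (innerPerturbation α.generator h) (F n)) :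
    ∃ β : OneParamAutGroup A, β.generator = innerPerturbation α.generator h ∧
      IsAFLocallyRepresentable β := by
  obtain ⟨G, hG, k, hk⟩ := exists_tower_of_invariant hh hF hd hinv
  -- `k n` and `k m` implement the same derivation on `G n`.
  have hcomm : ∀ n m, n ≤ m → ∀ x ∈ G n, (k m - k n) * x = x * (k m - k n) := by
    intro n m hnm x hx
    have h1 := ((hk n).2.2 x hx).unique ((hk m).2.2 x (hG.mono hnm hx))
    rw [adI_apply, adI_apply] at h1
    have h2 : k n * x - x * k n = k m * x - x * k m :=
      smul_right_injective A Complex.I_ne_zero h1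
    rw [sub_mul, mul_sub, sub_eq_sub_iff_sub_eq_sub, h2]
  obtain ⟨β, hβ⟩ := exists_limit_group hG (fun n => ⟨k n, (hk n).2.1⟩) (fun n => (hk n).1) hcomm
  have hgen : ∀ n, ∀ x ∈ G n, β.HasGen x (adI (k n) x) := by
    intro n x hx
    rw [HasGen]
    simp only [hβ n x hx]
    exact hasDerivAt_adExp _ x
  have hfd : ∀ n, FiniteDimensional ℂ (Subalgebra.toSubmodule (G n).toSubalgebra) := hG.finDim
  have hadI : ∀ n, ∀ x ∈ G n, adI (k n) x ∈ G n := fun n x hx =>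
    SMulMemClass.smul_mem _ (sub_mem (mul_mem (hk n).1 hx) (mul_mem hx (hk n).1))
  have hdα : IsDenseInDomain α.generator (⋃ n, (G n : Set A)) :=
    isDenseInDomain_of_invariant hh (F := fun n => Subalgebra.toSubmodule (G n).toSubalgebra) hfd
      hG.dense fun n x hx => ⟨_, hadI n x hx, (hk n).2.2 x hx⟩
  have hdβ : IsDenseInDomain β.generator (⋃ n, (G n : Set A)) :=
    isDenseInDomain_of_invariant (h := 0) (IsSelfAdjoint.zero A)
      (F := fun n => Subalgebra.toSubmodule (G n).toSubalgebra) hfd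
      hG.dense fun n x hx => ⟨_, hadI n x hx, hasPert_zero.2 (hgen n x hx)⟩
  -- Both operators are closed, agree on the tower, and have the tower as a core.
  have hiff : ∀ x y, β.HasGen x y ↔ HasPert α h x y := by
    intro x y
    constructor
    · intro H
      obtain ⟨u, w, huw, hu, hw⟩ := hdβ.exists_seq H
      refine HasPert.of_tendsto (fun n => ?_) hu hw
      obtain ⟨m, hm⟩ := Set.mem_iUnion.1 (huw n).1
      rw [(huw n).2.unique (hgen m _ hm)]
      exact (hk m).2.2 _ hm
    · intro H
      obtain ⟨u, w, huw, hu, hw⟩ := hdα.exists_seq H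
      have hw' : Tendsto (fun n => w n + adI h (u n)) atTop (𝓝 y) := by
        have := hw.add (((continuous_adI h).tendsto x).comp hu)
        simpa using this
      refine HasGen.of_tendsto (fun n => ?_) hu hw'
      obtain ⟨m, hm⟩ := Set.mem_iUnion.1 (huw n).1
      have h1 : HasPert α h (u n) (w n + adI h (u n)) := by
        rw [HasPert, add_sub_cancel_right]; exact (huw n).2
      rw [h1.unique ((hk m).2.2 _ hm)]
      exact hgen m _ hm
  refine ⟨β, ?_, fun n => (G n).toNonUnitalStarSubalgebra, ⟨fun n m hnm => hG.mono hnm,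
    hG.finDim⟩, hG.dense, fun n t => ?_⟩
  · refine LinearPMap.ext (SetLike.ext fun x => ⟨fun hx => ?_, fun hx => ?_⟩) fun x hx hx' => ?_
    · exact (hasPert_iff.1 ((hiff x _).1 (hasGen_iff.2 ⟨hx, rfl⟩))).1
    · exact (hasGen_iff.1 ((hiff x _).2 (hasPert_iff.2 ⟨hx, rfl⟩))).1
    · exact ((hiff x _).1 (hasGen_iff.2 ⟨hx, rfl⟩)).unique (hasPert_iff.2 ⟨hx', rfl⟩)
  · have hsub : ∀ t, ∀ x ∈ G n, β t x ∈ G n := by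
      intro t x hx
      have := hG.finDim n
      have hcl := isClosed_of_finiteDimensional (G n)
      rw [hβ n x hx, adExp_apply]
      have hIk : Complex.I • k n ∈ G n := SMulMemClass.smul_mem _ (hk n).1
      have hsm : ∀ (r : ℝ) {z : A}, z ∈ G n → r • z ∈ G n := fun r z hz => by
        have : (r : ℂ) • z ∈ G n := SMulMemClass.smul_mem _ hz
        rwa [Complex.coe_smul] at this
      exact mul_mem (mul_mem (exp_mem_of_mem hcl (hsm t hIk)) hx)
        (exp_mem_of_mem hcl (hsm t (neg_mem hIk)))
    refine Set.Subset.antisymm ?_ fun x hx => ?_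
    · rintro _ ⟨x, hx, rfl⟩
      exact hsub t x hx
    · exact ⟨β (-t) x, hsub (-t) x hx, β.map_map_neg t x⟩

end Flow

/-! ### Contractive compression onto a commutant. -/

section Pinching

theorem norm_sum_le_of_orthogonal {ι : Type*} (s : Finset ι) (f : ι → A)
    (hf : ∀ i, IsSelfAdjoint (f i)) (ho : ∀ i j, i ≠ j → f i * f j = 0) {C : ℝ} (hC : 0 ≤ C)
    (h : ∀ i, ‖f i‖ ≤ C) : ‖∑ i ∈ s, f i‖ ≤ C := by
  classical
  induction s using Finset.induction with
  | empty => simpa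
  | insert j s hj ih =>
    rw [Finset.sum_insert hj, IsSelfAdjoint.norm_add_eq_max (hf j)
      (isSelfAdjoint_sum s fun i _ => hf i)]
    · exact max_le (h j) ih
    · rw [Finset.mul_sum]
      exact Finset.sum_eq_zero fun i hi => ho j i (by rintro rfl; exact hj hi)

/-- Compression to the commutant of a finite-dimensional commutative subalgebra. -/
theorem exists_pinching (D : StarSubalgebra ℂ A) [FiniteDimensional ℂ D]
    (hc : ∀ x ∈ D, ∀ y ∈ D, x * y = y * x) :
    ∃ E : A → A, (∀ x, (∀ d ∈ D, x * d = d * x) → E x = x) ∧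
      (∀ x y, ‖E x - E y‖ ≤ ‖x - y‖) ∧ (∀ x, ∀ d ∈ D, E x * d = d * E x) ∧
      ∀ G : StarSubalgebra ℂ A, D ≤ G → ∀ x ∈ G, E x ∈ G := by
  obtain ⟨n, e, heD, -, hesa, hee, heo, hsum, hmul⟩ := exists_projections D hc
  have hmul' : ∀ d ∈ D, ∀ i, ∃ μ : ℂ, d * e i = μ • e i ∧ e i * d = μ • e i := fun d hd i => by
    obtain ⟨μ, hμ⟩ := hmul d hd i
    exact ⟨μ, hμ, by rw [hc _ (heD i) _ hd, hμ]⟩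
  have hnorm : ∀ x : A, ‖∑ i, e i * x * e i‖ ≤ ‖x‖ := by
    intro x
    have hne : ∀ i, ‖e i‖ ≤ 1 := by
      intro i
      have h1 : ‖e i‖ * ‖e i‖ = ‖e i‖ := by
        rw [← CStarRing.norm_star_mul_self, (hesa i).star_eq, hee]
      by_contra! hlt
      nlinarith
    -- The square is a sum of pairwise orthogonal self-adjoint terms, whose norm is the largest of
    -- the norms; this makes the compression contractive.
    have hsq : star (∑ i, e i * x * e i) * ∑ i, e i * x * e i =
        ∑ i, star (e i * x * e i) * (e i * x * e i) := by
      rw [star_sum, Finset.sum_mul]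
      refine Finset.sum_congr rfl fun i _ => ?_
      rw [Finset.mul_sum, Finset.sum_eq_single i]
      · intro j _ hji
        rw [star_mul, star_mul, (hesa i).star_eq]
        calc e i * (star x * e i) * (e j * x * e j) =
            e i * star x * (e i * e j) * x * e j := by simp only [mul_assoc]
          _ = 0 := by rw [heo i j hji.symm]; simp
      · simp
    have h2 : ‖∑ i, e i * x * e i‖ * ‖∑ i, e i * x * e i‖ ≤ ‖x‖ * ‖x‖ := by
      rw [← CStarRing.norm_star_mul_self, hsq]
      refine norm_sum_le_of_orthogonal _ _ (fun i => IsSelfAdjoint.star_mul_self _)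
        (fun i j hij => ?_) (by positivity) fun i => ?_
      · rw [star_mul, star_mul, star_mul, star_mul, (hesa i).star_eq, (hesa j).star_eq]
        calc _ = e i * star x * e i * e i * x * (e i * e j) * star x * e j * (e j * x * e j) := by
              simp only [mul_assoc]
          _ = 0 := by rw [heo i j hij]; simp
      · rw [CStarRing.norm_star_mul_self]
        have : ‖e i * x * e i‖ ≤ ‖x‖ := by
          calc _ ≤ ‖e i‖ * ‖x‖ * ‖e i‖ := (norm_mul_le _ _).trans (by gcongr; exact norm_mul_le _ _)
            _ ≤ 1 * ‖x‖ * 1 := by gcongr <;> exact hne i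
            _ = ‖x‖ := by ring
        gcongr
    exact abs_le_of_sq_le_sq' (by nlinarith) (norm_nonneg _) |>.2
  refine ⟨fun x => ∑ i, e i * x * e i, fun x hx => ?_, fun x y => ?_, fun x d hd => ?_,
    fun G hG x hx => ?_⟩
  · have : ∀ i, e i * x * e i = x * e i := fun i => by
      rw [← hx _ (heD i), mul_assoc, hee]
    simp only [this, ← Finset.mul_sum, hsum, mul_one]
  · have : ∑ i, e i * x * e i - ∑ i, e i * y * e i = ∑ i, e i * (x - y) * e i := by
      simp [mul_sub, sub_mul]
    rw [this]; exact hnorm _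
  · rw [Finset.sum_mul, Finset.mul_sum]
    refine Finset.sum_congr rfl fun i _ => ?_
    obtain ⟨μ, h1, h2⟩ := hmul' d hd i
    rw [mul_assoc, h2, ← mul_assoc, ← mul_assoc, h1]
    simp
  · exact sum_mem fun i _ => mul_mem (mul_mem (hG (heD i)) hx) (hG (heD i))

end Pinching

/-! ### Masas adapted to a tower. -/

/-- A commutative subalgebra whose relative position to a tower is that of a canonical masa. -/
structure IsMasaTower (G : ℕ → StarSubalgebra ℂ A) (C : StarSubalgebra ℂ A) : Prop
    extends IsTower G where
  closed : IsClosed (C : Set A)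
  comm : ∀ x ∈ C, ∀ y ∈ C, x * y = y * x
  layer_mem : ∀ n, ∀ x ∈ G (n + 1), (∀ y ∈ G n, x * y = y * x) →
    (∀ c ∈ C, c ∈ G (n + 1) → (∀ y ∈ G n, c * y = y * c) → x * c = c * x) → x ∈ C

theorem IsMatrixUnits.toCommutant_commute {G D : StarSubalgebra ℂ A} {n : ℕ} {v : Fin n → A}
    (hv : IsMatrixUnits G D v) {c y : A} (hcG : ∀ x ∈ G, c * x = x * c) (hcy : c * y = y * c) :
    toCommutant v y * c = c * toCommutant v y := by
  rw [toCommutant, Finset.sum_mul, Finset.mul_sum]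
  refine Finset.sum_congr rfl fun i _ => ?_
  rw [mul_assoc, ← hcG _ (star_mem (hv.mem i)), ← mul_assoc, mul_assoc (v i), ← hcy,
    ← mul_assoc (v i), ← hcG _ (hv.mem i)]
  simp only [mul_assoc]

theorem IsMatrixUnits.toCommutant_mem {G D : StarSubalgebra ℂ A} {n : ℕ} {v : Fin n → A}
    (hv : IsMatrixUnits G D v) {G' : StarSubalgebra ℂ A} (hG' : G ≤ G') {y : A} (hy : y ∈ G') :
    toCommutant v y ∈ G' :=
  sum_mem fun i _ => mul_mem (mul_mem (hG' (hv.mem i)) hy) (star_mem (hG' (hv.mem i)))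

namespace IsMasaTower

variable {G : ℕ → StarSubalgebra ℂ A} {C : StarSubalgebra ℂ A}

/-- Induction on the stage. An element of `G (n + 1)` commuting with `C ⊓ G (n + 1)` commutes with
`C ⊓ G n`, so matrix units of `G n` express it through range projections in `C` and elements of the
layer `G (n + 1) ∩ (G n)'`. Those elements commute with the layer of `C`, hence lie in `C`. -/
theorem isMaxAb (hC : IsMasaTower G C) (n : ℕ) : IsMaxAb (C ⊓ G n) (G n) := by
  refine ⟨inf_le_right, fun x hx y hy => hC.comm x hx.1 y hy.1, ?_⟩
  induction n with
  | zero =>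
    intro x hx _
    refine ⟨?_, hx⟩
    rw [hC.zero] at hx
    exact (bot_le : (⊥ : StarSubalgebra ℂ A) ≤ C) hx
  | succ n ih =>
    intro x hx hc
    refine ⟨?_, hx⟩
    have hmax : IsMaxAb (C ⊓ G n) (G n) :=
      ⟨inf_le_right, fun x hx y hy => hC.comm x hx.1 y hy.1, ih⟩
    have := hC.finDim n
    obtain ⟨m, v, hv⟩ := exists_matrixUnits hmax
    have hle : G n ≤ G (n + 1) := hC.mono n.le_succ
    rw [hv.eq_sum_of_commute fun d hd => hc d ⟨hd.1, hle hd.2⟩]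
    refine sum_mem fun i _ => mul_mem (hv.range_mem i).1 (hC.layer_mem n _ ?_ ?_ ?_)
    · exact hv.toCommutant_mem hle (mul_mem (mul_mem (star_mem (hle (hv.mem i))) hx)
        (hle (hv.mem i)))
    · exact fun y hy => hv.toCommutant_comm _ hy
    · intro c hcC hcG hcn
      refine hv.toCommutant_commute hcn ?_
      rw [← mul_assoc, ← mul_assoc, hcn _ (star_mem (hv.mem i)), mul_assoc (star (v i)),
        ← hc c ⟨hcC, hcG⟩, mul_assoc, mul_assoc, hcn _ (hv.mem i)]
      simp only [mul_assoc]

/-- The layers `C ∩ G (k + 1) ∩ (G k)'` generate the stages: matrix units of `G n` decompose an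
element of `C ⊓ G (n + 1)` into products of elements of `C ⊓ G n` and of the next layer. -/
theorem commute_of_commute_layers (hC : IsMasaTower G C) {x : A}
    (hx : ∀ n, ∀ c ∈ C, c ∈ G (n + 1) → (∀ y ∈ G n, c * y = y * c) → x * c = c * x) (n : ℕ) :
    ∀ c ∈ C, c ∈ G n → x * c = c * x := by
  induction n with
  | zero => exact fun c _ hc => (hC.commute_zero hc x).symm
  | succ n ih =>
    intro c hcC hcG
    have := hC.finDim n
    obtain ⟨m, v, hv⟩ := exists_matrixUnits (hC.isMaxAb n)
    have hle : G n ≤ G (n + 1) := hC.mono n.le_succ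
    have key : ∀ i, toCommutant v (star (v i) * c * v i) ∈ C ∧
        x * toCommutant v (star (v i) * c * v i) = toCommutant v (star (v i) * c * v i) * x := by
      intro i
      have h1 : toCommutant v (star (v i) * c * v i) ∈ G (n + 1) :=
        hv.toCommutant_mem hle (mul_mem (mul_mem (star_mem (hle (hv.mem i))) hcG) (hle (hv.mem i)))
      have h2 : ∀ y ∈ G n, toCommutant v (star (v i) * c * v i) * y =
          y * toCommutant v (star (v i) * c * v i) := fun y hy => hv.toCommutant_comm _ hy
      have h3 : toCommutant v (star (v i) * c * v i) ∈ C := by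
        refine hC.layer_mem n _ h1 h2 fun d hdC hdG hdn => ?_
        refine hv.toCommutant_commute hdn ?_
        rw [← mul_assoc, ← mul_assoc, hdn _ (star_mem (hv.mem i)), mul_assoc (star (v i)),
          hC.comm d hdC c hcC, mul_assoc, mul_assoc, hdn _ (hv.mem i)]
        simp only [mul_assoc]
      exact ⟨h3, hx n _ h3 h1 h2⟩
    rw [hv.eq_sum_of_commute fun d hd => hC.comm c hcC d hd.1, Finset.mul_sum, Finset.sum_mul]
    refine Finset.sum_congr rfl fun i _ => ?_
    rw [← mul_assoc, ih _ (hv.range_mem i).1 (hv.range_mem i).2, mul_assoc, (key i).2, ← mul_assoc]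

/-- The commutant of the layers is the closure of the union of the finite stages. -/
theorem mem_closure_of_commute (hC : IsMasaTower G C) {x : A}
    (hx : ∀ n, ∀ c ∈ C, c ∈ G n → x * c = c * x) :
    x ∈ closure (⋃ n, ((C ⊓ G n : StarSubalgebra ℂ A) : Set A)) := by
  refine Metric.mem_closure_iff.2 fun ε hε => ?_
  obtain ⟨y, hy, hyd⟩ := hC.dense.exists_dist_lt x hε
  obtain ⟨n, hn⟩ := Set.mem_iUnion.1 hy
  have := hC.finDim n
  have hfd : FiniteDimensional ℂ (C ⊓ G n : StarSubalgebra ℂ A) :=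
    Submodule.finiteDimensional_of_le
      (S₁ := Subalgebra.toSubmodule (C ⊓ G n : StarSubalgebra ℂ A).toSubalgebra)
      (S₂ := Subalgebra.toSubmodule (G n).toSubalgebra) (inf_le_right : C ⊓ G n ≤ G n)
  -- The compression fixes `x`, contracts distances, and moves the approximant `y ∈ G n` into the
  -- commutant of `C ⊓ G n` in `G n`, which is `C ⊓ G n` itself.
  obtain ⟨E, hE1, hE2, hE3, hE4⟩ := exists_pinching (C ⊓ G n) (hC.isMaxAb n).comm
  refine ⟨E y, Set.mem_iUnion.2 ⟨n, (hC.isMaxAb n).mem _ (hE4 _ inf_le_right y hn) (hE3 y)⟩, ?_⟩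
  rw [dist_eq_norm] at hyd ⊢
  have h1 := hE2 x y
  rw [hE1 x fun d hd => hx n d hd.1 hd.2] at h1
  exact h1.trans_lt hyd

theorem mem_of_commute (hC : IsMasaTower G C) {x : A}
    (hx : ∀ n, ∀ c ∈ C, c ∈ G n → x * c = c * x) : x ∈ C :=
  closure_minimal (Set.iUnion_subset fun _ _ hy => hy.1) hC.closed (hC.mem_closure_of_commute hx)

theorem mem_of_commute_layers (hC : IsMasaTower G C) {x : A}
    (hx : ∀ n, ∀ c ∈ C, c ∈ G (n + 1) → (∀ y ∈ G n, c * y = y * c) → x * c = c * x) : x ∈ C :=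
  hC.mem_of_commute (hC.commute_of_commute_layers hx)

theorem mem_closure (hC : IsMasaTower G C) {x : A} (hx : x ∈ C) :
    x ∈ closure (⋃ n, ((C ⊓ G n : StarSubalgebra ℂ A) : Set A)) :=
  hC.mem_closure_of_commute fun _ c hc _ => hC.comm x hx c hc

theorem mem_relCommutant {B B₀ : NonUnitalStarSubalgebra ℂ A} {x : A} :
    x ∈ relCommutant B B₀ ↔ x ∈ B ∧ ∀ y ∈ B₀, x * y = y * x := by
  rw [relCommutant, NonUnitalStarAlgebra.mem_inf, NonUnitalStarSubalgebra.mem_centralizer_iff]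
  refine and_congr_right fun _ => ⟨fun h y hy => (h y hy).1.symm, fun h y hy =>
    ⟨(h y hy).symm, (h _ (star_mem (s := B₀) hy)).symm⟩⟩

theorem isClosed_relCommutant {B B₀ : NonUnitalStarSubalgebra ℂ A} (hB : IsClosed (B : Set A)) :
    IsClosed (relCommutant B B₀ : Set A) := by
  rw [relCommutant, NonUnitalStarAlgebra.coe_inf]
  exact hB.inter (Set.isClosed_centralizer _)

/-- The tower preceded by zero, as in the definition of a canonical AF masa. -/
def shiftBot (G : ℕ → StarSubalgebra ℂ A) : ℕ → NonUnitalStarSubalgebra ℂ A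
  | 0 => ⊥
  | n + 1 => (G n).toNonUnitalStarSubalgebra

theorem isCanonicalAFMasa (hC : IsMasaTower G C) :
    IsCanonicalAFMasa C.toNonUnitalStarSubalgebra := by
  refine ⟨isMasaIn_of_commutant hC.closed le_top hC.comm fun x _ hx =>
    hC.mem_of_commute fun n c hc _ => hx c hc, ?_, ?_⟩
  · refine ⟨fun n => (C ⊓ G n : StarSubalgebra ℂ A).toNonUnitalStarSubalgebra,
      ⟨fun n m hnm => inf_le_inf_left C (hC.mono hnm), fun n => ?_⟩, ?_⟩
    · have := hC.finDim n
      exact Submodule.finiteDimensional_of_le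
        (S₁ := Subalgebra.toSubmodule (C ⊓ G n : StarSubalgebra ℂ A).toSubalgebra)
        (S₂ := Subalgebra.toSubmodule (G n).toSubalgebra) (inf_le_right : C ⊓ G n ≤ G n)
    · refine Set.Subset.antisymm ?_ fun x hx => hC.mem_closure hx
      exact closure_minimal (Set.iUnion_subset fun _ _ hy => hy.1) hC.closed
  · have hcl : ∀ n, IsClosed (shiftBot G n : Set A) := by
      rintro (_ | n)
      · change IsClosed ((⊥ : NonUnitalStarSubalgebra ℂ A) : Set A)
        rw [NonUnitalStarAlgebra.coe_bot]; exact isClosed_singleton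
      · have := hC.finDim n
        exact isClosed_of_finiteDimensional (G n)
    refine ⟨shiftBot G, ⟨monotone_nat_of_le_succ ?_, ?_⟩, rfl, ?_, fun n => ?_⟩
    · rintro (_ | n)
      · exact bot_le
      · exact fun x hx => hC.mono n.le_succ hx
    · rintro (_ | n)
      · exact Module.Finite.of_surjective (0 : ℂ →ₗ[ℂ] (⊥ : NonUnitalStarSubalgebra ℂ A))
          fun x => ⟨0, Subtype.ext (NonUnitalStarAlgebra.mem_bot.1 x.2).symm⟩
      · exact hC.finDim n
    · exact hC.dense.mono (Set.iUnion_subset fun n x hx => Set.mem_iUnion.2 ⟨n + 1, hx⟩)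
    · have hr := IsMasaTower.isClosed_relCommutant (B := shiftBot G (n + 1)) (B₀ :=
        shiftBot G n) (hcl (n + 1))
      refine isMasaIn_of_commutant ?_ inf_le_right (fun x hx y hy => hC.comm x hx.1 y hy.1) ?_
      · rw [NonUnitalStarAlgebra.coe_inf]; exact IsClosed.inter hC.closed hr
      · intro x hx hc
        refine ⟨?_, hx⟩
        obtain ⟨hx1, hx2⟩ := mem_relCommutant.1 hx
        -- The shifted sequence starts at zero, so its first layer is all of `G 0`, that is, the
        -- scalars.
        rcases n with _ | n
        · have hx1 : x ∈ G 0 := hx1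
          rw [hC.zero] at hx1
          exact (bot_le : (⊥ : StarSubalgebra ℂ A) ≤ C) hx1
        · exact hC.layer_mem n x hx1 hx2 fun c hcC hcG hcn =>
            hc c ⟨hcC, mem_relCommutant.2 ⟨hcG, hcn⟩⟩

end IsMasaTower

/-- A canonical AF masa sits in a tower of unital algebras. -/
theorem IsCanonicalAFMasa.exists_isMasaTower {C : NonUnitalStarSubalgebra ℂ A}
    (hC : IsCanonicalAFMasa C) : ∃ (G : ℕ → StarSubalgebra ℂ A) (C' : StarSubalgebra ℂ A),
      IsMasaTower G C' ∧ (C' : Set A) = C := by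
  obtain ⟨hmasa, -, F, hF, hF0, hd, hrel⟩ := hC
  -- A masa of a unital algebra contains the unit, although the algebras `F n` need not.
  have h1 : (1 : A) ∈ C := hmasa.mem_of_commute isClosed_univ NonUnitalStarAlgebra.mem_top
    fun y _ => by rw [one_mul, mul_one]
  let C' : StarSubalgebra ℂ A :=
    { carrier := C
      mul_mem' := fun hx hy => mul_mem (s := C) hx hy
      one_mem' := h1
      add_mem' := fun hx hy => add_mem (s := C) hx hy
      zero_mem' := zero_mem C
      algebraMap_mem' := fun c => by
        rw [Algebra.algebraMap_eq_smul_one]; exact SMulMemClass.smul_mem (s := C) c h1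
      star_mem' := fun hx => star_mem (s := C) hx }
  refine ⟨unitalTower F, C', ⟨isTower_unitalTower hF hd, hmasa.prop.1, hmasa.prop.2.2, ?_⟩, rfl⟩
  have halg : ∀ c : ℂ, algebraMap ℂ A c ∈ C' := fun c => C'.algebraMap_mem c
  have hmem : ∀ n, ∀ x ∈ F (n + 1), (∀ y ∈ F n, x * y = y * x) →
      (∀ c ∈ C, c ∈ F (n + 1) → (∀ y ∈ F n, c * y = y * c) → x * c = c * x) → x ∈ C := by
    intro n x hx hxn hxc
    have hcl : IsClosed (F (n + 1) : Set A) := by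
      have h1 := hF.2 (n + 1)
      have : FiniteDimensional ℂ (F (n + 1)).toSubmodule := h1
      exact (F (n + 1)).toSubmodule.closed_of_finiteDimensional
    exact ((hrel n).mem_of_commute (IsMasaTower.isClosed_relCommutant hcl)
      (IsMasaTower.mem_relCommutant.2 ⟨hx, hxn⟩) fun c hc => by
        obtain ⟨h2, h3⟩ := IsMasaTower.mem_relCommutant.1 hc.2
        exact hxc c hc.1 h2 h3).1
  -- `unitalTower` lags by one index: its stage `1` is generated by `F 0 = ⊥`, so the first layer
  -- consists of scalars, and each later layer comes from a layer of `F` by adding scalars.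
  rintro (_ | n) x hx hxn hxc
  · obtain ⟨c, y, hy, rfl⟩ := mem_adjoin_iff.1 hx
    rw [hF0, NonUnitalStarAlgebra.mem_bot] at hy
    rw [hy, add_zero]
    exact halg c
  · obtain ⟨c, y, hy, rfl⟩ := mem_adjoin_iff.1 hx
    have hcomm : ∀ z, (algebraMap ℂ A c + y) * z = z * (algebraMap ℂ A c + y) ↔
        y * z = z * y := by
      intro z
      rw [add_mul, mul_add, Algebra.commutes c z, add_right_inj]
    refine add_mem (halg c) (hmem n y hy (fun z hz => ?_) fun z hzC hz hzn => ?_)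
    · exact (hcomm z).1 (hxn z (StarAlgebra.subset_adjoin ℂ (F n : Set A) hz))
    · refine (hcomm z).1 (hxc z hzC (StarAlgebra.subset_adjoin ℂ (F (n + 1) : Set A) hz)
        fun w hw => ?_)
      obtain ⟨d, u, hu, rfl⟩ := mem_adjoin_iff.1 hw
      rw [add_mul, mul_add, Algebra.commutes d z, hzn u hu]

/-! ### From invariant algebras to a canonical masa. -/

section

variable {α : OneParamAutGroup A} {h : A}

/-- The kernel of the perturbed generator. -/
def kerPert (α : OneParamAutGroup A) {h : A} (hh : IsSelfAdjoint h) : StarSubalgebra ℂ A where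
  carrier := {x | HasPert α h x 0}
  mul_mem' := fun {x y} hx hy => by
    have := HasPert.mul hx hy
    simpa using this
  add_mem' := fun {x y} hx hy => by
    have := HasPert.add hx hy
    simpa using this
  algebraMap_mem' := hasPert_algebraMap
  star_mem' := fun {x} hx => by
    have := HasPert.star hh hx
    simpa using this

theorem isClosed_kerPert (hh : IsSelfAdjoint h) : IsClosed (kerPert α hh : Set A) :=
  isClosed_of_closure_subset fun x hx => by
    obtain ⟨u, hu, hux⟩ := mem_closure_iff_seq_limit.1 hx
    exact HasPert.of_tendsto (y := fun _ => 0) hu hux tendsto_const_nhds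

/-- The difference `k (n + 1) - k n` of implementing elements lies in the relative commutant `R n`,
so some masa `D n` of `R n` contains it. Elements of `D n` commute with `k n` and with this
difference, hence are killed by the perturbed generator. Its kernel is a closed star algebra, so it
contains everything the `D n` generate. -/
theorem exists_canonicalAFMasa_of_invariant (hh : IsSelfAdjoint h)
    {F : ℕ → NonUnitalStarSubalgebra ℂ A}
    (hF : IsIncreasingFinDim F) (hd : IsDenseInDomain α.generator (⋃ n, (F n : Set A)))
    (hinv : ∀ n, LeavesInvariant (innerPerturbation α.generator h) (F n)) :
    ∃ C : NonUnitalStarSubalgebra ℂ A, IsCanonicalAFMasa C ∧ (C : Set A) ⊆ α.generator.domain := by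
  obtain ⟨G, hG, k, hk⟩ := exists_tower_of_invariant hh hF hd hinv
  let R : ℕ → StarSubalgebra ℂ A := fun n =>
    G (n + 1) ⊓ StarSubalgebra.centralizer ℂ (G n : Set A)
  have hR : ∀ n x, x ∈ R n ↔ x ∈ G (n + 1) ∧ ∀ y ∈ G n, x * y = y * x := by
    intro n x
    refine and_congr_right fun _ => ?_
    change x ∈ StarSubalgebra.centralizer ℂ (G n : Set A) ↔ _
    rw [StarSubalgebra.mem_centralizer_iff]
    exact ⟨fun h y hy => (h y hy).1.symm, fun h y hy =>
      ⟨(h y hy).symm, (h _ (star_mem (s := G n) hy)).symm⟩⟩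
  have hRfd : ∀ n, FiniteDimensional ℂ (R n) := fun n => by
    have := hG.finDim (n + 1)
    exact Submodule.finiteDimensional_of_le
      (S₁ := Subalgebra.toSubmodule (R n).toSubalgebra)
      (S₂ := Subalgebra.toSubmodule (G (n + 1)).toSubalgebra) (inf_le_left : R n ≤ G (n + 1))
  have hkR : ∀ n, k (n + 1) - k n ∈ R n := by
    intro n
    have hle := hG.mono n.le_succ
    refine (hR n _).2 ⟨sub_mem (hk (n + 1)).1 (hle (hk n).1), fun x hx => ?_⟩
    have h1 := ((hk n).2.2 x hx).unique ((hk (n + 1)).2.2 x (hle hx))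
    have h2 : k n * x - x * k n = k (n + 1) * x - x * k (n + 1) :=
      smul_right_injective A Complex.I_ne_zero h1
    rw [sub_mul, mul_sub, sub_eq_sub_iff_sub_eq_sub, h2]
  choose D hD hkD using fun n => exists_isMaxAb (R n) (hkR n) ((hk (n + 1)).2.1.sub (hk n).2.1)
  let S : Set A := ⋃ n, (D n : Set A)
  have hSn : ∀ {n m}, n ≤ m → ∀ x ∈ D n, ∀ y ∈ D m, x * y = y * x := by
    intro n m hnm x hx y hy
    rcases hnm.eq_or_lt with rfl | hlt
    · exact (hD n).comm x hx y hy
    · exact (((hR m y).1 ((hD m).le hy)).2 x (hG.mono hlt ((hR n x).1 ((hD n).le hx)).1)).symm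
  have hScomm : ∀ x ∈ S, ∀ y ∈ S, x * y = y * x := by
    intro x hx y hy
    obtain ⟨n, hn⟩ := Set.mem_iUnion.1 hx
    obtain ⟨m, hm⟩ := Set.mem_iUnion.1 hy
    rcases le_total n m with h | h
    · exact hSn h x hn y hm
    · exact (hSn h y hm x hn).symm
  have hSS : S ∪ star S = S := Set.union_eq_self_of_subset_right fun a ha => by
    obtain ⟨n, hn⟩ := Set.mem_iUnion.1 ha
    refine Set.mem_iUnion.2 ⟨n, ?_⟩
    simpa using star_mem (s := D n) hn
  let C : StarSubalgebra ℂ A := (StarAlgebra.adjoin ℂ S).topologicalClosure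
  have hCS : (C : Set A) ⊆ S.centralizer.centralizer := by
    have := StarSubalgebra.topologicalClosure_adjoin_le_centralizer_centralizer ℂ S
    refine subset_trans this ?_
    rw [StarSubalgebra.coe_centralizer_centralizer, hSS]
  have hSC : S ⊆ C := (StarAlgebra.subset_adjoin ℂ S).trans
    (StarSubalgebra.le_topologicalClosure _)
  have hker : C ≤ kerPert α hh := by
    refine StarSubalgebra.topologicalClosure_minimal (StarAlgebra.adjoin_le fun x hx => ?_)
      (isClosed_kerPert hh)
    obtain ⟨n, hn⟩ := Set.mem_iUnion.1 hx
    obtain ⟨hx1, hx2⟩ := (hR n x).1 ((hD n).le hn)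
    have h1 := (hk (n + 1)).2.2 x hx1
    -- `x` commutes with `k n ∈ G n` because it is in the layer, and with `k (n + 1) - k n` because
    -- both are in the commutative `D n`.
    have h2 : k (n + 1) * x - x * k (n + 1) = 0 := by
      have h3 := hx2 _ (hk n).1
      have h4 := (hD n).comm _ (hkD n) x hn
      rw [sub_mul, mul_sub, h3] at h4
      rw [sub_eq_zero]
      exact sub_left_injective h4
    rw [adI_apply, h2, smul_zero] at h1
    exact h1
  have hCt : IsMasaTower G C :=
    { hG with
      closed := StarSubalgebra.isClosed_topologicalClosure _
      comm := fun x hx y hy => commute_of_mem_double_centralizer hScomm (hCS hx) (hCS hy)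
      layer_mem := fun n x hx hxn hxc => hSC (Set.mem_iUnion.2 ⟨n, (hD n).mem x
        ((hR n x).2 ⟨hx, hxn⟩) fun y hy => hxc y (hSC (Set.mem_iUnion.2 ⟨n, hy⟩))
          ((hR n y).1 ((hD n).le hy)).1 ((hR n y).1 ((hD n).le hy)).2⟩) }
  exact ⟨_, hCt.isCanonicalAFMasa, fun x hx => (hasGen_iff.1 (hker hx)).1⟩

end

/-! ### Spectral cutoffs of unitaries. -/

section Peak

/-- The real part of `z⁻¹ x`. -/
def rotRe (z : ℂ) (x : A) : A := (2⁻¹ : ℂ) • (star z • x + z • star x)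

/-- A continuous function supported near `1`. -/
def peak (κ s : ℝ) : ℝ := min 1 (max 0 ((s - (1 - κ)) / κ))

theorem continuous_peak (κ : ℝ) : Continuous (peak κ) := by
  unfold peak; fun_prop

theorem peak_one {κ : ℝ} (hκ : 0 < κ) : peak κ 1 = 1 := by
  simp [peak, hκ.ne']

theorem peak_nonneg (κ s : ℝ) : 0 ≤ peak κ s := le_min zero_le_one (le_max_left _ _)

theorem peak_le_one (κ s : ℝ) : peak κ s ≤ 1 := min_le_left _ _

theorem peak_eq_zero {κ s : ℝ} (hκ : 0 < κ) (hs : s ≤ 1 - κ) : peak κ s = 0 := by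
  have : (s - (1 - κ)) / κ ≤ 0 := div_nonpos_of_nonpos_of_nonneg (by linarith) hκ.le
  rw [peak, max_eq_left this]; simp

variable {z : ℂ} {x : A} {κ : ℝ}

theorem isSelfAdjoint_rotRe (z : ℂ) (x : A) : IsSelfAdjoint (rotRe z x) := by
  rw [IsSelfAdjoint, rotRe, star_smul, star_add, star_smul, star_smul, star_star, star_star,
    add_comm (z • star x)]
  simp

theorem norm_rotRe_le [Nontrivial A] (hz : ‖z‖ = 1) (hx : x ∈ unitary A) : ‖rotRe z x‖ ≤ 1 := by
  rw [rotRe, norm_smul]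
  have h1 : ‖x‖ = 1 := CStarRing.norm_of_mem_unitary hx
  have h2 : ‖star z • x + z • star x‖ ≤ 2 := by
    refine (norm_add_le _ _).trans ?_
    rw [norm_smul, norm_smul, norm_star, norm_star, h1, hz]; norm_num
  have h3 : ‖(2⁻¹ : ℂ)‖ = 2⁻¹ := by simp
  rw [h3]; linarith

theorem star_mul_self_eq_rotRe (hz : ‖z‖ = 1) (hx : x ∈ unitary A) :
    star (x - algebraMap ℂ A z) * (x - algebraMap ℂ A z) = (2 : ℂ) • (1 - rotRe z x) := by
  have h1 : star x * x = 1 := (Unitary.mem_iff.1 hx).1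
  have h2 : star z * z = 1 := by
    rw [Complex.star_def, ← Complex.normSq_eq_conj_mul_self, Complex.normSq_eq_norm_sq, hz]; simp
  rw [Algebra.algebraMap_eq_smul_one, star_sub, star_smul, star_one, sub_mul, mul_sub, mul_sub, h1,
    smul_mul_smul_comm, h2, mul_smul_comm, smul_mul_assoc, rotRe, smul_sub, smul_smul]
  simp only [mul_one, one_mul]
  rw [mul_inv_cancel₀ two_ne_zero]
  module

theorem star_mul_self_add_eq_rotRe (hz : ‖z‖ = 1) (hx : x ∈ unitary A) :
    star (1 + star z • x) * (1 + star z • x) = (2 : ℂ) • (1 + rotRe z x) := by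
  have h1 : star x * x = 1 := (Unitary.mem_iff.1 hx).1
  have h2 : z * star z = 1 := by
    rw [Complex.star_def, mul_comm, ← Complex.normSq_eq_conj_mul_self, Complex.normSq_eq_norm_sq,
      hz]
    simp
  rw [star_add, star_smul, star_one, star_star, add_mul, mul_add, mul_add, 
    smul_mul_smul_comm, h2, h1, rotRe, smul_add, smul_smul]
  simp only [mul_one, one_mul]
  rw [mul_inv_cancel₀ two_ne_zero]
  module

/-- A spectral cutoff of the unitary `x` near `z`. -/
def cutoff (κ : ℝ) (z : ℂ) (x : A) : A := cfc (peak κ) (rotRe z x)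

theorem isSelfAdjoint_cutoff : IsSelfAdjoint (cutoff κ z x) := cfc_predicate _ _

theorem norm_cutoff_le : ‖cutoff κ z x‖ ≤ 1 :=
  norm_cfc_le zero_le_one fun s _ => by
    rw [Real.norm_of_nonneg (peak_nonneg κ s)]; exact peak_le_one κ s

/-- With `a = rotRe z x`, the identity for `star (1 + star z • x) * (1 + star z • x)` and `‖a‖ ≤ 1`
turn the hypothesis into `‖1 + a‖ = 2`. Hence `1` is in the spectrum of `a`, and there the peak
function equals `1`. -/
theorem one_le_norm_cutoff [Nontrivial A] (hκ : 0 < κ) (hz : ‖z‖ = 1) (hx : x ∈ unitary A)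
    (h : 2 ≤ ‖1 + star z • x‖) : 1 ≤ ‖cutoff κ z x‖ := by
  have hsa := isSelfAdjoint_rotRe z x
  have hle := norm_rotRe_le hz hx
  have h1 : 2 ≤ ‖1 + rotRe z x‖ := by
    have h2 : ‖1 + star z • x‖ * ‖1 + star z • x‖ = 2 * ‖1 + rotRe z x‖ := by
      rw [← CStarRing.norm_star_mul_self, star_mul_self_add_eq_rotRe hz hx, norm_smul]; simp
    nlinarith
  have h2 : ‖1 + rotRe z x‖ = 2 := by
    refine le_antisymm ?_ h1
    refine (norm_add_le _ _).trans ?_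
    rw [norm_one]; linarith
  have hmem : (1 : ℝ) ∈ spectrum ℝ (rotRe z x) := by
    rcases CStarAlgebra.norm_or_neg_norm_mem_spectrum (A := A) ((IsSelfAdjoint.one A).add hsa)
      with h3 | h3
    · rw [h2, spectrum.mem_iff] at h3
      rw [spectrum.mem_iff]
      convert h3 using 2
      rw [Algebra.algebraMap_eq_smul_one, Algebra.algebraMap_eq_smul_one, one_smul, two_smul]
      abel
    -- A spectral value `-2` of `1 + a` would give `a` the spectral value `-3`, beyond its norm.
    · exfalso
      rw [h2, spectrum.mem_iff] at h3
      have h4 : (-3 : ℝ) ∈ spectrum ℝ (rotRe z x) := by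
        rw [spectrum.mem_iff]
        convert h3 using 2
        rw [Algebra.algebraMap_eq_smul_one, Algebra.algebraMap_eq_smul_one]
        module
      have := spectrum.norm_le_norm_of_mem h4
      norm_num at this
      linarith
  have h5 := norm_apply_le_norm_cfc (𝕜 := ℝ) (peak κ) (rotRe z x) hmem
    (continuous_peak κ).continuousOn hsa
  rwa [peak_one hκ, norm_one] at h5

/-- The squared modulus of `x - z` is `2 (1 - a)`, which is at most `2 κ` wherever the peak function
is nonzero. The truncated square root `r` agrees with the modulus there and is bounded by `√(2 * κ)`
everywhere. -/
theorem norm_sub_mul_cutoff_le [Nontrivial A] (hκ : 0 < κ) (hz : ‖z‖ = 1) (hx : x ∈ unitary A)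
    (w : A) : ‖(x - algebraMap ℂ A z) * (cutoff κ z x * w)‖ ≤ √(2 * κ) * ‖cutoff κ z x * w‖ := by
  set a := rotRe z x with ha
  have hsa : IsSelfAdjoint a := isSelfAdjoint_rotRe z x
  have hle : ‖a‖ ≤ 1 := norm_rotRe_le hz hx
  set d := cutoff κ z x with hd
  have hspec : ∀ s ∈ spectrum ℝ a, s ≤ 1 := fun s hs =>
    (le_abs_self s).trans ((spectrum.norm_le_norm_of_mem hs).trans hle)
  set r : ℝ → ℝ := fun s => √(min (2 * (1 - s)) (2 * κ)) with hr
  have hrc : Continuous r := by rw [hr]; fun_prop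
  have hrf : ∀ s ∈ spectrum ℝ a, r s * peak κ s * (r s * peak κ s) =
      peak κ s * (2 * (1 - s)) * peak κ s := by
    intro s hs
    by_cases h1 : s ≤ 1 - κ
    · simp [peak_eq_zero hκ h1]
    · push Not at h1
      have h2 : r s * r s = 2 * (1 - s) := by
        rw [hr]
        simp only
        rw [min_eq_left (by linarith), Real.mul_self_sqrt (by linarith [hspec s hs])]
      linear_combination (peak κ s) ^ 2 * h2
  have hpc := continuous_peak κ
  have h1 : cfc r a * d * (cfc r a * d) = d * ((2 : ℂ) • (1 - a)) * d := by
    have e1 : cfc r a * d = cfc (fun s => r s * peak κ s) a :=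
      (cfc_mul r (peak κ) a hrc.continuousOn hpc.continuousOn).symm
    have e2 : (2 : ℂ) • (1 - a) = cfc (fun s : ℝ => 2 * (1 - s)) a := by
      rw [cfc_const_mul (2 : ℝ) (fun s => 1 - s) a, cfc_sub (fun _ => (1 : ℝ)) (fun s => s) a,
        cfc_const_one ℝ a, cfc_id' ℝ a, ← Complex.coe_smul]
      norm_num
    have e3 : d * ((2 : ℂ) • (1 - a)) * d =
        cfc (fun s => peak κ s * (2 * (1 - s)) * peak κ s) a := by
      rw [e2, cfc_mul (fun s => peak κ s * (2 * (1 - s))) (peak κ) a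
        (by fun_prop) hpc.continuousOn,
        cfc_mul (peak κ) (fun s => 2 * (1 - s)) a hpc.continuousOn (by fun_prop)]
      rfl
    rw [e1, e3, ← cfc_mul (fun s => r s * peak κ s) (fun s => r s * peak κ s) a
      (by fun_prop) (by fun_prop)]
    exact cfc_congr hrf
  have hdsa : star d = d := isSelfAdjoint_cutoff
  have hrsa : star (cfc r a) = cfc r a := (cfc_predicate r a : IsSelfAdjoint (cfc r a))
  have hcomm : cfc r a * d = d * cfc r a := cfc_commute_cfc r (peak κ) a
  have h2 : ‖(x - algebraMap ℂ A z) * (d * w)‖ = ‖cfc r a * (d * w)‖ := by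
    have h3 : ‖(x - algebraMap ℂ A z) * (d * w)‖ * ‖(x - algebraMap ℂ A z) * (d * w)‖ =
        ‖cfc r a * (d * w)‖ * ‖cfc r a * (d * w)‖ := by
      rw [← CStarRing.norm_star_mul_self, ← CStarRing.norm_star_mul_self]
      congr 1
      rw [star_mul, star_mul, star_mul, star_mul, hdsa, hrsa]
      calc _ = star w * (d * (star (x - algebraMap ℂ A z) * (x - algebraMap ℂ A z)) * d) * w := by
            simp only [mul_assoc]
        _ = star w * (cfc r a * d * (cfc r a * d)) * w := by
            rw [star_mul_self_eq_rotRe hz hx, ← h1]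
        _ = star w * (d * cfc r a * (cfc r a * d)) * w := by rw [← hcomm]
        _ = _ := by simp only [mul_assoc]
    exact (mul_self_inj (norm_nonneg _) (norm_nonneg _)).1 h3
  rw [h2]
  refine (norm_mul_le _ _).trans ?_
  gcongr
  refine norm_cfc_le (Real.sqrt_nonneg _) fun s _ => ?_
  rw [Real.norm_of_nonneg (Real.sqrt_nonneg _)]
  exact Real.sqrt_le_sqrt (min_le_right _ _)

/-- A unitary near another has a point of the spectrum of the quotient at full distance. -/
theorem exists_peak_point [Nontrivial A] {u v : A} (hu : u ∈ unitary A) (hv : v ∈ unitary A) :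
    ∃ z : ℂ, ‖z‖ = 1 ∧ ‖z - 1‖ = ‖v - u‖ ∧ 2 ≤ ‖u + star z • v‖ := by
  set x := v * star u with hx
  have hxu : x ∈ unitary A := mul_mem hv (Unitary.star_mem hu)
  have huu : star u * u = 1 := (Unitary.mem_iff.1 hu).1
  have hxv : x * u = v := by rw [hx, mul_assoc, huu, mul_one]
  have hnorm : IsStarNormal (x - 1) := by
    have h1 := (Unitary.mem_iff.1 hxu)
    refine ⟨?_⟩
    rw [Commute, SemiconjBy, star_sub, star_one, sub_mul, mul_sub, mul_sub, sub_mul, mul_sub,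
      mul_sub, h1.1, h1.2]
    simp only [mul_one, one_mul]
    abel
  -- `x - 1` is normal, so its norm is attained at a spectral point `w`; the peak point is `z = w +
  -- 1`, and `2 = 1 + star z * z` is then a spectral value of `1 + star z • x`.
  obtain ⟨w, hw, hwn⟩ := spectrum.exists_nnnorm_eq_spectralRadius (x - 1)
  rw [IsStarNormal.spectralRadius_eq_nnnorm] at hwn
  have hwn' : ‖w‖ = ‖x - 1‖ := by
    have : ‖w‖₊ = ‖x - 1‖₊ := by exact_mod_cast hwn
    exact congrArg NNReal.toReal this
  have hz : w + 1 ∈ spectrum ℂ x := by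
    rw [spectrum.mem_iff] at hw ⊢
    convert hw using 2
    rw [map_add, map_one]; abel
  have hz1 : ‖w + 1‖ = 1 := by
    simpa using spectrum.subset_circle_of_unitary hxu hz
  have hzz : star (w + 1) * (w + 1) = 1 := by
    rw [Complex.star_def, ← Complex.normSq_eq_conj_mul_self, Complex.normSq_eq_norm_sq, hz1]; simp
  refine ⟨w + 1, hz1, ?_, ?_⟩
  · rw [add_sub_cancel_right, hwn']
    have : v - u = (x - 1) * u := by rw [sub_mul, hxv, one_mul]
    rw [this, CStarRing.norm_mul_mem_unitary _ hu]
  · have h2 : (2 : ℂ) ∈ spectrum ℂ (1 + star (w + 1) • x) := by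
      rw [spectrum.mem_iff] at hz ⊢
      intro hunit
      apply hz
      have hne : w + 1 ≠ 0 := by
        intro h0; rw [h0, norm_zero] at hz1; exact zero_ne_one hz1
      have : algebraMap ℂ A (w + 1) - x =
          (w + 1) • (algebraMap ℂ A 2 - (1 + star (w + 1) • x)) := by
        rw [smul_sub, smul_add, smul_smul, mul_comm (w + 1), hzz, one_smul,
          Algebra.algebraMap_eq_smul_one, Algebra.algebraMap_eq_smul_one, smul_smul]
        module
      rw [this]
      exact (isUnit_smul_iff (Units.mk0 (w + 1) hne) _).2 hunit
    have h3 := spectrum.norm_le_norm_of_mem h2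
    have h4 : u + star (w + 1) • v = (1 + star (w + 1) • x) * u := by
      rw [add_mul, one_mul, smul_mul_assoc, hxv]
    rw [h4, CStarRing.norm_mul_mem_unitary _ hu]
    simpa using h3

end Peak

/-! ### Central sequences in a simple algebra. -/

section Central

/-- Bounded sequences that commute asymptotically with every element. -/
structure IsCentralSeq (b : ℕ → A) : Prop where
  bound : ∃ K : ℝ, ∀ m, ‖b m‖ ≤ K
  comm : ∀ y, Tendsto (fun m => b m * y - y * b m) atTop (𝓝 0)

namespace IsCentralSeq

theorem add {b c : ℕ → A} (hb : IsCentralSeq b) (hc : IsCentralSeq c) :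
    IsCentralSeq fun m => b m + c m := by
  obtain ⟨K, hK⟩ := hb.bound
  obtain ⟨L, hL⟩ := hc.bound
  refine ⟨⟨K + L, fun m => (norm_add_le _ _).trans (add_le_add (hK m) (hL m))⟩, fun y => ?_⟩
  have := (hb.comm y).add (hc.comm y)
  rw [zero_add] at this
  refine this.congr fun m => ?_
  rw [add_mul, mul_add]; abel

theorem tendsto_bdd_mul {b c : ℕ → A} {K : ℝ} (hK : ∀ m, ‖b m‖ ≤ K)
    (hc : Tendsto c atTop (𝓝 0)) : Tendsto (fun m => b m * c m) atTop (𝓝 0) := by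
  refine squeeze_zero_norm (a := fun m => K * ‖c m‖) (fun m => ?_) ?_
  · exact (norm_mul_le _ _).trans (by gcongr; exact hK m)
  · simpa using (tendsto_zero_iff_norm_tendsto_zero.1 hc).const_mul K

theorem tendsto_mul_bdd {b c : ℕ → A} {K : ℝ} (hK : ∀ m, ‖b m‖ ≤ K)
    (hc : Tendsto c atTop (𝓝 0)) : Tendsto (fun m => c m * b m) atTop (𝓝 0) := by
  refine squeeze_zero_norm (a := fun m => ‖c m‖ * K) (fun m => ?_) ?_
  · exact (norm_mul_le _ _).trans (by gcongr; exact hK m)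
  · simpa using (tendsto_zero_iff_norm_tendsto_zero.1 hc).mul_const K

theorem mul {b c : ℕ → A} (hb : IsCentralSeq b) (hc : IsCentralSeq c) :
    IsCentralSeq fun m => b m * c m := by
  obtain ⟨K, hK⟩ := hb.bound
  obtain ⟨L, hL⟩ := hc.bound
  have hK0 : 0 ≤ K := (norm_nonneg _).trans (hK 0)
  refine ⟨⟨K * L, fun m => (norm_mul_le _ _).trans
    (mul_le_mul (hK m) (hL m) (norm_nonneg _) hK0)⟩, fun y => ?_⟩
  have := (tendsto_bdd_mul hK (hc.comm y)).add (tendsto_mul_bdd hL (hb.comm y))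
  rw [zero_add] at this
  refine this.congr fun m => ?_
  rw [mul_sub, sub_mul]; simp only [mul_assoc]; abel

theorem const (c : ℂ) : IsCentralSeq fun _ => algebraMap ℂ A c := by
  refine ⟨⟨_, fun _ => le_rfl⟩, fun y => ?_⟩
  simp only [Algebra.commutes c y, sub_self]
  exact tendsto_const_nhds

theorem star {b : ℕ → A} (hb : IsCentralSeq b) : IsCentralSeq fun m => star (b m) := by
  obtain ⟨K, hK⟩ := hb.bound
  refine ⟨⟨K, fun m => by rw [norm_star]; exact hK m⟩, fun y => ?_⟩
  have := (hb.comm (Star.star y)).star.neg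
  rw [star_zero, neg_zero] at this
  refine this.congr fun m => ?_
  simp

theorem smul_bdd {b : ℕ → A} (hb : IsCentralSeq b) {z : ℕ → ℂ} {L : ℝ} (hz : ∀ m, ‖z m‖ ≤ L) :
    IsCentralSeq fun m => z m • b m := by
  obtain ⟨K, hK⟩ := hb.bound
  have hL0 : 0 ≤ L := (norm_nonneg _).trans (hz 0)
  refine ⟨⟨L * K, fun m => ?_⟩, fun y => ?_⟩
  · rw [norm_smul]
    exact mul_le_mul (hz m) (hK m) (norm_nonneg _) hL0
  · refine squeeze_zero_norm (a := fun m => L * ‖b m * y - y * b m‖) (fun m => ?_) ?_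
    · rw [smul_mul_assoc, mul_smul_comm, ← smul_sub, norm_smul]
      gcongr; exact hz m
    · simpa using (tendsto_zero_iff_norm_tendsto_zero.1 (hb.comm y)).const_mul L

theorem of_approx {b : ℕ → A}
    (h : ∀ ε > 0, ∃ c : ℕ → A, IsCentralSeq c ∧ ∀ m, ‖b m - c m‖ ≤ ε) : IsCentralSeq b := by
  refine ⟨?_, fun y => ?_⟩
  · obtain ⟨c, hc, hbc⟩ := h 1 one_pos
    obtain ⟨K, hK⟩ := hc.bound
    refine ⟨1 + K, fun m => ?_⟩
    calc ‖b m‖ = ‖(b m - c m) + c m‖ := by rw [sub_add_cancel]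
      _ ≤ _ := (norm_add_le _ _).trans (add_le_add (hbc m) (hK m))
  · rw [Metric.tendsto_atTop]
    intro ε hε
    obtain ⟨c, hc, hbc⟩ := h (ε / (4 * (‖y‖ + 1))) (by positivity)
    obtain ⟨N, hN⟩ := Metric.tendsto_atTop.1 (hc.comm y) (ε / 2) (by positivity)
    refine ⟨N, fun m hm => ?_⟩
    have h1 := hN m hm
    rw [dist_zero_right] at h1 ⊢
    have e : b m * y - y * b m = (b m - c m) * y - y * (b m - c m) + (c m * y - y * c m) := by
      rw [sub_mul, mul_sub]; abel
    have h2 : ‖b m - c m‖ * ‖y‖ ≤ ε / 4 := by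
      calc ‖b m - c m‖ * ‖y‖ ≤ (ε / (4 * (‖y‖ + 1))) * (‖y‖ + 1) := by
            gcongr
            · exact hbc m
            · linarith
        _ = ε / 4 := by field_simp
    rw [e]
    calc _ ≤ ‖(b m - c m) * y‖ + ‖y * (b m - c m)‖ + ‖c m * y - y * c m‖ :=
          (norm_add_le _ _).trans (by gcongr; exact norm_sub_le _ _)
      _ ≤ ‖b m - c m‖ * ‖y‖ + ‖y‖ * ‖b m - c m‖ + ‖c m * y - y * c m‖ := by
          gcongr <;> exact norm_mul_le _ _
      _ < ε := by linarith

theorem aeval {b : ℕ → A} (hb : IsCentralSeq b) (p : Polynomial ℝ) :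
    IsCentralSeq fun m => Polynomial.aeval (b m) p := by
  induction p using Polynomial.induction_on' with
  | add p q hp hq => simpa only [map_add] using hp.add hq
  | monomial n r =>
    have hpow : IsCentralSeq fun m => (b m) ^ n := by
      induction n with
      | zero => simpa using const (A := A) 1
      | succ n ih => simpa only [pow_succ] using ih.mul hb
    have h1 := (const (A := A) (algebraMap ℝ ℂ r)).mul hpow
    rw [← IsScalarTower.algebraMap_apply ℝ ℂ A r] at h1
    simpa only [Polynomial.aeval_monomial] using h1

/-- All spectra lie in `[-1, 1]`, so one Weierstrass polynomial approximates `f` uniformly in `m`,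
and polynomials preserve central sequences. -/
theorem cfc {b : ℕ → A} (hb : IsCentralSeq b) (hsa : ∀ m, IsSelfAdjoint (b m))
    (hle : ∀ m, ‖b m‖ ≤ 1) [Nontrivial A] {f : ℝ → ℝ} (hf : Continuous f) :
    IsCentralSeq fun m => cfc f (b m) := by
  refine of_approx fun ε hε => ?_
  obtain ⟨p, hp⟩ := exists_polynomial_near_of_continuousOn (-1) 1 f hf.continuousOn ε hε
  refine ⟨_, hb.aeval p, fun m => ?_⟩
  have hm := hsa m
  rw [← cfc_polynomial (R := ℝ) p (b m), ← cfc_sub f p.eval (b m) hf.continuousOn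
    p.continuous.continuousOn]
  refine norm_cfc_le hε.le fun s hs => ?_
  have h1 := (spectrum.norm_le_norm_of_mem hs).trans (hle m)
  rw [Real.norm_eq_abs, abs_le] at h1
  rw [norm_sub_rev]
  exact (hp s h1).le

theorem cutoff [Nontrivial A] {b : ℕ → A} (hb : IsCentralSeq b) (hu : ∀ m, b m ∈ unitary A)
    {z : ℕ → ℂ} (hz : ∀ m, ‖z m‖ = 1) (κ : ℝ) : IsCentralSeq fun m => cutoff κ (z m) (b m) := by
  refine IsCentralSeq.cfc ?_ (fun m => isSelfAdjoint_rotRe _ _)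
    (fun m => norm_rotRe_le (hz m) (hu m)) (continuous_peak κ)
  have h1 : IsCentralSeq fun m => Star.star (z m) • b m + z m • Star.star (b m) :=
    (hb.smul_bdd (L := 1) fun m => by rw [norm_star, hz m]).add
      (hb.star.smul_bdd (L := 1) fun m => (hz m).le)
  exact h1.smul_bdd (z := fun _ => 2⁻¹) (L := 1) fun m => by norm_num

/-- In a simple algebra, products with central sequences do not vanish asymptotically. -/
theorem frequently_norm_mul (hA : IsSimpleCStar A) {b : ℕ → A} (hb : IsCentralSeq b)
    (h1 : ∀ m, 1 ≤ ‖b m‖) {d : A} (hd : d ≠ 0) :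
    ∃ ρ > 0, ∃ᶠ m in atTop, ρ ≤ ‖d * b m‖ := by
  obtain ⟨K, hK⟩ := hb.bound
  -- Centrality of `b` makes this left ideal two-sided, boundedness makes it closed, and `1 ≤ ‖b m‖`
  -- excludes the unit; simplicity leaves only zero.
  let I : TwoSidedIdeal A := TwoSidedIdeal.mk' {y | Tendsto (fun m => y * b m) atTop (𝓝 0)}
    (by simp)
    (fun {x y} hx hy => by
      have := Tendsto.add hx hy
      simpa only [Set.mem_ofPred_eq, add_mul, add_zero] using this)
    (fun {x} hx => by
      have := Tendsto.neg hx
      simpa only [Set.mem_ofPred_eq, neg_mul, neg_zero] using this)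
    (fun {x y} hy => by
      have := Tendsto.const_mul x hy
      simpa only [Set.mem_ofPred_eq, mul_assoc, mul_zero] using this)
    (fun {x y} hx => by
      have h2 := (Tendsto.mul_const y hx).sub ((hb.comm y).const_mul x)
      rw [zero_mul, mul_zero, sub_zero] at h2
      refine h2.congr fun m => ?_
      rw [mul_sub]; simp only [mul_assoc]; abel)
  have hI : ∀ y, y ∈ I ↔ Tendsto (fun m => y * b m) atTop (𝓝 0) := fun y =>
    TwoSidedIdeal.mem_mk' _ _ _ _ _ _ _
  have hcl : IsClosed (I : Set A) := by
    refine isClosed_of_closure_subset fun y hy => ?_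
    refine (hI y).2 (Metric.tendsto_atTop.2 fun ε hε => ?_)
    have hK0 : 0 ≤ K := (norm_nonneg _).trans (hK 0)
    obtain ⟨w, hw, hwd⟩ := Metric.mem_closure_iff.1 hy (ε / (2 * (K + 1))) (by positivity)
    obtain ⟨N, hN⟩ := Metric.tendsto_atTop.1 ((hI w).1 hw) (ε / 2) (by positivity)
    refine ⟨N, fun m hm => ?_⟩
    have h2 := hN m hm
    rw [dist_zero_right] at h2 ⊢
    rw [dist_eq_norm] at hwd
    calc ‖y * b m‖ = ‖(y - w) * b m + w * b m‖ := by rw [sub_mul, sub_add_cancel]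
      _ ≤ ‖y - w‖ * ‖b m‖ + ‖w * b m‖ := (norm_add_le _ _).trans (by gcongr; exact norm_mul_le _ _)
      _ ≤ (ε / (2 * (K + 1))) * (K + 1) + ‖w * b m‖ := by
          gcongr
          linarith [hK m]
      _ = ε / 2 + ‖w * b m‖ := by congr 1; field_simp
      _ < ε := by linarith
  have hbot : I = ⊥ := by
    refine (hA.2 I hcl).resolve_right fun htop => ?_
    have h2 : (1 : A) ∈ I := by rw [htop]; trivial
    have h3 := tendsto_zero_iff_norm_tendsto_zero.1 ((hI 1).1 h2)
    simp only [one_mul] at h3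
    exact absurd (ge_of_tendsto' h3 h1) (by norm_num)
  by_contra! hcon
  have : d ∈ I := (hI d).2 (Metric.tendsto_atTop.2 fun ε hε => by
    have h2 := hcon ε hε
    obtain ⟨N, hN⟩ := eventually_atTop.1 h2
    exact ⟨N, fun m hm => by rw [dist_zero_right]; exact hN m hm⟩)
  rw [hbot] at this
  exact hd (by simpa using this)

end IsCentralSeq

/-- Joint spectral points of a unitary and an asymptotically central sequence of unitaries. -/
theorem exists_norm_sub_one_ge (hA : IsSimpleCStar A) {x p q : A} (hp : p ∈ unitary A)
    (hq : q ∈ unitary A) (hx : x = p * q) {z : ℂ} (hz : ‖z‖ = 1)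
    (hxz : 2 ≤ ‖1 + star z • x‖)
    {b : ℕ → A} (hb : IsCentralSeq b) (hbu : ∀ m, b m ∈ unitary A) {w : ℕ → ℂ}
    (hw : ∀ m, ‖w m‖ = 1) (hbw : ∀ m, 2 ≤ ‖1 + star (w m) • b m‖) {η : ℝ} (hη : 0 < η) :
    ∃ m, ‖z * w m - 1‖ ≤ ‖p * b m * q - 1‖ + η := by
  have := hA.1
  have hxu : x ∈ unitary A := hx ▸ mul_mem hp hq
  -- Chosen so that the cutoff error `√(2 * κ)` is `η / 4`.
  set κ : ℝ := (η / 4) ^ 2 / 2 with hκ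
  have hκ0 : 0 < κ := by positivity
  have hs : √(2 * κ) = η / 4 := by
    rw [hκ, mul_div_cancel₀ _ two_ne_zero, Real.sqrt_sq (by positivity)]
  set d := cutoff κ z x with hd
  set e : ℕ → A := fun m => cutoff κ (w m) (b m) with he
  have hd0 : d ≠ 0 := by
    intro h0
    have := one_le_norm_cutoff hκ0 hz hxu hxz
    rw [← hd, h0, norm_zero] at this
    linarith
  have hec : IsCentralSeq e := hb.cutoff hbu hw κ
  obtain ⟨ρ, hρ, hfreq⟩ := hec.frequently_norm_mul hA
    (fun m => one_le_norm_cutoff hκ0 (hw m) (hbu m) (hbw m)) hd0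
  -- the commutators that vanish asymptotically
  have hbe := hb.mul hec
  have hebd : ∀ m, ‖e m‖ ≤ 1 := fun m => norm_cutoff_le
  set T1 : ℕ → A := fun m => p * (b m * (q * d) - q * d * b m) * e m with hT1
  set T2 : ℕ → A := fun m => b m * e m * d - d * (b m * e m) with hT2
  set T3 : ℕ → A := fun m => e m * d - d * e m with hT3
  set T4 : ℕ → A := fun m => (b m * d - d * b m) * e m with hT4
  have hlim : Tendsto (fun m => ‖T1 m‖ + 2 * ‖T2 m‖ + 2 * ‖T3 m‖ + ‖T4 m‖) atTop (𝓝 0) := by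
    have l1 : Tendsto T1 atTop (𝓝 0) := by
      have := (hb.comm (q * d)).const_mul p
      rw [mul_zero] at this
      exact IsCentralSeq.tendsto_mul_bdd hebd this
    have l2 : Tendsto T2 atTop (𝓝 0) := hbe.comm d
    have l3 : Tendsto T3 atTop (𝓝 0) := hec.comm d
    have l4 : Tendsto T4 atTop (𝓝 0) := IsCentralSeq.tendsto_mul_bdd hebd (hb.comm d)
    have := ((l1.norm.add (l2.norm.const_mul 2)).add (l3.norm.const_mul 2)).add l4.norm
    simpa using this
  have hev := hlim.eventually_lt_const (show 0 < ρ * (η / 4) by positivity)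
  obtain ⟨m, hm1, hm2⟩ := (hfreq.and_eventually hev).exists
  refine ⟨m, ?_⟩
  set N := ‖d * e m‖ with hN
  -- On `d * e m` the element `p * b m * q` acts nearly as the scalar `z * w m`: `x = p * q` is
  -- nearly `z` on the range of `d`, `b m` is nearly `w m` on that of `e m`, and the `T` terms
  -- collect the commutators. By simplicity `d * e m` stays bounded below for infinitely many `m`.
  have hid : (p * b m * q - algebraMap ℂ A (z * w m)) * (d * e m) =
      (x - algebraMap ℂ A z) * (d * (b m * e m)) +
        z • ((b m - algebraMap ℂ A (w m)) * (e m * d)) + T1 m - z • T2 m + (z * w m) • T3 m := by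
    simp only [hT1, hT2, hT3, hx, Algebra.algebraMap_eq_smul_one, sub_mul, mul_sub,
      smul_mul_assoc, one_mul, smul_sub, smul_smul, mul_assoc]
    abel
  have hbm : ‖b m‖ = 1 := CStarRing.norm_of_mem_unitary (hbu m)
  have hwz : ‖z * w m‖ = 1 := by rw [norm_mul, hz, hw m, one_mul]
  have e1 : ‖(x - algebraMap ℂ A z) * (d * (b m * e m))‖ ≤ η / 4 * (N + ‖T4 m‖) := by
    have h1 := norm_sub_mul_cutoff_le hκ0 hz hxu (b m * e m)
    rw [hs, ← hd] at h1
    refine h1.trans ?_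
    gcongr
    have : d * (b m * e m) = b m * (d * e m) - T4 m := by
      simp only [hT4, sub_mul, mul_assoc]; abel
    rw [this]
    refine (norm_sub_le _ _).trans ?_
    gcongr
    calc _ ≤ ‖b m‖ * ‖d * e m‖ := norm_mul_le _ _
      _ = N := by rw [hbm, one_mul]
  have e2 : ‖z • ((b m - algebraMap ℂ A (w m)) * (e m * d))‖ ≤ η / 4 * (N + ‖T3 m‖) := by
    rw [norm_smul, hz, one_mul]
    have h1 := norm_sub_mul_cutoff_le hκ0 (hw m) (hbu m) d
    rw [hs] at h1
    refine h1.trans ?_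
    gcongr
    have : cutoff κ (w m) (b m) * d = d * e m + T3 m := by
      simp only [hT3, he]; abel
    rw [this]
    exact norm_add_le _ _
  have hη1 : ‖(p * b m * q - algebraMap ℂ A (z * w m)) * (d * e m)‖ ≤
      η / 4 * (N + ‖T4 m‖) + η / 4 * (N + ‖T3 m‖) + ‖T1 m‖ + ‖T2 m‖ + ‖T3 m‖ := by
    rw [hid]
    refine (norm_add_le _ _).trans (add_le_add ?_ ?_)
    · refine (norm_sub_le _ _).trans (add_le_add ?_ ?_)
      · refine (norm_add_le _ _).trans (add_le_add ?_ le_rfl)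
        exact (norm_add_le _ _).trans (add_le_add e1 e2)
      · rw [norm_smul, hz, one_mul]
    · rw [norm_smul, hwz, one_mul]
  have hge : ‖z * w m - 1‖ * N - ‖p * b m * q - 1‖ * N ≤
      ‖(p * b m * q - algebraMap ℂ A (z * w m)) * (d * e m)‖ := by
    have h1 : (p * b m * q - algebraMap ℂ A (z * w m)) * (d * e m) =
        (p * b m * q - 1) * (d * e m) - (z * w m - 1) • (d * e m) := by
      rw [Algebra.algebraMap_eq_smul_one, sub_mul, sub_mul, smul_mul_assoc, one_mul, sub_smul,
        one_smul]
      abel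
    rw [h1, norm_sub_rev ((p * b m * q - 1) * (d * e m))]
    have h2 := norm_sub_norm_le ((z * w m - 1) • (d * e m)) ((p * b m * q - 1) * (d * e m))
    rw [norm_smul] at h2
    have h3 := norm_mul_le (p * b m * q - 1) (d * e m)
    linarith
  have hN0 : 0 < N := lt_of_lt_of_le hρ hm1
  -- The absorption of error terms needs `η / 4 ≤ 1`. For larger `η` the claim is trivial, since the
  -- left side is at most `2`.
  by_cases hbig : η ≤ 4
  · have hT : η / 4 * ‖T4 m‖ ≤ ‖T4 m‖ := by nlinarith [norm_nonneg (T4 m)]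
    have hT' : η / 4 * ‖T3 m‖ ≤ ‖T3 m‖ := by nlinarith [norm_nonneg (T3 m)]
    have h6 : ρ * (η / 4) ≤ N * (η / 4) := by gcongr
    have h7 : (‖z * w m - 1‖ - ‖p * b m * q - 1‖ - η) * N ≤ 0 := by
      nlinarith [norm_nonneg (T2 m)]
    have := nonpos_of_mul_nonpos_left h7 hN0
    linarith
  · push Not at hbig
    have h8 : ‖z * w m - 1‖ ≤ 2 := by
      refine (norm_sub_le _ _).trans ?_
      rw [hwz, norm_one]; norm_num
    linarith [norm_nonneg (p * b m * q - 1)]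

end Central

/-! ### Automorphisms close to the identity on the masa. -/

theorem norm_map_aut (σ : A ≃⋆ₐ[ℂ] A) (x : A) : ‖σ x‖ = ‖x‖ :=
  NonUnitalStarAlgHom.norm_map σ σ.injective x

theorem map_mem_unitary (σ : A ≃⋆ₐ[ℂ] A) {u : A} (hu : u ∈ unitary A) : σ u ∈ unitary A := by
  rw [Unitary.mem_iff, ← map_star, ← map_mul, ← map_mul, (Unitary.mem_iff.1 hu).1,
    (Unitary.mem_iff.1 hu).2, map_one]
  exact ⟨rfl, rfl⟩

namespace IsMasaTower

variable {G : ℕ → StarSubalgebra ℂ A} {C : StarSubalgebra ℂ A}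

/-- A subalgebra in the domain of the generator moves uniformly. -/
theorem exists_lipschitz (hC : IsMasaTower G C) {α : OneParamAutGroup A}
    (hdom : (C : Set A) ⊆ α.generator.domain) :
    ∃ M : ℝ, 0 < M ∧ ∀ t, ∀ c ∈ C, ‖α t c - c‖ ≤ M * |t| * ‖c‖ := by
  let S : Submodule ℂ A := Subalgebra.toSubmodule C.toSubalgebra
  have : CompleteSpace S := hC.closed.isComplete.completeSpace_coe
  -- Difference quotients on the Banach space `C`: each point of `C` is in the domain, so they are
  -- pointwise bounded, and Banach–Steinhaus applies. At `t = 0` the quotient is zero.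
  let g : ℝ → S →L[ℂ] A := fun t => ((|t|⁻¹ : ℝ) : ℂ) • (α.clm t - 1).comp S.subtypeL
  have hg : ∀ t (x : S), ‖g t x‖ = |t|⁻¹ * ‖α t x - x‖ := by
    intro t x
    simp [g, norm_smul]
  obtain ⟨M, hM⟩ := banach_steinhaus (g := g) (by
    intro x
    have hx := hasGen_generator (α := α) ⟨x, hdom x.2⟩
    set y := α.generator ⟨x, hdom x.2⟩
    refine ⟨3 * ‖y‖, fun t => ?_⟩
    have h1 := hx.norm_sub_le t (C := 2 * ‖y‖) fun s _ => by
      refine (norm_sub_le _ _).trans ?_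
      rw [α.norm_map]; linarith
    have h2 : ‖α t x - x‖ ≤ 3 * ‖y‖ * |t| := by
      calc ‖α t (x : A) - x‖ = ‖(α t (x : A) - x - t • y) + t • y‖ := by rw [sub_add_cancel]
        _ ≤ 2 * ‖y‖ * |t| + |t| * ‖y‖ := by
            refine (norm_add_le _ _).trans (add_le_add h1 ?_)
            rw [norm_smul, Real.norm_eq_abs]
        _ = _ := by ring
    rw [hg]
    rcases eq_or_ne t 0 with rfl | ht
    · simp
    · have : 0 < |t| := abs_pos.2 ht
      rw [inv_mul_le_iff₀ this]; linarith)
  refine ⟨max M 1, by positivity, fun t c hc => ?_⟩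
  have h1 := (g t).le_of_opNorm_le (hM t) ⟨c, hc⟩
  rw [hg] at h1
  change |t|⁻¹ * ‖α t c - c‖ ≤ M * ‖c‖ at h1
  rcases eq_or_ne t 0 with rfl | ht
  · simp [α.map_zero']
  · have : 0 < |t| := abs_pos.2 ht
    rw [inv_mul_le_iff₀ this] at h1
    calc _ ≤ |t| * (M * ‖c‖) := h1
      _ ≤ |t| * (max M 1 * ‖c‖) := by gcongr; exact le_max_left _ _
      _ = _ := by ring

end IsMasaTower

/-- Unitaries of `C` in the commutant of `G n`. -/
structure InTail (G : ℕ → StarSubalgebra ℂ A) (C : StarSubalgebra ℂ A) (n : ℕ) (u : A) : Prop where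
  mem : u ∈ C
  unitary : u ∈ unitary A
  comm : ∀ y ∈ G n, u * y = y * u

namespace InTail

variable {G : ℕ → StarSubalgebra ℂ A} {C : StarSubalgebra ℂ A} {n m : ℕ} {u v : A}

theorem mul (hu : InTail G C n u) (hv : InTail G C n v) : InTail G C n (u * v) :=
  ⟨mul_mem hu.mem hv.mem, mul_mem hu.unitary hv.unitary, fun y hy => by
    rw [mul_assoc, hv.comm y hy, ← mul_assoc, hu.comm y hy, mul_assoc]⟩

theorem star (hu : InTail G C n u) : InTail G C n (star u) :=
  ⟨star_mem hu.mem, Unitary.star_mem hu.unitary, fun y hy => by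
    have := congrArg Star.star (hu.comm _ (star_mem hy))
    simpa using this.symm⟩

theorem anti (hG : Monotone G) (hu : InTail G C n u) (h : m ≤ n) : InTail G C m u :=
  ⟨hu.mem, hu.unitary, fun y hy => hu.comm y (hG h hy)⟩

theorem isCentralSeq [Nontrivial A] (hG : IsTower G) {u : ℕ → A} {N : ℕ → ℕ}
    (hu : ∀ m, InTail G C (N m) (u m)) (hN : ∀ m, m ≤ N m) : IsCentralSeq u := by
  have h1 : ∀ m, ‖u m‖ = 1 := fun m => CStarRing.norm_of_mem_unitary (hu m).unitary
  refine ⟨⟨1, fun m => (h1 m).le⟩, fun y => Metric.tendsto_atTop.2 fun ε hε => ?_⟩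
  obtain ⟨x, hx, hxy⟩ := hG.dense.exists_dist_lt y (show 0 < ε / 2 by positivity)
  obtain ⟨k, hk⟩ := Set.mem_iUnion.1 hx
  refine ⟨k, fun m hm => ?_⟩
  have h2 := (hu m).comm x (hG.mono (hm.trans (hN m)) hk)
  rw [dist_zero_right]
  rw [dist_eq_norm] at hxy
  have : u m * y - y * u m = u m * (y - x) - (y - x) * u m := by
    rw [mul_sub, sub_mul, h2]; abel
  rw [this]
  calc _ ≤ ‖u m‖ * ‖y - x‖ + ‖y - x‖ * ‖u m‖ :=
        (norm_sub_le _ _).trans (add_le_add (norm_mul_le _ _) (norm_mul_le _ _))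
    _ < ε := by rw [h1]; linarith

/-- Replacing `u` by its adjoint conjugates the peak point, so it may be taken in the closed upper
half plane. This fixes the sign of the rotation, so that rotations of different unitaries add rather
than cancel. -/
theorem exists_peak_point_map [Nontrivial A] (σ : A ≃⋆ₐ[ℂ] A) (hu : InTail G C n u) :
    ∃ (v : A) (z : ℂ), InTail G C n v ∧ ‖z‖ = 1 ∧ 0 ≤ z.im ∧ ‖z - 1‖ = ‖σ u - u‖ ∧
      2 ≤ ‖v + Star.star z • σ v‖ := by
  obtain ⟨z, hz, hz1, hz2⟩ := exists_peak_point hu.unitary (map_mem_unitary σ hu.unitary)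
  by_cases him : 0 ≤ z.im
  · exact ⟨u, z, hu, hz, him, hz1, hz2⟩
  · refine ⟨Star.star u, Star.star z, hu.star, by rw [norm_star, hz], ?_, ?_, ?_⟩
    · rw [Complex.star_def, Complex.conj_im]; linarith
    · rw [← hz1, ← norm_star (z - 1), star_sub, star_one]
    · rw [← norm_star] at hz2
      simpa only [star_add, star_smul, star_star, map_star] using hz2

end InTail

/-- With `a = ‖z - 1‖ ^ 2` and `b = ‖w - 1‖ ^ 2` one has `‖z * w - 1‖ ^ 2 = a + b - a * b / 2 + 2 *
z.im * w.im`. Since `a ≤ 1 / 4`, this is at least `a + 7 / 8 * b`, which exceeds `(15 / 8) * (16 /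
25) * r ^ 2 = 1.2 * r ^ 2`, more than `(1.05 * r) ^ 2`. -/
theorem lt_norm_mul_sub_one {z w : ℂ} (hz : ‖z‖ = 1) (hw : ‖w‖ = 1) (hzi : 0 ≤ z.im)
    (hwi : 0 ≤ w.im) {r : ℝ} (hr : 0 < r) (hr' : r ≤ 1 / 2) (hz1 : 4 / 5 * r < ‖z - 1‖)
    (hz2 : ‖z - 1‖ ≤ r) (hw1 : 4 / 5 * r < ‖w - 1‖) :
    r + r / 20 < ‖z * w - 1‖ := by
  have hsq : ∀ x : ℂ, ‖x‖ = 1 → ‖x - 1‖ ^ 2 = 2 - 2 * x.re := by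
    intro x hx
    have h1 : ‖x‖ ^ 2 = 1 := by rw [hx]; norm_num
    rw [← Complex.normSq_eq_norm_sq, Complex.normSq_apply] at h1 ⊢
    simp only [Complex.sub_re, Complex.sub_im, Complex.one_re, Complex.one_im]
    nlinarith
  have e1 := hsq z hz
  have e2 := hsq w hw
  have e3 := hsq (z * w) (by rw [norm_mul, hz, hw, one_mul])
  rw [Complex.mul_re] at e3
  have h1 : (4 / 5 * r) ^ 2 < ‖z - 1‖ ^ 2 := by gcongr
  have h2 : (4 / 5 * r) ^ 2 < ‖w - 1‖ ^ 2 := by gcongr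
  have h3 : ‖z - 1‖ ^ 2 ≤ (1 / 2) ^ 2 := by gcongr; exact hz2.trans hr'
  have him : 0 ≤ z.im * w.im := mul_nonneg hzi hwi
  set a := ‖z - 1‖ ^ 2
  set b := ‖w - 1‖ ^ 2
  have hza : z.re = 1 - a / 2 := by linarith
  have hwb : w.re = 1 - b / 2 := by linarith
  refine lt_of_pow_lt_pow_left₀ 2 (norm_nonneg _) ?_
  rw [e3, hza, hwb]
  have h4 : b * a ≤ b * (1 / 2) ^ 2 := by gcongr
  nlinarith [sq_nonneg r, sq_pos_of_pos hr]

namespace IsMasaTower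

variable {G : ℕ → StarSubalgebra ℂ A} {C : StarSubalgebra ℂ A}

/-- Otherwise every tail contains a unitary moved by more than `4 / 5 * r`. Pair one such `u` with a
central sequence of others: by `exists_norm_sub_one_ge` some product `u * v m` is moved by almost
`‖z * w m - 1‖`. This exceeds `r + r / 20` by `lt_norm_mul_sub_one`, so the error `r / 20` still
leaves more than `r`. -/
theorem tail_improve (hC : IsMasaTower G C) (hA : IsSimpleCStar A) (σ : A ≃⋆ₐ[ℂ] A) {r : ℝ}
    (hr : 0 < r) (hr' : r ≤ 1 / 2) {n : ℕ} (hn : ∀ u, InTail G C n u → ‖σ u - u‖ ≤ r) :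
    ∃ m, ∀ u, InTail G C m u → ‖σ u - u‖ ≤ 4 / 5 * r := by
  have := hA.1
  by_contra! hcon
  have hcon' : ∀ m, ∃ (u : A) (z : ℂ), InTail G C m u ∧ ‖z‖ = 1 ∧ 0 ≤ z.im ∧ 4 / 5 * r < ‖z - 1‖ ∧
      (n ≤ m → ‖z - 1‖ ≤ r) ∧ 2 ≤ ‖u + star z • σ u‖ := by
    intro m
    obtain ⟨u, hu, hur⟩ := hcon m
    obtain ⟨v, z, hv, hz, hzi, hz1, hz2⟩ := hu.exists_peak_point_map σ
    exact ⟨v, z, hv, hz, hzi, hz1 ▸ hur, fun h => hz1 ▸ hn u (hu.anti hC.mono h), hz2⟩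
  obtain ⟨u, z, hu, hz, hzi, hzr, hzr', hz2⟩ := hcon' n
  -- The index `max n m` makes the sequence central and keeps it in the tail where `hn` applies.
  choose v w hv hw hwi hwr _ hw2 using fun m => hcon' (max n m)
  have hmul : ∀ {u : A} {z : ℂ}, u ∈ unitary A → 2 ≤ ‖u + star z • σ u‖ →
      2 ≤ ‖1 + star z • (σ u * star u)‖ := by
    intro u z hu h
    have : u + star z • σ u = (1 + star z • (σ u * star u)) * u := by
      rw [add_mul, one_mul, smul_mul_assoc, mul_assoc, (Unitary.mem_iff.1 hu).1, mul_one]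
    rwa [this, CStarRing.norm_mul_mem_unitary _ hu] at h
  have hvc : IsCentralSeq v := InTail.isCentralSeq hC.toIsTower hv fun m => le_max_right _ _
  have hσvc : IsCentralSeq fun m => σ (v m) := by
    refine ⟨⟨1, fun m => ?_⟩, fun y => ?_⟩
    · rw [norm_map_aut, CStarRing.norm_of_mem_unitary (hv m).unitary]
    · have := tendsto_zero_iff_norm_tendsto_zero.1 (hvc.comm (σ.symm y))
      refine tendsto_zero_iff_norm_tendsto_zero.2 (this.congr fun m => ?_)
      rw [← norm_map_aut σ, map_sub, map_mul, map_mul, StarAlgEquiv.apply_symm_apply]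
  obtain ⟨m, hm⟩ := exists_norm_sub_one_ge hA (map_mem_unitary σ hu.unitary)
    (Unitary.star_mem hu.unitary) rfl hz (hmul hu.unitary hz2) (hσvc.mul hvc.star)
    (fun m => mul_mem (map_mem_unitary σ (hv m).unitary) (Unitary.star_mem (hv m).unitary))
    hw (fun m => hmul (hv m).unitary (hw2 m)) (show 0 < r / 20 by positivity)
  have huv : InTail G C n (u * v m) := hu.mul ((hv m).anti hC.mono (le_max_left _ _))
  have h1 : ‖σ u * (σ (v m) * star (v m)) * star u - 1‖ = ‖σ (u * v m) - u * v m‖ := by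
    rw [← CStarRing.norm_mul_mem_unitary _ huv.unitary, sub_mul, one_mul]
    congr 2
    calc _ = σ u * σ (v m) * (star (v m) * (star u * u) * v m) := by simp only [mul_assoc]
      _ = _ := by
        rw [(Unitary.mem_iff.1 hu.unitary).1, mul_one, (Unitary.mem_iff.1 (hv m).unitary).1,
          mul_one, map_mul]
  have h2 := lt_norm_mul_sub_one hz (hw m) hzi (hwi m) hr hr' hzr (hzr' le_rfl) (hwr m)
  rw [h1] at hm
  linarith [hn _ huv]

/-- An automorphism that moves the unitaries of the masa little is asymptotically trivial
on it. -/
theorem exists_tail (hC : IsMasaTower G C) (hA : IsSimpleCStar A) (σ : A ≃⋆ₐ[ℂ] A)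
    (hσ : ∀ u, InTail G C 0 u → ‖σ u - u‖ ≤ 1 / 2) {ε : ℝ} (hε : 0 < ε) :
    ∃ n, ∀ u, InTail G C n u → ‖σ u - u‖ ≤ ε := by
  have key : ∀ k : ℕ, ∃ n, ∀ u, InTail G C n u → ‖σ u - u‖ ≤ (4 / 5) ^ k * (1 / 2) := by
    intro k
    induction k with
    | zero => exact ⟨0, by simpa using hσ⟩
    | succ k ih =>
      obtain ⟨n, hn⟩ := ih
      have h1 : ((4 : ℝ) / 5) ^ k ≤ 1 := pow_le_one₀ (by norm_num) (by norm_num)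
      obtain ⟨m, hm⟩ := hC.tail_improve hA σ (by positivity) (by linarith) hn
      exact ⟨m, fun u hu => (hm u hu).trans (by rw [pow_succ]; linarith)⟩
  obtain ⟨k, hk⟩ := exists_pow_lt_of_lt_one hε (show (4 / 5 : ℝ) < 1 by norm_num)
  obtain ⟨n, hn⟩ := key k
  exact ⟨n, fun u hu => (hn u hu).trans (by
    have : (0 : ℝ) < (4 / 5) ^ k := by positivity
    linarith)⟩

end IsMasaTower

/-! ### Twisted pinchings and their convergence. -/

/-- A partition of unity by projections of `D` on which `D` acts by scalars. -/
structure IsAtoms (D : StarSubalgebra ℂ A) {n : ℕ} (e : Fin n → A) : Prop where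
  mem : ∀ i, e i ∈ D
  star_eq : ∀ i, star (e i) = e i
  idem : ∀ i, e i * e i = e i
  orth : ∀ i j, i ≠ j → e i * e j = 0
  sum_eq : ∑ i, e i = 1
  eigen : ∀ d ∈ D, ∀ i, ∃ μ : ℂ, d * e i = μ • e i

theorem exists_isAtoms (D : StarSubalgebra ℂ A) [FiniteDimensional ℂ D]
    (hc : ∀ x ∈ D, ∀ y ∈ D, x * y = y * x) : ∃ (n : ℕ) (e : Fin n → A), IsAtoms D e := by
  obtain ⟨n, e, h1, -, h3, h4, h5, h6, h7⟩ := exists_projections D hc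
  exact ⟨n, e, h1, h3, h4, h5, h6, h7⟩

/-- The twisted pinching `x ↦ ∑ i, σ (e i) x (e i)`. -/
def twist (σ : A ≃⋆ₐ[ℂ] A) {n : ℕ} (e : Fin n → A) (x : A) : A := ∑ i, σ (e i) * x * e i

theorem twist_sub (σ : A ≃⋆ₐ[ℂ] A) {n : ℕ} (e : Fin n → A) (x y : A) :
    twist σ e (x - y) = twist σ e x - twist σ e y := by
  simp [twist, mul_sub, sub_mul]

namespace IsAtoms

variable {D D' : StarSubalgebra ℂ A} {n m : ℕ} {e : Fin n → A} {f : Fin m → A} {σ : A ≃⋆ₐ[ℂ] A}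

theorem map_mul_twist (he : IsAtoms D e) (hc : ∀ x ∈ D, ∀ y ∈ D, x * y = y * x) {d : A}
    (hd : d ∈ D) (x : A) : σ d * twist σ e x = twist σ e x * d := by
  rw [twist, Finset.mul_sum, Finset.sum_mul]
  refine Finset.sum_congr rfl fun i _ => ?_
  obtain ⟨μ, hμ⟩ := he.eigen d hd i
  rw [← mul_assoc, ← mul_assoc, ← map_mul, hμ, mul_assoc _ (e i) d, ← hc d hd _ (he.mem i), hμ,
    map_smul, smul_mul_assoc, smul_mul_assoc, mul_smul_comm]

theorem twist_eq_self (he : IsAtoms D e) {x : A} (hx : ∀ d ∈ D, σ d * x = x * d) :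
    twist σ e x = x := by
  rw [twist]
  calc _ = ∑ i, x * e i := Finset.sum_congr rfl fun i _ => by
        rw [hx _ (he.mem i), mul_assoc, he.idem]
    _ = x := by rw [← Finset.mul_sum, he.sum_eq, mul_one]

/-- An atom of the smaller algebra acts on each atom of the larger one by an idempotent scalar, so
compressing by the finer partition absorbs the coarser one. -/
theorem twist_twist (he : IsAtoms D e) (hf : IsAtoms D' f) (hc : ∀ x ∈ D', ∀ y ∈ D', x * y = y * x)
    (hD : D ≤ D') (x : A) : twist σ f (twist σ e x) = twist σ f x := by
  simp only [twist]
  refine Finset.sum_congr rfl fun k _ => ?_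
  have h1 : ∀ i, σ (f k) * (σ (e i) * x * e i) * f k = σ (f k) * x * (e i * f k) := by
    intro i
    obtain ⟨μ, hμ⟩ := hf.eigen (e i) (hD (he.mem i)) k
    have h2 : μ • (μ • f k) = μ • f k := by
      rw [← hμ, ← mul_smul_comm, ← hμ, ← mul_assoc, he.idem]
    calc _ = σ (f k * e i) * x * (e i * f k) := by
          rw [map_mul]; simp only [mul_assoc]
      _ = σ (e i * f k) * x * (e i * f k) := by rw [← hc _ (hD (he.mem i)) _ (hf.mem k)]
      _ = _ := by
          rw [hμ, map_smul, smul_mul_assoc, smul_mul_assoc, ← mul_smul_comm, h2]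
  rw [Finset.mul_sum, Finset.sum_mul]
  calc _ = ∑ i, σ (f k) * x * (e i * f k) := Finset.sum_congr rfl fun i _ => h1 i
    _ = _ := by rw [← Finset.mul_sum, ← Finset.sum_mul, he.sum_eq, one_mul]

/-- The twisted pinching is an average over unitaries. -/
theorem exists_average [Nontrivial A] (he : IsAtoms D e) :
    0 < n ∧ ∃ u : ℕ → A, (∀ j, u j ∈ D ∧ u j ∈ unitary A) ∧
      ∀ (σ : A ≃⋆ₐ[ℂ] A) (x : A),
        twist σ e x = (n : ℂ)⁻¹ • ∑ j ∈ Finset.range n, σ (u j) * x * star (u j) := by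
  have hn : 0 < n := by
    rcases Nat.eq_zero_or_pos n with rfl | h
    · have := he.sum_eq
      simp at this
    · exact h
  refine ⟨hn, ?_⟩
  have hζ := Complex.isPrimitiveRoot_exp n hn.ne'
  set ζ := Complex.exp (2 * Real.pi * Complex.I / n) with hζd
  have hζ1 : ‖ζ‖ = 1 := hζ.norm'_eq_one hn.ne'
  have hζs : ∀ k : ℕ, ζ ^ k * star (ζ ^ k) = 1 := fun k => by
    rw [Complex.star_def, mul_comm, ← Complex.normSq_eq_conj_mul_self, Complex.normSq_eq_norm_sq,
      norm_pow, hζ1]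
    simp
  -- Averaging over the powers of the root of unity kills the off-diagonal terms `σ (e i) * x * e
  -- i'` by orthogonality of characters.
  let u : ℕ → A := fun j => ∑ i : Fin n, (ζ ^ (i : ℕ)) ^ j • e i
  have hus : ∀ j, star (u j) = ∑ i : Fin n, star ((ζ ^ (i : ℕ)) ^ j) • e i := fun j => by
    simp only [u, star_sum, star_smul, he.star_eq]
  have hprod : ∀ a b : Fin n → ℂ, (∑ i, a i • e i) * (∑ i, b i • e i) = ∑ i, (a i * b i) • e i := by
    intro a b
    rw [Finset.sum_mul]
    refine Finset.sum_congr rfl fun i _ => ?_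
    rw [Finset.mul_sum, Finset.sum_eq_single i]
    · rw [smul_mul_smul_comm, he.idem]
    · intro j _ hj
      rw [smul_mul_smul_comm, he.orth i j hj.symm, smul_zero]
    · simp
  refine ⟨u, fun j => ⟨sum_mem fun i _ => SMulMemClass.smul_mem _ (he.mem i), ?_⟩, fun σ x => ?_⟩
  · rw [Unitary.mem_iff, hus, hprod, hprod, ← he.sum_eq]
    constructor <;> refine Finset.sum_congr rfl fun i _ => ?_
    · rw [← pow_mul, mul_comm, hζs, one_smul]
    · rw [← pow_mul, hζs, one_smul]
  · have h1 : ∀ j, σ (u j) * x * star (u j) = ∑ i : Fin n, ∑ i' : Fin n,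
        ((ζ ^ (i : ℕ)) ^ j * star ((ζ ^ (i' : ℕ)) ^ j)) • (σ (e i) * x * e i') := by
      intro j
      rw [hus, map_sum, Finset.sum_mul, Finset.sum_mul]
      refine Finset.sum_congr rfl fun i _ => ?_
      rw [Finset.mul_sum]
      refine Finset.sum_congr rfl fun i' _ => ?_
      rw [map_smul, smul_mul_assoc, smul_mul_smul_comm]
    have h2 : ∀ i i' : Fin n, ∑ j ∈ Finset.range n, (ζ ^ (i : ℕ)) ^ j * star ((ζ ^ (i' : ℕ)) ^ j) =
        if i = i' then (n : ℂ) else 0 := by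
      intro i i'
      have e1 : ∀ j, (ζ ^ (i : ℕ)) ^ j * star ((ζ ^ (i' : ℕ)) ^ j) =
          (ζ ^ (i : ℕ) * star (ζ ^ (i' : ℕ))) ^ j := fun j => by
        rw [mul_pow, ← star_pow]
      simp only [e1]
      split_ifs with h
      · subst h
        simp only [hζs]
        simp
      · set q := ζ ^ (i : ℕ) * star (ζ ^ (i' : ℕ)) with hq
        have hq1 : q ≠ 1 := by
          intro h1
          refine h (Fin.ext (hζ.pow_inj i.2 i'.2 ?_))
          calc ζ ^ (i : ℕ) = ζ ^ (i : ℕ) * (ζ ^ (i' : ℕ) * star (ζ ^ (i' : ℕ))) := by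
                rw [hζs, mul_one]
            _ = q * ζ ^ (i' : ℕ) := by rw [hq]; ring
            _ = _ := by rw [h1, one_mul]
        have hqn : q ^ n = 1 := by
          rw [hq, mul_pow, ← star_pow, ← pow_mul, ← pow_mul, mul_comm (i : ℕ), mul_comm (i' : ℕ),
            pow_mul, pow_mul, hζ.pow_eq_one]
          simp
        have := mul_neg_geom_sum q n
        rw [hqn, sub_self] at this
        exact (mul_eq_zero.1 this).resolve_left (sub_ne_zero.2 hq1.symm)
    have h3 : ∑ j ∈ Finset.range n, σ (u j) * x * star (u j) = (n : ℂ) • twist σ e x := by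
      simp only [h1]
      rw [Finset.sum_comm, twist, Finset.smul_sum]
      refine Finset.sum_congr rfl fun i _ => ?_
      rw [Finset.sum_comm]
      calc _ = ∑ i', (if i = i' then (n : ℂ) else 0) • (σ (e i) * x * e i') :=
            Finset.sum_congr rfl fun i' _ => by rw [← Finset.sum_smul, h2]
        _ = _ := by simp [ite_smul]
    rw [h3, smul_smul, inv_mul_cancel₀ (Nat.cast_ne_zero.2 hn.ne'), one_smul]

theorem norm_average_le {n : ℕ} (hn : 0 < n) {f : ℕ → A} {K : ℝ} (hf : ∀ j, ‖f j‖ ≤ K) :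
    ‖(n : ℂ)⁻¹ • ∑ j ∈ Finset.range n, f j‖ ≤ K := by
  have h1 : ‖∑ j ∈ Finset.range n, f j‖ ≤ n * K := by
    refine (norm_sum_le _ _).trans ((Finset.sum_le_sum fun j _ => hf j).trans ?_)
    simp
  have hn' : (0 : ℝ) < n := Nat.cast_pos.2 hn
  rw [norm_smul, norm_inv, Complex.norm_natCast, inv_mul_le_iff₀ hn']
  exact h1

theorem norm_twist_le [Nontrivial A] (he : IsAtoms D e) (σ : A ≃⋆ₐ[ℂ] A) (x : A) :
    ‖twist σ e x‖ ≤ ‖x‖ := by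
  obtain ⟨hn, u, hu, hT⟩ := he.exists_average
  rw [hT]
  refine norm_average_le hn fun j => le_of_eq ?_
  rw [CStarRing.norm_mul_mem_unitary _ (Unitary.star_mem (hu j).2),
    CStarRing.norm_mem_unitary_mul _ (map_mem_unitary σ (hu j).2)]

theorem norm_twist_sub_twist_le [Nontrivial A] (he : IsAtoms D e) {σ τ : A ≃⋆ₐ[ℂ] A} {K : ℝ}
    (hK : ∀ u ∈ D, u ∈ unitary A → ‖σ u - τ u‖ ≤ K) : ‖twist σ e 1 - twist τ e 1‖ ≤ K := by
  obtain ⟨hn, u, hu, hT⟩ := he.exists_average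
  rw [hT, hT, ← smul_sub, ← Finset.sum_sub_distrib]
  refine norm_average_le hn fun j => ?_
  rw [mul_one, mul_one, ← sub_mul, CStarRing.norm_mul_mem_unitary _ (Unitary.star_mem (hu j).2)]
  exact hK _ (hu j).1 (hu j).2

theorem twist_refl (he : IsAtoms D e) : twist (StarAlgEquiv.refl ℂ A) e 1 = 1 := by
  rw [twist, ← he.sum_eq]
  refine Finset.sum_congr rfl fun i _ => ?_
  rw [he.sum_eq, mul_one]
  exact he.idem i

theorem norm_twist_one_sub_one_le [Nontrivial A] (he : IsAtoms D e) {K : ℝ}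
    (hK : ∀ u ∈ D, u ∈ unitary A → ‖σ u - u‖ ≤ K) : ‖twist σ e 1 - 1‖ ≤ K := by
  have := he.norm_twist_sub_twist_le (σ := σ) (τ := StarAlgEquiv.refl ℂ A) hK
  rwa [he.twist_refl] at this

end IsAtoms

namespace IsMasaTower

variable {G : ℕ → StarSubalgebra ℂ A} {C : StarSubalgebra ℂ A}

theorem finiteDimensional_of_le {D E : StarSubalgebra ℂ A} [FiniteDimensional ℂ E] (h : D ≤ E) :
    FiniteDimensional ℂ D :=
  Submodule.finiteDimensional_of_le (S₁ := Subalgebra.toSubmodule D.toSubalgebra)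
    (S₂ := Subalgebra.toSubmodule E.toSubalgebra) h

theorem exists_atoms (hC : IsMasaTower G C) (n : ℕ) :
    ∃ (k : ℕ) (e : Fin k → A), IsAtoms (C ⊓ G n) e := by
  have := hC.finDim n
  have : FiniteDimensional ℂ (C ⊓ G n : StarSubalgebra ℂ A) :=
    finiteDimensional_of_le (inf_le_right : C ⊓ G n ≤ G n)
  exact exists_isAtoms _ (hC.isMaxAb n).comm

/-- The number of atoms of the `n`-th stage of the masa. -/
def atomCount (hC : IsMasaTower G C) (n : ℕ) : ℕ := (hC.exists_atoms n).choose

/-- The atoms of the `n`-th stage of the masa. -/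
def atoms (hC : IsMasaTower G C) (n : ℕ) : Fin (hC.atomCount n) → A :=
  (hC.exists_atoms n).choose_spec.choose

theorem isAtoms_atoms (hC : IsMasaTower G C) (n : ℕ) : IsAtoms (C ⊓ G n) (hC.atoms n) :=
  (hC.exists_atoms n).choose_spec.choose_spec

/-- Every layer of `C` lies either in `G n` or in the commutant of `G n`, and commuting with all
layers suffices. -/
theorem mem_of_commute_split (hC : IsMasaTower G C) (n : ℕ) {x : A}
    (h1 : ∀ c ∈ C, c ∈ G n → x * c = c * x)
    (h2 : ∀ c ∈ C, (∀ y ∈ G n, c * y = y * c) → x * c = c * x) : x ∈ C := by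
  refine hC.mem_of_commute_layers fun k c hc hcG hck => ?_
  rcases le_or_gt (k + 1) n with h | h
  · exact h1 c hc (hC.mono h hcG)
  · exact h2 c hc fun y hy => hck y (hC.mono (Nat.lt_succ_iff.1 h) hy)

theorem toCommutant_mem_of_mem (hC : IsMasaTower G C) {n k : ℕ} {v : Fin k → A}
    (hv : IsMatrixUnits (G n) (C ⊓ G n) v) {y : A}
    (hy : ∀ c ∈ C, (∀ x ∈ G n, c * x = x * c) → c * y = y * c) : toCommutant v y ∈ C :=
  hC.mem_of_commute_split n (fun _ _ hc => hv.toCommutant_comm _ hc) fun c hc hcn =>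
    hv.toCommutant_commute hcn (hy c hc hcn)

/-- Intertwining relations extend from a stage and its relative commutant to later stages. -/
theorem intertwine_of_split (hC : IsMasaTower G C) {σ : A ≃⋆ₐ[ℂ] A} {n m : ℕ} (hnm : n ≤ m)
    {x : A} (h1 : ∀ c ∈ C, c ∈ G n → σ c * x = x * c)
    (h2 : ∀ c ∈ C, c ∈ G m → (∀ y ∈ G n, c * y = y * c) → σ c * x = x * c) :
    ∀ c ∈ C, c ∈ G m → σ c * x = x * c := by
  intro c hcC hcG
  have := hC.finDim n
  obtain ⟨k, v, hv⟩ := exists_matrixUnits (hC.isMaxAb n)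
  have hle : G n ≤ G m := hC.mono hnm
  have key : ∀ i, σ (toCommutant v (star (v i) * c * v i)) * x =
      x * toCommutant v (star (v i) * c * v i) := by
    intro i
    refine h2 _ (hC.toCommutant_mem_of_mem hv fun d hd hdn => ?_) (hv.toCommutant_mem hle
      (mul_mem (mul_mem (star_mem (hle (hv.mem i))) hcG) (hle (hv.mem i))))
      fun y hy => hv.toCommutant_comm _ hy
    rw [← mul_assoc, ← mul_assoc, hdn _ (star_mem (hv.mem i)), mul_assoc (star (v i)),
      hC.comm d hd c hcC, mul_assoc, mul_assoc, hdn _ (hv.mem i)]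
    simp only [mul_assoc]
  rw [hv.eq_sum_of_commute fun d hd => hC.comm c hcC d hd.1, map_sum, Finset.mul_sum,
    Finset.sum_mul]
  refine Finset.sum_congr rfl fun i _ => ?_
  rw [map_mul, mul_assoc, key, ← mul_assoc, h1 _ (hv.range_mem i).1 (hv.range_mem i).2, mul_assoc]

/-- The twist over stage `m` factors as the twist over stage `n` applied to the twist over `R`, the
part of `C ⊓ G m` commuting with `G n`. The inner twist of `1` is an average over unitaries of the
tail, hence within `ε` of `1`, and the outer twist is contractive. -/
theorem norm_twist_sub_le [Nontrivial A] (hC : IsMasaTower G C) {σ : A ≃⋆ₐ[ℂ] A} {n m : ℕ}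
    (hnm : n ≤ m) {ε : ℝ} (hε : ∀ u, InTail G C n u → ‖σ u - u‖ ≤ ε) :
    ‖twist σ (hC.atoms m) 1 - twist σ (hC.atoms n) 1‖ ≤ ε := by
  let R : StarSubalgebra ℂ A := C ⊓ G m ⊓ StarSubalgebra.centralizer ℂ (G n : Set A)
  have := hC.finDim m
  have : FiniteDimensional ℂ R :=
    finiteDimensional_of_le ((inf_le_left.trans inf_le_right : R ≤ G m))
  have hRm : R ≤ C ⊓ G m := inf_le_left
  have hRn : ∀ c ∈ R, ∀ y ∈ G n, c * y = y * c := fun c hc y hy =>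
    (((StarSubalgebra.mem_centralizer_iff ℂ).1 hc.2 y hy).1).symm
  obtain ⟨k, r, hr⟩ := exists_isAtoms R fun x hx y hy => hC.comm x hx.1.1 y hy.1.1
  have hrc := fun x (hx : x ∈ R) y (hy : y ∈ R) => hC.comm x hx.1.1 y hy.1.1
  set y := twist σ r 1 with hy
  set x := twist σ (hC.atoms n) y with hx
  have hn := hC.isAtoms_atoms n
  have hm := hC.isAtoms_atoms m
  have hx1 : ∀ c ∈ C, c ∈ G m → σ c * x = x * c := by
    refine hC.intertwine_of_split hnm
      (fun c hc hcn => hn.map_mul_twist (hC.isMaxAb n).comm ⟨hc, hcn⟩ y)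
      fun c hc hcm hcn => ?_
    have hcR : c ∈ R := ⟨⟨hc, hcm⟩, (StarSubalgebra.mem_centralizer_iff ℂ).2 fun g hg =>
      ⟨(hcn g hg).symm, (hcn _ (star_mem hg)).symm⟩⟩
    rw [hx, twist, Finset.mul_sum, Finset.sum_mul]
    refine Finset.sum_congr rfl fun i _ => ?_
    calc _ = σ (c * hC.atoms n i) * y * hC.atoms n i := by rw [map_mul]; simp only [mul_assoc]
      _ = σ (hC.atoms n i) * (σ c * y) * hC.atoms n i := by
          rw [hcn _ (hn.mem i).2, map_mul]; simp only [mul_assoc]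
      _ = σ (hC.atoms n i) * y * (c * hC.atoms n i) := by
          rw [hr.map_mul_twist hrc hcR, ← hy]; simp only [mul_assoc]
      _ = _ := by rw [hcn _ (hn.mem i).2]; simp only [mul_assoc]
  -- `x` intertwines on all of `C ⊓ G m`, so the twist over stage `m` fixes it; that twist also
  -- absorbs the two coarser twists from which `x` was built.
  have hxm : twist σ (hC.atoms m) 1 = x := by
    have h1 : twist σ (hC.atoms m) x = x := hm.twist_eq_self fun d hd => hx1 d hd.1 hd.2
    rw [← h1, hx, hn.twist_twist hm (hC.isMaxAb m).comm (inf_le_inf_left C (hC.mono hnm)), hy,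
      hr.twist_twist hm (hC.isMaxAb m).comm hRm]
  rw [hxm, hx, ← twist_sub]
  exact (hn.norm_twist_le σ _).trans (hr.norm_twist_one_sub_one_le fun u hu huu =>
    hε u ⟨hu.1.1, huu, hRn u hu⟩)

/-- The unitaries of the masa moved little by `σ` give rise to an element implementing `σ`. -/
theorem exists_tendsto_twist (hC : IsMasaTower G C) (hA : IsSimpleCStar A) (σ : A ≃⋆ₐ[ℂ] A)
    (hσ : ∀ u ∈ C, u ∈ unitary A → ‖σ u - u‖ ≤ 1 / 2) :
    ∃ z, Tendsto (fun n => twist σ (hC.atoms n) 1) atTop (𝓝 z) ∧ ∀ c ∈ C, σ c * z = z * c := by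
  have := hA.1
  have hcau : CauchySeq fun n => twist σ (hC.atoms n) 1 := by
    refine Metric.cauchySeq_iff'.2 fun ε hε => ?_
    obtain ⟨n, hn⟩ := hC.exists_tail hA σ (fun u hu => hσ u hu.mem hu.unitary) (half_pos hε)
    refine ⟨n, fun m hm => ?_⟩
    rw [dist_eq_norm]
    exact (hC.norm_twist_sub_le hm hn).trans_lt (half_lt_self hε)
  obtain ⟨z, hz⟩ := cauchySeq_tendsto_of_complete hcau
  refine ⟨z, hz, fun c hc => ?_⟩
  have hσc : Continuous σ := by
    refine (AddMonoidHomClass.isometry_of_norm σ (norm_map_aut σ)).continuous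
  have key : ∀ n, ∀ c ∈ C, c ∈ G n → σ c * z = z * c := by
    intro n c hc hcn
    refine tendsto_nhds_unique (hz.const_mul (σ c)) ((hz.mul_const c).congr' ?_)
    filter_upwards [eventually_ge_atTop n] with m hm
    exact ((hC.isAtoms_atoms m).map_mul_twist (hC.isMaxAb m).comm ⟨hc, hC.mono hm hcn⟩ 1).symm
  have hcl : IsClosed {c | σ c * z = z * c} := isClosed_eq (by fun_prop) (by fun_prop)
  exact closure_minimal (Set.iUnion_subset fun n c hc => key n c hc.1 hc.2) hcl
    (hC.mem_closure hc)

/-- A one-parameter group whose generator is defined on the masa is implemented on the masa,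
for small times, by a Lipschitz family. -/
theorem exists_intertwiner (hC : IsMasaTower G C) (hA : IsSimpleCStar A) {α : OneParamAutGroup A}
    (hdom : (C : Set A) ⊆ α.generator.domain) :
    ∃ M : ℝ, 0 < M ∧ ∃ z : ℝ → A, z 0 = 1 ∧
      (∀ t, M * |t| ≤ 1 / 2 → ∀ c ∈ C, α t c * z t = z t * c) ∧
      ∀ s t, M * |s| ≤ 1 / 2 → M * |t| ≤ 1 / 2 → ‖z s - z t‖ ≤ M * |s - t| := by
  have := hA.1
  obtain ⟨M, hM, hMt⟩ := hC.exists_lipschitz hdom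
  have hu : ∀ s t, ∀ u ∈ C, u ∈ unitary A → ‖α s u - α t u‖ ≤ M * |s - t| := by
    intro s t u hu huu
    have h1 := hMt (s - t) u hu
    rw [CStarRing.norm_of_mem_unitary huu, mul_one, ← α.norm_map t, map_sub, ← α.map_add',
      add_sub_cancel] at h1
    exact h1
  have h2 : ∀ t, ∃ z, M * |t| ≤ 1 / 2 →
      Tendsto (fun n => twist (α t) (hC.atoms n) 1) atTop (𝓝 z) ∧ ∀ c ∈ C, α t c * z = z * c := by
    intro t
    by_cases ht : M * |t| ≤ 1 / 2
    · obtain ⟨z, hz⟩ := hC.exists_tendsto_twist hA (α t) fun u huC huu => by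
        have := hu t 0 u huC huu
        rw [α.map_zero', sub_zero] at this
        exact this.trans ht
      exact ⟨z, fun _ => hz⟩
    · exact ⟨0, fun h => absurd h ht⟩
  choose z hz using h2
  refine ⟨M, hM, z, ?_, fun t ht => (hz t ht).2, fun s t hs ht => ?_⟩
  · have h3 := (hz 0 (by simp)).1
    refine tendsto_nhds_unique h3 (tendsto_const_nhds.congr fun n => ?_)
    exact ((hC.isAtoms_atoms n).twist_eq_self fun d hd => by
      rw [α.map_zero', one_mul, mul_one]).symm
  · refine le_of_tendsto ((hz s hs).1.sub (hz t ht).1).norm (Eventually.of_forall fun n => ?_)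
    exact (hC.isAtoms_atoms n).norm_twist_sub_twist_le fun u huC huu => hu s t u huC.1 huu

end IsMasaTower

/-! ### Unitary intertwiners from polar decomposition. -/

section Polar

/-- A continuous function that agrees with `x ↦ x ^ (-1/2)` on `[1/2, 3/2]`. -/
def invSqrtFun (x : ℝ) : ℝ := (√(max x (1 / 4)))⁻¹

theorem continuous_invSqrtFun : Continuous invSqrtFun := by
  unfold invSqrtFun
  refine Continuous.inv₀ (by fun_prop) fun x => ?_
  exact (Real.sqrt_pos.2 (lt_max_of_lt_right (by norm_num))).ne'

/-- The inverse square root of a self-adjoint element near `1`. -/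
def invSqrt (b : A) : A := cfc invSqrtFun b

variable {b z : A}

theorem isSelfAdjoint_invSqrt (b : A) : IsSelfAdjoint (invSqrt b) := cfc_predicate _ _

theorem spectrum_subset_of_norm_sub_one_le [Nontrivial A] (hb1 : ‖b - 1‖ ≤ 1 / 2) :
    spectrum ℝ b ⊆ Set.Icc (1 / 2) (3 / 2) := by
  intro x hx
  have h1 : x - 1 ∈ spectrum ℝ (b - 1) := by
    rw [spectrum.mem_iff] at hx ⊢
    convert hx using 2
    rw [map_sub, map_one]; abel
  have h2 := (spectrum.norm_le_norm_of_mem h1).trans hb1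
  rw [Real.norm_eq_abs, abs_le] at h2
  constructor <;> linarith

theorem invSqrt_mul_mul_invSqrt [Nontrivial A] (hb : IsSelfAdjoint b) (hb1 : ‖b - 1‖ ≤ 1 / 2) :
    invSqrt b * b * invSqrt b = 1 := by
  have hc := continuous_invSqrtFun
  conv_lhs => enter [1, 2]; rw [← cfc_id' ℝ b]
  rw [invSqrt, ← cfc_mul invSqrtFun (fun x => x) b hc.continuousOn (by fun_prop),
    ← cfc_mul (fun x => invSqrtFun x * x) invSqrtFun b (by fun_prop) hc.continuousOn,
    ← cfc_const_one ℝ b]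
  refine cfc_congr fun x hx => ?_
  have h1 := (spectrum_subset_of_norm_sub_one_le hb1 hx).1
  have h2 : 0 < x := by linarith
  simp only [invSqrtFun]
  rw [max_eq_left (by linarith)]
  have h3 := Real.sq_sqrt h2.le
  have h4 : 0 < √x := Real.sqrt_pos.2 h2
  field_simp
  exact h3.symm

theorem norm_invSqrt_sub_one_le [Nontrivial A] (hb : IsSelfAdjoint b) (hb1 : ‖b - 1‖ ≤ 1 / 2) :
    ‖invSqrt b - 1‖ ≤ 1 / 2 := by
  have hc := continuous_invSqrtFun
  rw [invSqrt, ← cfc_const_one ℝ b, ← cfc_sub invSqrtFun (fun _ => 1) b hc.continuousOn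
    (by fun_prop)]
  refine norm_cfc_le (by norm_num) fun x hx => ?_
  have h1 := spectrum_subset_of_norm_sub_one_le hb1 hx
  have h0 : 0 < x := by linarith [h1.1]
  simp only [invSqrtFun]
  rw [max_eq_left (by linarith [h1.1]), Real.norm_eq_abs, abs_le]
  have h4 : 0 < √x := Real.sqrt_pos.2 h0
  have h5 : √x ≤ 2 := Real.sqrt_le_iff.2 ⟨by norm_num, by linarith [h1.2]⟩
  have h6 : 2 / 3 ≤ √x := Real.le_sqrt_of_sq_le (by linarith [h1.1])
  have h7 : (√x)⁻¹ ≤ (2 / 3)⁻¹ := by gcongr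
  have h8 : (2 : ℝ)⁻¹ ≤ (√x)⁻¹ := by gcongr
  constructor <;> norm_num at h7 h8 ⊢ <;> linarith

theorem commute_invSqrt {c : A} (h : b * c = c * b) : invSqrt b * c = c * invSqrt b :=
  Commute.cfc_real (show Commute b c from h) _

/-- The unitary part of an element near `1`. -/
def unitaryPart (z : A) : A := z * invSqrt (star z * z)

theorem norm_star_mul_self_sub_one_le [Nontrivial A] (hz : ‖z - 1‖ ≤ 1 / 8) :
    ‖star z * z - 1‖ ≤ 1 / 2 := by
  have h1 : star z * z - 1 = star (z - 1) * (z - 1) + star (z - 1) + (z - 1) := by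
    rw [star_sub, star_one, sub_mul, mul_sub]; simp only [mul_one, one_mul]; abel
  rw [h1]
  calc _ ≤ ‖star (z - 1)‖ * ‖z - 1‖ + ‖star (z - 1)‖ + ‖z - 1‖ :=
        (norm_add_le _ _).trans (by
          gcongr
          exact (norm_add_le _ _).trans (by gcongr; exact norm_mul_le _ _))
    _ ≤ 1 / 2 := by rw [norm_star]; nlinarith [norm_nonneg (z - 1)]

theorem unitaryPart_mem [Nontrivial A] (hz : ‖z - 1‖ ≤ 1 / 8) : unitaryPart z ∈ unitary A := by
  have hb : IsSelfAdjoint (star z * z) := .star_mul_self z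
  have hb1 := norm_star_mul_self_sub_one_le hz
  have h1 := invSqrt_mul_mul_invSqrt hb hb1
  have hsa : star (invSqrt (star z * z)) = invSqrt (star z * z) := isSelfAdjoint_invSqrt _
  have h2 : star (unitaryPart z) * unitaryPart z = 1 := by
    rw [unitaryPart, star_mul, hsa, ← mul_assoc, mul_assoc (invSqrt _) (star z) z, h1]
  have hzu : IsUnit z := by
    have := isUnit_one_sub_of_norm_lt_one (x := 1 - z) (by
      rw [norm_sub_rev]; exact hz.trans_lt (by norm_num))
    rwa [sub_sub_cancel] at this
  have hsu : IsUnit (invSqrt (star z * z)) := by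
    have := isUnit_one_sub_of_norm_lt_one (x := 1 - invSqrt (star z * z)) (by
      rw [norm_sub_rev]; exact (norm_invSqrt_sub_one_le hb hb1).trans_lt (by norm_num))
    rwa [sub_sub_cancel] at this
  obtain ⟨w, hw⟩ : IsUnit (unitaryPart z) := hzu.mul hsu
  refine Unitary.mem_iff.2 ⟨h2, ?_⟩
  have h3 : star (unitaryPart z) = ↑w⁻¹ := by
    rw [← hw] at h2 ⊢
    exact (Units.inv_eq_of_mul_eq_one_left h2).symm
  rw [h3, ← hw, Units.mul_inv]

theorem unitaryPart_one [Nontrivial A] : unitaryPart (1 : A) = 1 := by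
  rw [unitaryPart, one_mul, star_one, one_mul, invSqrt, cfc_apply_one]
  norm_num [invSqrtFun]

theorem continuous_invSqrt [Nontrivial A] {X : Type*} [TopologicalSpace X] {b : X → A}
    (hb : Continuous b) (hsa : ∀ x, IsSelfAdjoint (b x)) (hb1 : ∀ x, ‖b x - 1‖ ≤ 1 / 2) :
    Continuous fun x => invSqrt (b x) :=
  hb.cfc' (isCompact_Icc) invSqrtFun (fun x => spectrum_subset_of_norm_sub_one_le (hb1 x))
    continuous_invSqrtFun.continuousOn hsa

theorem continuous_unitaryPart [Nontrivial A] {X : Type*} [TopologicalSpace X] {z : X → A}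
    (hz : Continuous z) (hz1 : ∀ x, ‖z x - 1‖ ≤ 1 / 8) : Continuous fun x => unitaryPart (z x) :=
  hz.mul (continuous_invSqrt (by fun_prop) (fun x => .star_mul_self (z x))
    fun x => norm_star_mul_self_sub_one_le (hz1 x))

/-- The relations for `c` and `star c` together make `star z * z` commute with `c`, and then so does
its inverse square root. -/
theorem intertwine_unitaryPart {σ : A ≃⋆ₐ[ℂ] A} {c : A} (h : σ c * z = z * c)
    (h' : σ (star c) * z = z * star c) : σ c * unitaryPart z = unitaryPart z * c := by
  have h1 : star z * z * c = c * (star z * z) := by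
    have h2 := congrArg star h'
    rw [star_mul, star_mul, map_star, star_star, star_star] at h2
    rw [mul_assoc, ← h, ← mul_assoc, h2, mul_assoc]
  rw [unitaryPart, ← mul_assoc, h, mul_assoc, mul_assoc, commute_invSqrt h1]

end Polar

theorem continuous_act (α : OneParamAutGroup A) {X : Type*} [TopologicalSpace X] {s : X → ℝ}
    {w : X → A} (hs : Continuous s) (hw : Continuous w) : Continuous fun x => α (s x) (w x) := by
  have h : Continuous fun p : ℝ × A => α p.1 p.2 := by
    rw [continuous_iff_continuousAt]
    rintro ⟨t, y⟩
    rw [ContinuousAt, tendsto_iff_norm_sub_tendsto_zero]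
    have h1 : Tendsto (fun p : ℝ × A => ‖p.2 - y‖ + ‖α p.1 y - α t y‖) (𝓝 (t, y)) (𝓝 0) := by
      have h2 : Continuous fun p : ℝ × A => ‖p.2 - y‖ + ‖α p.1 y - α t y‖ := by
        have := (α.continuous' y).comp (continuous_fst (X := ℝ) (Y := A))
        fun_prop
      simpa using h2.tendsto (t, y)
    refine squeeze_zero (fun _ => norm_nonneg _) (fun p => ?_) h1
    calc ‖α p.1 p.2 - α t y‖ = ‖α p.1 (p.2 - y) + (α p.1 y - α t y)‖ := by
          rw [map_sub]; congr 1; abel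
      _ ≤ _ := (norm_add_le _ _).trans (by rw [α.norm_map])
  exact h.comp (hs.prodMk hw)

theorem intervalIntegral_mem {E : Type*} [NormedAddCommGroup E] [NormedSpace ℝ E] [CompleteSpace E]
    {K : Submodule ℝ E} (hK : IsClosed (K : Set E)) {f : ℝ → E} (hf : Continuous f) {a b : ℝ}
    (hab : a ≤ b) (h : ∀ r ∈ Set.Icc a b, f r ∈ K) : ∫ r in a..b, f r ∈ K := by
  have hc : CompleteSpace K := IsClosed.completeSpace_coe (hs := hK)
  -- Membership in `K` is known only on `[a, b]`, so the argument is clamped to get a globally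
  -- continuous `K`-valued function.
  let g : ℝ → K := fun r => ⟨f (Set.projIcc a b hab r), h _ (Set.projIcc a b hab r).2⟩
  have hg : Continuous g := (hf.comp (continuous_subtype_val.comp continuous_projIcc)).subtype_mk _
  have h1 : ∫ r in a..b, f r = ∫ r in a..b, K.subtypeL (g r) := by
    refine intervalIntegral.integral_congr fun r hr => ?_
    rw [Set.uIcc_of_le hab] at hr
    simp [g, Set.projIcc_of_mem hab hr]
  rw [h1, K.subtypeL.intervalIntegral_comp_comm
    (hg.intervalIntegrable (μ := MeasureTheory.volume) a b)]
  exact Subtype.prop _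

namespace IsMasaTower

variable {G : ℕ → StarSubalgebra ℂ A} {C : StarSubalgebra ℂ A}

/-- Polar parts of the Lipschitz family of intertwiners. The choice `T = 1 / (8 * M)` keeps that
family within `1 / 8` of `1`, where the polar part is continuous; clamping time makes the family
total, and a further shrinking of the interval gives the bound `η`. -/
theorem exists_unitary_intertwiner (hC : IsMasaTower G C) (hA : IsSimpleCStar A)
    {α : OneParamAutGroup A} (hdom : (C : Set A) ⊆ α.generator.domain) {η : ℝ} (hη : 0 < η) :
    ∃ T > 0, ∃ w : ℝ → A, Continuous w ∧ (∀ t, w t ∈ unitary A) ∧ (∀ t, ‖w t - 1‖ ≤ η) ∧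
      ∀ t ∈ Set.Icc 0 T, ∀ c ∈ C, α t c * w t = w t * c := by
  have := hA.1
  obtain ⟨M, hM, z, hz0, hzc, hzl⟩ := hC.exists_intertwiner hA hdom
  have hT0 : 0 < 1 / (8 * M) := by positivity
  set T := 1 / (8 * M) with hT
  have hMT : M * T = 1 / 8 := by rw [hT]; field_simp
  let z' : ℝ → A := fun t => z (Set.projIcc 0 T hT0.le t)
  have hp : ∀ t : ℝ, M * |(Set.projIcc 0 T hT0.le t : ℝ)| ≤ 1 / 8 := by
    intro t
    have h1 := (Set.projIcc 0 T hT0.le t).2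
    rw [abs_of_nonneg h1.1, ← hMT]
    exact mul_le_mul_of_nonneg_left h1.2 hM.le
  have hz' : Continuous z' := by
    rw [Metric.continuous_iff]
    intro s ε hε
    have hpc : Continuous fun t : ℝ => (Set.projIcc 0 T hT0.le t : ℝ) :=
      continuous_subtype_val.comp continuous_projIcc
    obtain ⟨δ, hδ, h⟩ := Metric.continuous_iff.1 hpc s (ε / M) (by positivity)
    refine ⟨δ, hδ, fun t ht => ?_⟩
    have h1 := h t ht
    rw [Real.dist_eq, lt_div_iff₀ hM] at h1
    rw [dist_eq_norm]
    refine (hzl _ _ ((hp t).trans (by norm_num)) ((hp s).trans (by norm_num))).trans_lt ?_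
    rwa [mul_comm]
  have hz'1 : ∀ t, ‖z' t - 1‖ ≤ 1 / 8 := by
    intro t
    rw [← hz0]
    refine (hzl _ 0 ((hp t).trans (by norm_num)) (by simp)).trans ?_
    rw [sub_zero]; exact hp t
  have hw := continuous_unitaryPart hz' hz'1
  have hw0 : unitaryPart (z' 0) = 1 := by
    have : z' 0 = 1 := by simp [z', hz0]
    rw [this, unitaryPart_one]
  obtain ⟨δ, hδ, hδw⟩ := Metric.continuous_iff.1 hw 0 η hη
  have hT'0 : 0 ≤ min T (δ / 2) := by positivity
  refine ⟨min T (δ / 2), by positivity, fun t => unitaryPart (z' (Set.projIcc 0 _ hT'0 t)),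
    hw.comp (continuous_subtype_val.comp continuous_projIcc), fun t => unitaryPart_mem (hz'1 _),
    fun t => ?_, fun t ht c hc => ?_⟩
  · have h1 := (Set.projIcc 0 _ hT'0 t).2
    have h2 := hδw (Set.projIcc 0 _ hT'0 t) (by
      rw [Real.dist_eq, sub_zero, abs_of_nonneg h1.1]
      exact (h1.2.trans (min_le_right _ _)).trans_lt (half_lt_self hδ))
    rw [dist_eq_norm, hw0] at h2
    exact h2.le
  · have ht' : t ∈ Set.Icc 0 T := ⟨ht.1, ht.2.trans (min_le_left _ _)⟩
    have h1 : z' t = z t := by simp [z', Set.projIcc_of_mem hT0.le ht']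
    have h2 : M * |t| ≤ 1 / 2 := by
      have := hp t
      rw [Set.projIcc_of_mem hT0.le ht'] at this
      exact this.trans (by norm_num)
    simp only [Set.projIcc_of_mem hT'0 ht, h1]
    exact intertwine_unitaryPart (hzc t h2 c hc) (hzc t h2 _ (star_mem hc))

end IsMasaTower

instance : CompleteSpace (selfAdjoint A) :=
  IsClosed.completeSpace_coe (hs := isClosed_eq continuous_star continuous_id)

/-! ### Correction of the intertwiners to a cocycle. -/

section Cocycle

variable (α : OneParamAutGroup A) {w : ℝ → A} (hw : ∀ t, w t ∈ unitary A)

/-- The failure of `w` to satisfy the cocycle identity `w (s + t) = α s (w t) * w s`. -/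
def defect (s t : ℝ) : unitary A :=
  ⟨star (w (s + t)) * (α s (w t) * w s),
    mul_mem (Unitary.star_mem (hw _)) (mul_mem (map_mem_unitary _ (hw t)) (hw s))⟩

theorem mul_defect (s t : ℝ) : w (s + t) * defect α hw s t = α s (w t) * w s := by
  rw [defect, ← mul_assoc, (Unitary.mem_iff.1 (hw _)).2, one_mul]

theorem norm_defect_sub_one_le {η : ℝ} (hη : ∀ t, ‖w t - 1‖ ≤ η) (s t : ℝ) :
    ‖(defect α hw s t : A) - 1‖ ≤ 3 * η := by
  have h1 : (defect α hw s t : A) - 1 = star (w (s + t)) * (α s (w t - 1) * w s + (w s - 1) -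
      (w (s + t) - 1)) := by
    have e : star (w (s + t)) * w (s + t) = 1 := (Unitary.mem_iff.1 (hw _)).1
    rw [defect, map_sub, map_one, sub_mul, one_mul]
    simp only [mul_sub, mul_add, mul_one, e]
    abel
  rw [h1, CStarRing.norm_mem_unitary_mul _ (Unitary.star_mem (hw _))]
  refine (norm_sub_le _ _).trans ?_
  have h2 : ‖α s (w t - 1) * w s‖ ≤ η := by
    rw [CStarRing.norm_mul_mem_unitary _ (hw s), α.norm_map]
    exact hη t
  linarith [norm_add_le (α s (w t - 1) * w s) (w s - 1), hη s, hη (s + t)]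

theorem continuous_defect (hwc : Continuous w) :
    Continuous fun p : ℝ × ℝ => defect α hw p.1 p.2 := by
  refine Continuous.subtype_mk ?_ _
  have := continuous_act α continuous_fst (hwc.comp (continuous_snd (X := ℝ) (Y := ℝ)))
  have h1 : Continuous fun p : ℝ × ℝ => w (p.1 + p.2) := by fun_prop
  have h2 : Continuous fun p : ℝ × ℝ => w p.1 := by fun_prop
  exact h1.star.mul (this.mul h2)

/-- The logarithm of the defect. -/
def logDefect (s t : ℝ) : selfAdjoint A := Unitary.argSelfAdjoint (defect α hw s t)

theorem continuous_logDefect (hwc : Continuous w) {η : ℝ} (hη : ∀ t, ‖w t - 1‖ ≤ η)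
    (hη' : 3 * η ≤ 1) : Continuous fun p : ℝ × ℝ => logDefect α hw p.1 p.2 := by
  refine Unitary.continuousOn_argSelfAdjoint.comp_continuous (continuous_defect α hw hwc)
    fun p => ?_
  rw [Metric.mem_ball, Subtype.dist_eq, dist_eq_norm]
  exact (norm_defect_sub_one_le α hw hη _ _).trans_lt (by linarith)

theorem norm_logDefect_lt {η : ℝ} (hη : ∀ t, ‖w t - 1‖ ≤ η)
    (hη' : 3 * η ≤ 1) (s t : ℝ) : ‖logDefect α hw s t‖ < Real.pi / 2 := by
  have h1 := norm_defect_sub_one_le α hw hη s t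
  rw [logDefect, Unitary.norm_argSelfAdjoint (by linarith), Real.arccos_lt_pi_div_two]
  have h2 : ‖(defect α hw s t : A) - 1‖ ≤ 1 := by linarith
  nlinarith [norm_nonneg ((defect α hw s t : A) - 1)]

theorem expUnitary_logDefect {η : ℝ} (hη : ∀ t, ‖w t - 1‖ ≤ η)
    (hη' : 3 * η ≤ 1) (s t : ℝ) :
    selfAdjoint.expUnitary (logDefect α hw s t) = defect α hw s t :=
  expUnitary_argSelfAdjoint
    ((norm_defect_sub_one_le α hw hη s t).trans_lt (by linarith))

end Cocycle

namespace IsMasaTower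

variable {G : ℕ → StarSubalgebra ℂ A} {C : StarSubalgebra ℂ A} {α : OneParamAutGroup A}
  {w : ℝ → A} {hw : ∀ t, w t ∈ unitary A} {T η : ℝ}

/-- Both `w (s + t)` and `α s (w t) * w s` intertwine `α (s + t)` with the identity on `C`, so their
quotient commutes with the masa `C`. -/
theorem defect_mem (hC : IsMasaTower G C)
    (hT : ∀ t ∈ Set.Icc 0 T, ∀ c ∈ C, α t c * w t = w t * c) {s t : ℝ} (hs : 0 ≤ s) (ht : 0 ≤ t)
    (hst : s + t ≤ T) : (defect α hw s t : A) ∈ C := by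
  refine hC.mem_of_commute fun n c hc _ => ?_
  have h1 : α (s + t) c * (α s (w t) * w s) = (α s (w t) * w s) * c := by
    rw [α.map_add', ← mul_assoc, ← map_mul, hT t ⟨ht, by linarith⟩ c hc, map_mul, mul_assoc,
      hT s ⟨hs, by linarith⟩ c hc, mul_assoc]
  have h2 : star (w (s + t)) * α (s + t) c = c * star (w (s + t)) := by
    have := congrArg star (hT (s + t) ⟨by positivity, hst⟩ _ (star_mem hc))
    rw [star_mul, star_mul, map_star, star_star, star_star] at this
    exact this
  rw [defect, mul_assoc, ← h1, ← mul_assoc, h2, mul_assoc]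

theorem logDefect_mem (hC : IsMasaTower G C)
    (hT : ∀ t ∈ Set.Icc 0 T, ∀ c ∈ C, α t c * w t = w t * c) {s t : ℝ} (hs : 0 ≤ s) (ht : 0 ≤ t)
    (hst : s + t ≤ T) : (logDefect α hw s t : A) ∈ C := by
  have h1 := hC.defect_mem (hw := hw) hT hs ht hst
  refine hC.mem_of_commute fun n c hc _ => ?_
  exact Commute.cfc (show Commute _ _ from hC.comm _ h1 c hc)
    (show Commute _ _ from hC.comm _ (star_mem h1) c hc) _

/-- The cocycle identity of the defect. -/
theorem defect_cocycle (hC : IsMasaTower G C)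
    (hT : ∀ t ∈ Set.Icc 0 T, ∀ c ∈ C, α t c * w t = w t * c) {s t r : ℝ} (hs : 0 ≤ s) (ht : 0 ≤ t)
    (hr : 0 ≤ r) (hst : s + t + r ≤ T) :
    defect α hw s (t + r) * defect α hw t r = defect α hw (s + t) r * defect α hw s t := by
  ext
  have key : w (s + t + r) * ((defect α hw s (t + r) : A) * defect α hw t r) =
      w (s + t + r) * ((defect α hw (s + t) r : A) * defect α hw s t) := by
    have h1 := hC.defect_mem (hw := hw) hT ht hr (by linarith : t + r ≤ T)
    rw [← mul_assoc, ← mul_assoc, mul_defect, mul_assoc _ (w (s + t)), mul_defect, add_assoc,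
      mul_defect, mul_assoc, ← hT s ⟨hs, by linarith⟩ _ h1, ← mul_assoc, ← map_mul, mul_defect,
      α.map_add', map_mul, mul_assoc]
  have e : star (w (s + t + r)) * w (s + t + r) = 1 := (Unitary.mem_iff.1 (hw _)).1
  have := congrArg (fun x => star (w (s + t + r)) * x) key
  simp only [← mul_assoc, e, one_mul] at this
  exact this

/-- The logarithms lie in the commutative algebra `C` and are shorter than `π / 2`. Sums of two stay
within the ball where the exponential is injective, so the multiplicative identity becomes additive.
-/
theorem logDefect_cocycle (hC : IsMasaTower G C)
    (hT : ∀ t ∈ Set.Icc 0 T, ∀ c ∈ C, α t c * w t = w t * c) (hη : ∀ t, ‖w t - 1‖ ≤ η)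
    (hη' : 3 * η ≤ 1) {s t r : ℝ} (hs : 0 ≤ s) (ht : 0 ≤ t) (hr : 0 ≤ r) (hst : s + t + r ≤ T) :
    logDefect α hw s (t + r) + logDefect α hw t r =
      logDefect α hw (s + t) r + logDefect α hw s t := by
  have hn := norm_logDefect_lt α hw hη hη'
  have hn' : ∀ a b c d : ℝ, ‖logDefect α hw a b + logDefect α hw c d‖ < Real.pi := fun a b c d =>
    (norm_add_le _ _).trans_lt (by linarith [hn a b, hn c d])
  have m1 := hC.logDefect_mem (hw := hw) hT hs (by positivity : 0 ≤ t + r) (by linarith)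
  have m2 := hC.logDefect_mem (hw := hw) hT ht hr (by linarith)
  have m3 := hC.logDefect_mem (hw := hw) hT (by positivity : 0 ≤ s + t) hr (by linarith)
  have m4 := hC.logDefect_mem (hw := hw) hT hs ht (by linarith)
  rw [← argSelfAdjoint_expUnitary (hn' s (t + r) t r),
    ← argSelfAdjoint_expUnitary (hn' (s + t) r s t),
    Commute.expUnitary_add (show Commute _ _ from hC.comm _ m1 _ m2),
    Commute.expUnitary_add (show Commute _ _ from hC.comm _ m3 _ m4)]
  simp only [expUnitary_logDefect α hw hη hη']
  rw [hC.defect_cocycle hT hs ht hr hst]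

/-- A coboundary for the logarithm of the defect. -/
def primitive (α : OneParamAutGroup A) (hw : ∀ t, w t ∈ unitary A) (τ t : ℝ) : selfAdjoint A :=
  τ⁻¹ • ((∫ r in (0 : ℝ)..t, logDefect α hw r τ) - ∫ r in (0 : ℝ)..τ, logDefect α hw t r)

/-- The 2-cocycle becomes a coboundary by averaging the cocycle identity over its last variable. As
time runs only over an interval, this leaves boundary integrals of `g s`, which the term `∫ g r τ`
in `primitive` compensates. Times up to `2 * τ` occur, whence `2 * τ ≤ T`. -/
theorem primitive_add (hC : IsMasaTower G C)
    (hT : ∀ t ∈ Set.Icc 0 T, ∀ c ∈ C, α t c * w t = w t * c) (hwc : Continuous w)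
    (hη : ∀ t, ‖w t - 1‖ ≤ η) (hη' : 3 * η ≤ 1) {τ : ℝ} (hτ : 0 < τ) (hτT : 2 * τ ≤ T) {s t : ℝ}
    (hs : 0 ≤ s) (ht : 0 ≤ t) (hst : s + t ≤ τ) :
    primitive α hw τ (s + t) = logDefect α hw s t + primitive α hw τ s + primitive α hw τ t := by
  have hgc := continuous_logDefect α hw hwc hη hη'
  set g := logDefect α hw with hg
  have hcoc : ∀ {s t r : ℝ}, 0 ≤ s → 0 ≤ t → 0 ≤ r → s + t + r ≤ T →
      g s (t + r) + g t r = g (s + t) r + g s t := fun h1 h2 h3 h4 =>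
    hC.logDefect_cocycle hT hη hη' h1 h2 h3 h4
  have c1 : ∀ a, Continuous fun r => g r a :=
    fun a => hgc.comp (by fun_prop : Continuous fun r : ℝ => (r, a))
  have c2 : ∀ a, Continuous fun r => g a r :=
    fun a => hgc.comp (by fun_prop : Continuous fun r : ℝ => (a, r))
  have i1 : ∀ a b c, IntervalIntegrable (fun r => g r a) MeasureTheory.volume b c := fun a b c =>
    (c1 a).intervalIntegrable b c
  have i2 : ∀ a b c, IntervalIntegrable (fun r => g a r) MeasureTheory.volume b c := fun a b c =>
    (c2 a).intervalIntegrable b c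
  have e1 : (∫ r in (0 : ℝ)..(s + t), g r τ) = (∫ r in (0 : ℝ)..s, g r τ) +
      ∫ r in (0 : ℝ)..t, g (s + r) τ := by
    rw [intervalIntegral.integral_comp_add_left (fun r => g r τ) s, add_zero,
      intervalIntegral.integral_add_adjacent_intervals (i1 _ _ _) (i1 _ _ _)]
  -- Integrate the cocycle identity for `(s, r, τ)` over `r ∈ [0, t]`.
  have e2 : (∫ r in (0 : ℝ)..t, g (s + r) τ) = (∫ r in (0 : ℝ)..t, g r τ) +
      ((∫ r in (0 : ℝ)..t, g s (r + τ)) - ∫ r in (0 : ℝ)..t, g s r) := by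
    have i3 : IntervalIntegrable (fun r => g s (r + τ)) MeasureTheory.volume 0 t :=
      ((c2 s).comp (by fun_prop : Continuous fun r : ℝ => r + τ)).intervalIntegrable _ _
    rw [← intervalIntegral.integral_sub i3 (i2 _ _ _), ← intervalIntegral.integral_add (i1 _ _ _)
      (i3.sub (i2 _ _ _))]
    refine intervalIntegral.integral_congr fun r hr => ?_
    rw [Set.uIcc_of_le ht] at hr
    have := hcoc hs hr.1 hτ.le (by linarith [hr.2])
    rw [← sub_eq_iff_eq_add.2 this]
    abel
  -- Integrate the cocycle identity for `(s, t, r)` over `r ∈ [0, τ]`; the constant term is what the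
  -- factor `τ⁻¹` normalizes.
  have e3 : (∫ r in (0 : ℝ)..τ, g (s + t) r) = (∫ r in (0 : ℝ)..τ, g s (t + r)) +
      (∫ r in (0 : ℝ)..τ, g t r) - τ • g s t := by
    have i3 : IntervalIntegrable (fun r => g s (t + r)) MeasureTheory.volume 0 τ :=
      ((c2 s).comp (by fun_prop : Continuous fun r : ℝ => t + r)).intervalIntegrable _ _
    have : τ • g s t = ∫ _r in (0 : ℝ)..τ, g s t := by
      rw [intervalIntegral.integral_const, sub_zero]
    rw [this, ← intervalIntegral.integral_add i3 (i2 _ _ _),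
      ← intervalIntegral.integral_sub (i3.add (i2 _ _ _)) intervalIntegrable_const]
    refine intervalIntegral.integral_congr fun r hr => ?_
    rw [Set.uIcc_of_le hτ.le] at hr
    have := hcoc hs ht hr.1 (by linarith [hr.2])
    rw [this]; abel
  have e4 : (∫ r in (0 : ℝ)..t, g s (r + τ)) = (∫ r in τ..(t + τ), g s r) := by
    rw [intervalIntegral.integral_comp_add_right (fun r => g s r) τ, zero_add]
  have e5 : (∫ r in (0 : ℝ)..τ, g s (t + r)) = ∫ r in t..(t + τ), g s r := by
    rw [intervalIntegral.integral_comp_add_left (fun r => g s r) t, add_zero]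
  have e6 : (∫ r in (0 : ℝ)..τ, g s r) + (∫ r in τ..(t + τ), g s r) =
      (∫ r in (0 : ℝ)..t, g s r) + ∫ r in t..(t + τ), g s r := by
    rw [intervalIntegral.integral_add_adjacent_intervals (i2 _ _ _) (i2 _ _ _),
      intervalIntegral.integral_add_adjacent_intervals (i2 _ _ _) (i2 _ _ _)]
  have e7 : g s t = τ⁻¹ • (τ • g s t) := by rw [smul_smul, inv_mul_cancel₀ hτ.ne', one_smul]
  simp only [primitive, ← hg]
  rw [e7, ← smul_add, ← smul_add, e1, e2, e3, e4, e5]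
  congr 1
  rw [← sub_eq_zero]
  have := sub_eq_zero.2 e6
  rw [← this]
  abel

theorem primitive_mem (hC : IsMasaTower G C)
    (hT : ∀ t ∈ Set.Icc 0 T, ∀ c ∈ C, α t c * w t = w t * c) (hwc : Continuous w)
    (hη : ∀ t, ‖w t - 1‖ ≤ η) (hη' : 3 * η ≤ 1) {τ : ℝ} (hτ : 0 < τ) (hτT : 2 * τ ≤ T) {t : ℝ}
    (ht : t ∈ Set.Icc 0 τ) : (primitive α hw τ t : A) ∈ C := by
  have hgc := continuous_logDefect α hw hwc hη hη'
  let K : Submodule ℝ (selfAdjoint A) :=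
    { carrier := {x | (x : A) ∈ C}
      add_mem' := fun {x y} hx hy => add_mem (S := StarSubalgebra ℂ A) hx hy
      zero_mem' := zero_mem C
      smul_mem' := fun c x hx => by
        have : ((c : ℂ) • (x : A)) ∈ C := SMulMemClass.smul_mem _ hx
        rwa [Complex.coe_smul] at this }
  have hK : IsClosed (K : Set (selfAdjoint A)) := hC.closed.preimage continuous_subtype_val
  have c1 : ∀ a, Continuous fun r => logDefect α hw r a := fun a =>
    hgc.comp (by fun_prop : Continuous fun r : ℝ => (r, a))
  have c2 : ∀ a, Continuous fun r => logDefect α hw a r := fun a =>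
    hgc.comp (by fun_prop : Continuous fun r : ℝ => (a, r))
  change primitive α hw τ t ∈ K
  refine K.smul_mem _ (K.sub_mem (intervalIntegral_mem hK (c1 τ) ht.1 fun r hr => ?_)
    (intervalIntegral_mem hK (c2 t) hτ.le fun r hr => ?_))
  · exact hC.logDefect_mem hT hr.1 hτ.le (by linarith [hr.2, ht.2])
  · exact hC.logDefect_mem hT ht.1 hr.1 (by linarith [hr.2, ht.2])

theorem continuous_primitive (hwc : Continuous w) (hη : ∀ t, ‖w t - 1‖ ≤ η) (hη' : 3 * η ≤ 1)
    (τ : ℝ) : Continuous (primitive α hw τ) := by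
  have hgc := continuous_logDefect α hw hwc hη hη'
  have c1 : ∀ a, Continuous fun r => logDefect α hw r a := fun a =>
    hgc.comp (by fun_prop : Continuous fun r : ℝ => (r, a))
  have h1 : Continuous fun t : ℝ => ∫ r in (0 : ℝ)..t, logDefect α hw r τ :=
    intervalIntegral.continuous_primitive (fun a b => (c1 τ).intervalIntegrable a b) 0
  have h2 : Continuous fun t : ℝ => ∫ r in (0 : ℝ)..τ, logDefect α hw t r :=
    intervalIntegral.continuous_parametric_intervalIntegral_of_continuous' hgc 0 τ
  exact (h1.sub h2).const_smul τ⁻¹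

/-- The one-parameter group is implemented on the masa, for small times, by a cocycle. -/
theorem exists_cocycle (hC : IsMasaTower G C) (hA : IsSimpleCStar A) {α : OneParamAutGroup A}
    (hdom : (C : Set A) ⊆ α.generator.domain) :
    ∃ τ > 0, ∃ y : ℝ → A, Continuous y ∧ (∀ t, y t ∈ unitary A) ∧
      (∀ s t, 0 ≤ s → 0 ≤ t → s + t ≤ τ → y (s + t) = α s (y t) * y s) ∧
      ∀ t ∈ Set.Icc 0 τ, ∀ c ∈ C, α t c * y t = y t * c := by
  obtain ⟨T, hT0, w, hwc, hw, hη, hT⟩ :=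
    hC.exists_unitary_intertwiner hA hdom (show (0 : ℝ) < 1 / 3 by norm_num)
  have hη' : 3 * (1 / 3 : ℝ) ≤ 1 := by norm_num
  -- Half of the interval, since `primitive` evaluates the defect at total times up to `2 * τ`.
  set τ := T / 2 with hτ
  have hτ0 : 0 < τ := by positivity
  have hτT : 2 * τ ≤ T := by rw [hτ]; linarith
  set l := primitive α hw τ with hl
  have hmem : ∀ t ∈ Set.Icc 0 τ, (l t : A) ∈ C := fun t ht =>
    hC.primitive_mem hT hwc hη hη' hτ0 hτT ht
  have hexp : ∀ t ∈ Set.Icc 0 τ, (selfAdjoint.expUnitary (l t) : A) ∈ C := by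
    intro t ht
    refine exp_mem_of_mem hC.closed ?_
    exact SMulMemClass.smul_mem _ (hmem t ht)
  refine ⟨τ, hτ0, fun t => w t * selfAdjoint.expUnitary (l t), ?_, fun t => mul_mem (hw t)
    (selfAdjoint.expUnitary (l t)).2, fun s t hs ht hst => ?_, fun t ht c hc => ?_⟩
  · have h1 := continuous_primitive (α := α) (hw := hw) hwc hη hη' τ
    exact hwc.mul (continuous_subtype_val.comp (selfAdjoint.continuous_expUnitary.comp h1))
  · have hs' : s ∈ Set.Icc 0 τ := ⟨hs, by linarith⟩
    have ht' : t ∈ Set.Icc 0 τ := ⟨ht, by linarith⟩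
    have m0 := hC.logDefect_mem (hw := hw) hT hs ht (by linarith)
    -- Exponentiating `primitive_add`: the factor `e^{il}` absorbs the defect of `w`. As `e^{il(t)}`
    -- lies in `C`, it can be moved past `w s`.
    have h1 : selfAdjoint.expUnitary (l (s + t)) =
        defect α hw s t * selfAdjoint.expUnitary (l t) * selfAdjoint.expUnitary (l s) := by
      rw [hl, hC.primitive_add hT hwc hη hη' hτ0 hτT hs ht hst, ← hl, add_right_comm,
        Commute.expUnitary_add, Commute.expUnitary_add, expUnitary_logDefect α hw hη hη']
      · exact hC.comm _ m0 _ (hmem t ht')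
      · exact hC.comm _ (add_mem m0 (hmem t ht')) _ (hmem s hs')
    simp only
    rw [h1, map_mul]
    calc _ = w (s + t) * defect α hw s t * selfAdjoint.expUnitary (l t) *
          selfAdjoint.expUnitary (l s) := by
            simp only [Submonoid.coe_mul, mul_assoc]
      _ = α s (w t) * (w s * selfAdjoint.expUnitary (l t)) * selfAdjoint.expUnitary (l s) := by
          rw [mul_defect]; simp only [mul_assoc]
      _ = _ := by
          rw [← hT s ⟨hs, by linarith⟩ _ (hexp t ht')]; simp only [mul_assoc]
  · simp only
    rw [← mul_assoc, hT t ⟨ht.1, by linarith [ht.2]⟩ c hc, mul_assoc, mul_assoc,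
      hC.comm _ hc _ (hexp t ht)]

end IsMasaTower

/-! ### Smoothing a local cocycle. -/

/-- Square roots near `1` inherit differentiability. -/
theorem differentiableWithinAt_of_mul_self {R : ℝ → A} {s : Set ℝ} {a : ℝ}
    (hR : ContinuousWithinAt R s a) (hd : DifferentiableWithinAt ℝ (fun t => R t * R t) s a)
    (hRa : ‖R a - 1‖ ≤ 1 / 2) : DifferentiableWithinAt ℝ R s a := by
  -- The derivative of squaring at `R a` is `x ↦ R a * x + x * R a`, equal to `2 * (1 - T)` with
  -- `‖T‖ ≤ 1 / 2`. It is invertible, and the inverse function theorem recovers `R` from its square.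
  let T : A →L[ℝ] A := (2⁻¹ : ℝ) • (ContinuousLinearMap.mul ℝ A (1 - R a) +
    (ContinuousLinearMap.mul ℝ A).flip (1 - R a))
  have hT : ‖T‖ < 1 := by
    refine lt_of_le_of_lt (ContinuousLinearMap.opNorm_le_bound T (by norm_num : (0 : ℝ) ≤ 1 / 2)
      fun x => ?_) (by norm_num : (1 / 2 : ℝ) < 1)
    have e : T x = (2⁻¹ : ℝ) • ((1 - R a) * x + x * (1 - R a)) := rfl
    rw [e, norm_smul]
    have h1 : ‖(1 - R a) * x + x * (1 - R a)‖ ≤ ‖x‖ := by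
      rw [norm_sub_rev] at hRa
      refine (norm_add_le _ _).trans ((add_le_add (norm_mul_le _ _) (norm_mul_le _ _)).trans ?_)
      nlinarith [norm_nonneg x]
    have h2 : ‖(2⁻¹ : ℝ)‖ = 1 / 2 := by norm_num
    rw [h2]
    gcongr
  let L : A ≃L[ℝ] A := ContinuousLinearEquiv.ofUnit
    ((Units.mk0 (2 : ℝ) two_ne_zero).map (algebraMap ℝ (A →L[ℝ] A)).toMonoidHom *
      Units.oneSub T hT)
  have hL : ∀ x, L x = R a * x + x * R a := by
    intro x
    have e : L x = (2 : ℝ) • (x - (2⁻¹ : ℝ) • ((1 - R a) * x + x * (1 - R a))) := rfl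
    rw [e, smul_sub, smul_smul]
    norm_num
    rw [sub_mul, mul_sub, two_smul]
    simp only [one_mul, mul_one]
    abel
  have hf : HasStrictFDerivAt (fun x : A => x * x) (L : A →L[ℝ] A) (R a) := by
    refine ((hasStrictFDerivAt_id (𝕜 := ℝ) (R a)).mul' (hasStrictFDerivAt_id (R a))).congr_fderiv ?_
    ext x
    simp [hL]
  have hinv := hf.to_localInverse.hasFDerivAt
  have hcomp : DifferentiableWithinAt ℝ
      (fun t => hf.localInverse (fun x : A => x * x) L (R a) (R t * R t)) s a :=
    hinv.differentiableAt.comp_differentiableWithinAt (f := fun t => R t * R t) a hd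
  refine hcomp.congr_of_eventuallyEq ?_ ?_
  · exact (hR.eventually hf.eventually_left_inverse).mono fun t ht => ht.symm
  · exact hf.localInverse_apply_image.symm

/-- Moving averages of a continuous function are differentiable. -/
theorem differentiableAt_average {y : ℝ → A} (hyc : Continuous y) (σ : ℝ) :
    DifferentiableAt ℝ (fun t => σ⁻¹ • ((∫ r in (0 : ℝ)..(t + σ), y r) - ∫ r in (0 : ℝ)..t, y r))
      0 := by
  have h1 : HasDerivAt (fun t : ℝ => ∫ r in (0 : ℝ)..(t + σ), y r) (y σ) 0 := by
    have : HasDerivAt (fun t : ℝ => ∫ r in (0 : ℝ)..t, y r) (y (0 + σ)) (0 + σ) :=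
      (hyc.integral_hasStrictDerivAt 0 (0 + σ)).hasDerivAt
    simpa using this.comp_add_const 0 σ
  have h2 : HasDerivAt (fun t : ℝ => ∫ r in (0 : ℝ)..t, y r) (y 0) 0 :=
    (hyc.integral_hasStrictDerivAt 0 0).hasDerivAt
  exact ((h1.sub h2).const_smul σ⁻¹).differentiableAt

theorem average_add {y : ℝ → A} (hyc : Continuous y) (σ t : ℝ) :
    σ⁻¹ • ((∫ r in (0 : ℝ)..(t + σ), y r) - ∫ r in (0 : ℝ)..t, y r) =
      σ⁻¹ • ∫ r in (0 : ℝ)..σ, y (t + r) := by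
  rw [intervalIntegral.integral_interval_sub_left (hyc.intervalIntegrable _ _)
    (hyc.intervalIntegrable _ _), intervalIntegral.integral_comp_add_left, add_zero]

theorem exists_average_close {y : ℝ → A} (hyc : Continuous y) {τ ε : ℝ} (hτ : 0 < τ) (hε : 0 < ε) :
    ∃ σ > 0, σ ≤ τ ∧ ‖σ⁻¹ • (∫ r in (0 : ℝ)..σ, y r) - y 0‖ ≤ ε := by
  obtain ⟨δ, hδ, hδy⟩ := Metric.continuous_iff.1 hyc 0 ε hε
  have hσ0 : 0 < min τ (δ / 2) := by positivity
  refine ⟨min τ (δ / 2), hσ0, min_le_left _ _, ?_⟩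
  set σ := min τ (δ / 2)
  have hσδ : σ < δ := (min_le_right _ _).trans_lt (half_lt_self hδ)
  have e : σ⁻¹ • (∫ r in (0 : ℝ)..σ, y r) - y 0 = σ⁻¹ • ∫ r in (0 : ℝ)..σ, (y r - y 0) := by
    rw [intervalIntegral.integral_sub (hyc.intervalIntegrable _ _) intervalIntegrable_const,
      intervalIntegral.integral_const, sub_zero, smul_sub, smul_smul, inv_mul_cancel₀ hσ0.ne',
      one_smul]
  have h1 : ‖∫ r in (0 : ℝ)..σ, (y r - y 0)‖ ≤ ε * |σ - 0| := by
    refine intervalIntegral.norm_integral_le_of_norm_le_const fun r hr => ?_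
    rw [Set.uIoc_of_le hσ0.le] at hr
    have := hδy r (by
      rw [Real.dist_eq, sub_zero, abs_of_pos hr.1]
      exact hr.2.trans_lt hσδ)
    rw [dist_eq_norm] at this
    exact this.le
  rw [e, norm_smul, norm_inv, Real.norm_of_nonneg hσ0.le, inv_mul_le_iff₀ hσ0]
  rw [sub_zero, abs_of_pos hσ0] at h1
  linarith

/-- A local cocycle is cohomologous to a differentiable one. -/
theorem exists_differentiable_cocycle [Nontrivial A] {α : OneParamAutGroup A} {y : ℝ → A} {τ : ℝ}
    (hτ : 0 < τ) (hyc : Continuous y) (hyu : ∀ t, y t ∈ unitary A) (hy0 : y 0 = 1)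
    (hcoc : ∀ s t, 0 ≤ s → 0 ≤ t → s + t ≤ τ → y (s + t) = α s (y t) * y s) :
    ∃ U ∈ unitary A, DifferentiableWithinAt ℝ (fun t => α t U * y t) (Set.Ici 0) 0 := by
  obtain ⟨σ, hσ0, hστ, hV1⟩ := exists_average_close hyc (half_pos hτ)
    (show (0 : ℝ) < 1 / 8 by norm_num)
  rw [hy0] at hV1
  have hyi : ∀ a b, IntervalIntegrable y MeasureTheory.volume a b := fun a b =>
    hyc.intervalIntegrable a b
  -- By the cocycle identity `α t V * y t` is a moving average of `y`, hence differentiable in `t`.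
  -- `V` is near `1` but not unitary; its unitary part will serve as `U`.
  set V : A := σ⁻¹ • ∫ r in (0 : ℝ)..σ, y r with hV
  let Vt : ℝ → A := fun t => σ⁻¹ • ((∫ r in (0 : ℝ)..(t + σ), y r) - ∫ r in (0 : ℝ)..t, y r)
  have hVt : ∀ t, 0 ≤ t → t ≤ σ → α t V * y t = Vt t := by
    intro t ht htσ
    have h1 : α t (∫ r in (0 : ℝ)..σ, y r) = ∫ r in (0 : ℝ)..σ, α t (y r) :=
      (((α.clm t).restrictScalars ℝ).intervalIntegral_comp_comm (hyi 0 σ)).symm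
    have h2 : α t V = σ⁻¹ • α t (∫ r in (0 : ℝ)..σ, y r) :=
      ((α.clm t).restrictScalars ℝ).map_smul _ _
    have h4 : (∫ r in (0 : ℝ)..σ, α t (y r)) * y t = ∫ r in (0 : ℝ)..σ, α t (y r) * y t :=
      (((ContinuousLinearMap.mul ℝ A).flip (y t)).intervalIntegral_comp_comm
        ((continuous_act α continuous_const hyc).intervalIntegrable 0 σ)).symm
    rw [h2, h1, smul_mul_assoc, h4]
    simp only [Vt]
    rw [average_add hyc]
    congr 1
    refine intervalIntegral.integral_congr fun r hr => ?_
    rw [Set.uIcc_of_le hσ0.le] at hr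
    exact (hcoc t r ht hr.1 (by linarith [hr.2])).symm
  have hVd : DifferentiableAt ℝ Vt 0 := differentiableAt_average hyc σ
  set b := star V * V with hb
  have hbsa : IsSelfAdjoint b := .star_mul_self V
  have hb1 : ‖b - 1‖ ≤ 1 / 2 := norm_star_mul_self_sub_one_le hV1
  -- The remaining factor of `α t (unitaryPart V) * y t`. Its square is the inverse of `star (Vt t)
  -- * Vt t`, which is differentiable, so `R` is differentiable as a square root near `1`.
  let R : ℝ → A := fun t => star (y t) * α t (invSqrt b) * y t
  have hyy : ∀ t, y t * star (y t) = 1 := fun t => (Unitary.mem_iff.1 (hyu t)).2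
  have hyy' : ∀ t, star (y t) * y t = 1 := fun t => (Unitary.mem_iff.1 (hyu t)).1
  have hR0 : R 0 = invSqrt b := by simp [R, hy0, α.map_zero']
  have hRc : Continuous R :=
    (hyc.star.mul (α.continuous' (invSqrt b))).mul hyc
  have hQ : ∀ t, 0 ≤ t → t ≤ σ → star (Vt t) * Vt t = star (y t) * α t b * y t := by
    intro t ht htσ
    rw [← hVt t ht htσ, hb, map_mul, map_star, star_mul]
    simp only [mul_assoc]
  have hconj : ∀ t x z, star (y t) * x * y t * (star (y t) * z * y t) =
      star (y t) * (x * z) * y t := by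
    intro t x z
    calc _ = star (y t) * x * (y t * star (y t)) * z * y t := by simp only [mul_assoc]
      _ = _ := by rw [hyy, mul_one]; simp only [mul_assoc]
  have hinv : invSqrt b * invSqrt b * b = 1 := by
    rw [mul_assoc, commute_invSqrt (b := b) (c := b) rfl, ← mul_assoc]
    exact invSqrt_mul_mul_invSqrt hbsa hb1
  have hinv' : b * (invSqrt b * invSqrt b) = 1 := by
    rw [← mul_assoc, ← commute_invSqrt (b := b) (c := b) rfl]
    exact invSqrt_mul_mul_invSqrt hbsa hb1
  have hRR : ∀ t, 0 ≤ t → t ≤ σ → R t * R t = Ring.inverse (star (Vt t) * Vt t) := by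
    intro t ht htσ
    have e1 : R t * R t = star (y t) * α t (invSqrt b * invSqrt b) * y t := by
      rw [map_mul, ← hconj]
    have e2 : R t * R t * (star (Vt t) * Vt t) = 1 := by
      rw [hQ t ht htσ, e1, hconj, ← map_mul, hinv, map_one, mul_one, hyy']
    have e3 : (star (Vt t) * Vt t) * (R t * R t) = 1 := by
      rw [hQ t ht htσ, e1, hconj, ← map_mul, hinv', map_one, mul_one, hyy']
    exact (Ring.inverse_unit (⟨_, _, e3, e2⟩ : Aˣ)).symm
  have hev : ∀ᶠ t in 𝓝[Set.Ici (0 : ℝ)] 0, 0 ≤ t ∧ t ≤ σ := by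
    filter_upwards [self_mem_nhdsWithin, nhdsWithin_le_nhds (Iio_mem_nhds hσ0)] with t h1 h2
    exact ⟨h1, le_of_lt h2⟩
  have hRd : DifferentiableWithinAt ℝ R (Set.Ici 0) 0 := by
    refine differentiableWithinAt_of_mul_self hRc.continuousWithinAt ?_ ?_
    · have hu : IsUnit (star (Vt 0) * Vt 0) := by
        rw [hQ 0 le_rfl hσ0.le, hy0, α.map_zero']
        have : IsUnit b := ⟨⟨b, _, hinv', hinv⟩, rfl⟩
        simpa using this
      obtain ⟨u, hu⟩ := hu
      have h1 : DifferentiableAt ℝ (Ring.inverse : A → A) (star (Vt 0) * Vt 0) := by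
        rw [← hu]; exact differentiableAt_inverse u.isUnit
      have h2 : DifferentiableAt ℝ (fun t => star (Vt t) * Vt t) 0 := hVd.star.mul hVd
      have h3 := (h1.comp (f := fun t => star (Vt t) * Vt t) 0 h2).differentiableWithinAt
        (s := Set.Ici 0)
      exact h3.congr_of_eventuallyEq (hev.mono fun t ht => hRR t ht.1 ht.2)
        (hRR 0 le_rfl hσ0.le)
    · rw [hR0]; exact norm_invSqrt_sub_one_le hbsa hb1
  have hWt : ∀ t, 0 ≤ t → t ≤ σ → α t (unitaryPart V) * y t = Vt t * R t := by
    intro t ht htσ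
    rw [← hVt t ht htσ, unitaryPart, map_mul]
    calc _ = α t V * 1 * α t (invSqrt b) * y t := by rw [mul_one]
      _ = _ := by rw [← hyy t]; simp only [R, mul_assoc]
  refine ⟨unitaryPart V, unitaryPart_mem hV1, ?_⟩
  exact (hVd.differentiableWithinAt.mul hRd).congr_of_eventuallyEq
    (hev.mono fun t ht => hWt t ht.1 ht.2) (hWt 0 le_rfl hσ0.le)

/-- A one-sided derivative of the orbit at `0` suffices for membership in the domain. -/
theorem OneParamAutGroup.hasGen_of_hasDerivWithinAt {α : OneParamAutGroup A} {x y : A}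
    (h : HasDerivWithinAt (fun t => α t x) y (Set.Ici 0) 0) : α.HasGen x y := by
  have h' : HasDerivWithinAt (fun t => α t x) y (Set.Iic 0) 0 := by
    rw [hasDerivWithinAt_iff_tendsto_slope] at h ⊢
    have h1 : Tendsto (fun s : ℝ => -s) (𝓝[Set.Iic 0 \ {0}] 0) (𝓝[Set.Ici 0 \ {0}] 0) := by
      refine tendsto_nhdsWithin_iff.2 ⟨?_, ?_⟩
      · have : Tendsto (fun s : ℝ => -s) (𝓝 0) (𝓝 0) := by
          simpa using (continuous_neg (G := ℝ)).tendsto 0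
        exact this.mono_left nhdsWithin_le_nhds
      · filter_upwards [self_mem_nhdsWithin] with s hs
        exact ⟨by simpa using hs.1, by simpa using hs.2⟩
    -- The left difference quotient at `s` is `α s` applied to the right difference quotient at
    -- `-s`, so joint continuity of the action gives its limit.
    have h2 : Tendsto (fun s : ℝ => ((s, slope (fun t => α t x) 0 (-s)) : ℝ × A))
        (𝓝[Set.Iic 0 \ {0}] 0) (𝓝 (0, y)) :=
      (tendsto_id.mono_left nhdsWithin_le_nhds).prodMk_nhds (h.comp h1)
    have h3 := ((continuous_act α (continuous_fst (X := ℝ) (Y := A)) continuous_snd).tendsto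
      (0, y)).comp h2
    simp only [α.map_zero'] at h3
    refine h3.congr fun s => ?_
    have h4 : ∀ (r : ℝ) (z : A), α s (r • z) = r • α s z := fun r z =>
      ((α.clm s).restrictScalars ℝ).map_smul r z
    simp only [Function.comp, slope_def_module, α.map_zero', sub_zero]
    rw [h4, map_sub, α.map_map_neg, inv_neg, neg_smul, ← smul_neg, neg_sub]
  have := h'.union h
  rwa [Set.Iic_union_Ici, hasDerivWithinAt_univ] at this

/-! ### The conjugated group and its generator. -/

/-- A unitary cocycle, for small times, that implements the group on `C`. -/
structure IsLocalCocycle (α : OneParamAutGroup A) (C : StarSubalgebra ℂ A) (y : ℝ → A)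
    (τ : ℝ) : Prop where
  pos : 0 < τ
  cont : Continuous y
  unitary : ∀ t, y t ∈ unitary A
  cocycle : ∀ s t, 0 ≤ s → 0 ≤ t → s + t ≤ τ → y (s + t) = α s (y t) * y s
  intertwine : ∀ t ∈ Set.Icc 0 τ, ∀ c ∈ C, α t c * y t = y t * c

/-- The group conjugated by `y`. -/
def conjAct (α : OneParamAutGroup A) (y : ℝ → A) (t : ℝ) (x : A) : A := star (y t) * α t x * y t

/-- `x` is mapped to `d` by the one-sided generator of `conjAct α y`. -/
def HasConjGen (α : OneParamAutGroup A) (y : ℝ → A) (x d : A) : Prop :=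
  HasDerivWithinAt (fun t => conjAct α y t x) d (Set.Ici 0) 0

namespace IsLocalCocycle

variable {G : ℕ → StarSubalgebra ℂ A} {α : OneParamAutGroup A} {C : StarSubalgebra ℂ A}
  {y : ℝ → A} {τ : ℝ} {x x' d d' : A}

theorem star_mul_self (hy : IsLocalCocycle α C y τ) (t : ℝ) : star (y t) * y t = 1 :=
  (Unitary.mem_iff.1 (hy.unitary t)).1

theorem mul_star_self (hy : IsLocalCocycle α C y τ) (t : ℝ) : y t * star (y t) = 1 :=
  (Unitary.mem_iff.1 (hy.unitary t)).2

theorem zero (hy : IsLocalCocycle α C y τ) : y 0 = 1 := by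
  have h := hy.cocycle 0 0 le_rfl le_rfl (by simpa using hy.pos.le)
  rw [add_zero, α.map_zero'] at h
  calc y 0 = star (y 0) * (y 0 * y 0) := by rw [← mul_assoc, hy.star_mul_self, one_mul]
    _ = 1 := by rw [← h, hy.star_mul_self]

theorem conjAct_zero (hy : IsLocalCocycle α C y τ) (x : A) : conjAct α y 0 x = x := by
  simp [conjAct, hy.zero, α.map_zero']

theorem conjAct_mul (hy : IsLocalCocycle α C y τ) (t : ℝ) (x x' : A) :
    conjAct α y t (x * x') = conjAct α y t x * conjAct α y t x' := by
  calc _ = star (y t) * α t x * 1 * α t x' * y t := by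
        rw [conjAct, map_mul]; simp only [mul_assoc, one_mul]
    _ = _ := by rw [← hy.mul_star_self t]; simp only [conjAct, mul_assoc]

theorem conjAct_eq_self (hy : IsLocalCocycle α C y τ) {t : ℝ} (ht : t ∈ Set.Icc 0 τ) {c : A}
    (hc : c ∈ C) : conjAct α y t c = c := by
  rw [conjAct, mul_assoc, hy.intertwine t ht c hc, ← mul_assoc, hy.star_mul_self, one_mul]

theorem conjAct_add (hy : IsLocalCocycle α C y τ) {s t : ℝ} (hs : 0 ≤ s) (ht : 0 ≤ t)
    (hst : s + t ≤ τ) (x : A) : conjAct α y (s + t) x = conjAct α y s (conjAct α y t x) := by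
  simp only [conjAct, hy.cocycle s t hs ht hst, α.map_add', star_mul, map_mul, map_star, mul_assoc]

theorem continuous_conjAct (hy : IsLocalCocycle α C y τ) (x : A) :
    Continuous fun t => conjAct α y t x :=
  (hy.cont.star.mul (α.continuous' x)).mul hy.cont

theorem eventually (hy : IsLocalCocycle α C y τ) :
    ∀ᶠ t in 𝓝[Set.Ici (0 : ℝ)] 0, t ∈ Set.Icc 0 τ := by
  filter_upwards [self_mem_nhdsWithin, nhdsWithin_le_nhds (Iio_mem_nhds hy.pos)] with t h1 h2
  exact ⟨h1, le_of_lt h2⟩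

theorem _root_.AFAction.HasConjGen.unique (h : HasConjGen α y x d) (h' : HasConjGen α y x d') :
    d = d' :=
  UniqueDiffWithinAt.eq_deriv _ (uniqueDiffOn_Ici 0 0 Set.self_mem_Ici) h h'

theorem _root_.AFAction.HasConjGen.add (h : HasConjGen α y x d) (h' : HasConjGen α y x' d') :
    HasConjGen α y (x + x') (d + d') := by
  refine (HasDerivWithinAt.add h h').congr_of_mem (fun t _ => ?_) Set.self_mem_Ici
  simp [conjAct, mul_add, add_mul]

theorem _root_.AFAction.HasConjGen.smul (c : ℂ) (h : HasConjGen α y x d) :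
    HasConjGen α y (c • x) (c • d) := by
  refine (HasDerivWithinAt.const_smul c h).congr_of_mem (fun t _ => ?_) Set.self_mem_Ici
  simp [conjAct]

theorem _root_.AFAction.HasConjGen.star (h : HasConjGen α y x d) :
    HasConjGen α y (star x) (star d) := by
  refine (HasDerivWithinAt.star h).congr_of_mem (fun t _ => ?_) Set.self_mem_Ici
  simp [conjAct, map_star, mul_assoc]

theorem hasConjGen_mul (hy : IsLocalCocycle α C y τ) (h : HasConjGen α y x d)
    (h' : HasConjGen α y x' d') : HasConjGen α y (x * x') (d * x' + x * d') := by
  have := HasDerivWithinAt.mul h h'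
  simp only [hy.conjAct_zero] at this
  exact this.congr_of_mem (fun t _ => hy.conjAct_mul t x x') Set.self_mem_Ici

theorem hasConjGen_of_mem (hy : IsLocalCocycle α C y τ) {c : A} (hc : c ∈ C) :
    HasConjGen α y c 0 :=
  (hasDerivWithinAt_const (0 : ℝ) (Set.Ici 0) c).congr_of_eventuallyEq
    (hy.eventually.mono fun _ ht => hy.conjAct_eq_self ht hc) (hy.conjAct_zero c)

/-- The domain of the one-sided generator of the conjugated group. -/
def conjDomain (hy : IsLocalCocycle α C y τ) : StarSubalgebra ℂ A where
  carrier := {x | ∃ d, HasConjGen α y x d}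
  mul_mem' := fun ⟨_, h⟩ ⟨_, h'⟩ => ⟨_, hy.hasConjGen_mul h h'⟩
  add_mem' := fun ⟨_, h⟩ ⟨_, h'⟩ => ⟨_, h.add h'⟩
  star_mem' := fun ⟨_, h⟩ => ⟨_, h.star⟩
  algebraMap_mem' := fun c => ⟨0, hy.hasConjGen_of_mem (algebraMap_mem C c)⟩

variable {n k : ℕ} {v : Fin k → A}

/-- The conjugated group fixes `C` and so preserves the way `C` acts on `v i`: by scalars for `C ⊓ G
n`, by commutation for the elements of `C` in the commutant of `G n`. Hence the product commutes
with both parts of `C` and lies in `C`. -/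
theorem conjAct_mul_star_mem (hy : IsLocalCocycle α C y τ) (hC : IsMasaTower G C)
    (hv : IsMatrixUnits (G n) (C ⊓ G n) v) (i : Fin k) {t : ℝ} (ht : t ∈ Set.Icc 0 τ) :
    conjAct α y t (v i) * star (v i) ∈ C := by
  set X := conjAct α y t (v i) with hX
  have hcX : ∀ c ∈ C, c * X = conjAct α y t (c * v i) := fun c hc => by
    rw [hy.conjAct_mul, hy.conjAct_eq_self ht hc]
  refine hC.mem_of_commute_split n (fun c hc hcn => ?_) (fun c hc hcn => ?_)
  · obtain ⟨μ, hμ⟩ := hv.mul_left c ⟨hc, hcn⟩ i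
    obtain ⟨ν, hν⟩ := hv.mul_left (star c) ⟨star_mem hc, star_mem hcn⟩ i
    have hν' : star (v i) * c = star ν • star (v i) := by
      have := congrArg star hν
      rwa [star_mul, star_smul, star_star] at this
    have h1 : μ • (v i * star (v i)) = star ν • (v i * star (v i)) := by
      rw [← smul_mul_assoc, ← hμ, ← mul_smul_comm, ← hν', mul_assoc, ← mul_assoc (v i)]
      exact hC.comm _ hc _ (hv.range_mem i).1
    have h2 : X * star (v i) = X * star (v i) * (v i * star (v i)) := by
      rw [mul_assoc, ← mul_assoc (star (v i)), hv.star_mul_mul_star]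
    have h3 : c * (X * star (v i)) = μ • (X * star (v i)) := by
      rw [← mul_assoc, hcX c hc, hμ, hX, conjAct, conjAct, map_smul]
      simp only [mul_smul_comm, smul_mul_assoc]
    have h4 : X * star (v i) * c = star ν • (X * star (v i)) := by
      rw [mul_assoc, hν', mul_smul_comm]
    rw [h3, h4]
    calc star ν • (X * star (v i)) = X * star (v i) * (star ν • (v i * star (v i))) := by
          rw [mul_smul_comm, ← h2]
      _ = μ • (X * star (v i)) := by rw [← h1, mul_smul_comm, ← h2]
  · have h1 := hcn _ (hv.mem i)
    have h2 := hcn _ (star_mem (hv.mem i))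
    rw [← mul_assoc, hcX c hc, h1, hy.conjAct_mul, hy.conjAct_eq_self ht hc, mul_assoc, ← h2,
      ← mul_assoc]

/-- The elements `c t = conjAct α y t (v i) * star (v i)` of `C` form a norm-continuous local
semigroup with `c 0 = e`, the range projection of `v i`. Such semigroups are differentiable, and
`conjAct α y t (v i) = c t * v i`. -/
theorem exists_hasConjGen_matrixUnit [Nontrivial A] (hy : IsLocalCocycle α C y τ)
    (hC : IsMasaTower G C) (hv : IsMatrixUnits (G n) (C ⊓ G n) v) (i : Fin k) :
    ∃ d, HasConjGen α y (v i) d ∧ d * star (v i) ∈ C := by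
  set e := v i * star (v i) with he
  have heC : e ∈ C := (hv.range_mem i).1
  let c : ℝ → A := fun t => conjAct α y t (v i) * star (v i)
  have hcC : ∀ t ∈ Set.Icc 0 τ, c t ∈ C := fun t ht => hy.conjAct_mul_star_mem hC hv i ht
  have hcc : Continuous c := (hy.continuous_conjAct (v i)).mul continuous_const
  have hc0 : c 0 = e := by simp only [c, hy.conjAct_zero, he]
  have hce : ∀ t, c t * e = c t := fun t => by
    simp only [c, he]
    rw [mul_assoc, ← mul_assoc (star (v i)), hv.star_mul_mul_star]
  have hcv : ∀ t ∈ Set.Icc 0 τ, conjAct α y t (v i) = c t * v i := fun t ht => by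
    have h1 := hy.conjAct_mul t e (v i)
    rw [he, hv.mul_star_mul i, ← he, hy.conjAct_eq_self ht heC] at h1
    have h2 : conjAct α y t (v i) * (star (v i) * v i) = conjAct α y t (v i) := by
      -- The initial projection is also in the masa, because `C ⊓ G n` acts on `v i` from the right
      -- by scalars.
      have h3 : star (v i) * v i ∈ C ⊓ G n := by
        refine (hC.isMaxAb n).mem _ (mul_mem (star_mem (hv.mem i)) (hv.mem i)) fun d hd => ?_
        obtain ⟨μ, hμ⟩ := hv.mul_right d hd i
        obtain ⟨ν, hν⟩ := hv.mul_right (star d) (star_mem hd) i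
        have hν' : d * star (v i) = star ν • star (v i) := by
          have := congrArg star hν
          rwa [star_mul, star_smul, star_star] at this
        have e1 : star (v i) * v i * d = μ • (star (v i) * v i) := by
          rw [mul_assoc, hμ, mul_smul_comm]
        have e2 : d * (star (v i) * v i) = star ν • (star (v i) * v i) := by
          rw [← mul_assoc, hν', smul_mul_assoc]
        have e3 : v i * (star (v i) * v i) = v i := by rw [← mul_assoc, hv.mul_star_mul]
        have e4 : μ • v i = v i * d := hμ.symm
        have e5 : v i * (d * (star (v i) * v i)) = star ν • v i := by
          rw [e2, mul_smul_comm, e3]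
        have e6 : v i * (d * (star (v i) * v i)) = μ • v i := by
          rw [← mul_assoc, hμ, smul_mul_assoc, e3]
        rw [e1, e2, ← mul_smul_comm, ← mul_smul_comm, ← e6, e5]
      rw [← hy.conjAct_eq_self ht h3.1, ← hy.conjAct_mul, ← mul_assoc, hv.mul_star_mul]
    simp only [c]
    rw [mul_assoc, h2]
  have hcs : ∀ s t, 0 ≤ s → 0 ≤ t → s + t ≤ τ → c (s + t) = c s * c t := by
    intro s t hs ht hst
    have hs' : s ∈ Set.Icc 0 τ := ⟨hs, by linarith⟩
    have ht' : t ∈ Set.Icc 0 τ := ⟨ht, by linarith⟩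
    calc c (s + t) = conjAct α y s (c t * v i) * star (v i) := by
          rw [← hcv t ht', ← hy.conjAct_add hs ht hst]
      _ = c t * c s := by
          rw [hy.conjAct_mul, hy.conjAct_eq_self hs' (hcC t ht'), mul_assoc]
      _ = _ := hC.comm _ (hcC t ht') _ (hcC s hs')
  obtain ⟨σ, hσ0, hστ, hJ⟩ := exists_average_close hcc (half_pos hy.pos)
    (show (0 : ℝ) < 1 / 2 by norm_num)
  rw [hc0] at hJ
  set J : A := σ⁻¹ • ∫ r in (0 : ℝ)..σ, c r with hJd
  -- `J` is close to `e` and need only be invertible in that corner; adding `1 - e` makes it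
  -- invertible in `A`. Then `c t` is a moving average of `c` times a fixed inverse.
  have hu : IsUnit (J + (1 - e)) := by
    have := isUnit_one_sub_of_norm_lt_one (x := -(J - e)) (by
      rw [norm_neg]; exact hJ.trans_lt (by norm_num))
    convert this using 1
    abel
  let Vt : ℝ → A := fun t => σ⁻¹ • ((∫ r in (0 : ℝ)..(t + σ), c r) - ∫ r in (0 : ℝ)..t, c r)
  have hVt : ∀ t, 0 ≤ t → t ≤ σ → c t = Vt t * Ring.inverse (J + (1 - e)) := by
    intro t ht htσ
    have h1 : c t * (J + (1 - e)) = Vt t := by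
      have h2 : c t * (1 - e) = 0 := by rw [mul_sub, mul_one, hce, sub_self]
      have h4 : c t * (∫ r in (0 : ℝ)..σ, c r) = ∫ r in (0 : ℝ)..σ, c t * c r :=
        ((ContinuousLinearMap.mul ℝ A (c t)).intervalIntegral_comp_comm
          (hcc.intervalIntegrable 0 σ)).symm
      simp only [Vt]
      rw [mul_add, h2, add_zero, average_add hcc, hJd, mul_smul_comm, h4]
      congr 1
      refine intervalIntegral.integral_congr fun r hr => ?_
      rw [Set.uIcc_of_le hσ0.le] at hr
      exact (hcs t r ht hr.1 (by linarith [hr.2])).symm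
    rw [← h1, mul_assoc, Ring.mul_inverse_cancel _ hu, mul_one]
  have hev : ∀ᶠ t in 𝓝[Set.Ici (0 : ℝ)] 0, 0 ≤ t ∧ t ≤ σ := by
    filter_upwards [self_mem_nhdsWithin, nhdsWithin_le_nhds (Iio_mem_nhds hσ0)] with t h1 h2
    exact ⟨h1, le_of_lt h2⟩
  have hcd : DifferentiableWithinAt ℝ c (Set.Ici 0) 0 :=
    ((differentiableAt_average hcc σ).differentiableWithinAt.mul_const _).congr_of_eventuallyEq
      (hev.mono fun t ht => hVt t ht.1 ht.2) (hVt 0 le_rfl hσ0.le)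
  have hcd' := hcd.hasDerivWithinAt
  set d := derivWithin c (Set.Ici 0) 0
  have hdC : d ∈ C := by
    have h1 := hasDerivWithinAt_iff_tendsto_slope.1 hcd'
    have : (𝓝[Set.Ici (0 : ℝ) \ {0}] 0).NeBot := by
      rw [Set.Ici_sdiff_left]; infer_instance
    refine hC.closed.mem_of_tendsto h1 ?_
    have h2 : ∀ᶠ t in 𝓝[Set.Ici (0 : ℝ) \ {0}] 0, t ∈ Set.Icc 0 τ :=
      hy.eventually.filter_mono (nhdsWithin_mono 0 Set.sdiff_subset)
    filter_upwards [h2] with t ht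
    rw [slope_def_module]
    have h3 : c t - c 0 ∈ C := sub_mem (hcC t ht) (hcC 0 ⟨le_rfl, hy.pos.le⟩)
    have h4 := SMulMemClass.smul_mem (((t - 0)⁻¹ : ℝ) : ℂ) h3
    rwa [Complex.coe_smul] at h4
  refine ⟨d * v i, ?_, ?_⟩
  · exact (hcd'.mul_const (v i)).congr_of_eventuallyEq
      (hy.eventually.mono fun t ht => hcv t ht) (hcv 0 ⟨le_rfl, hy.pos.le⟩)
  · rw [mul_assoc]; exact mul_mem hdC heC

/-- The conjugated group is differentiable on the tower, and its generator is implemented there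
by elements of the masa. -/
theorem exists_adI_eq [Nontrivial A] (hy : IsLocalCocycle α C y τ) (hC : IsMasaTower G C) (n : ℕ) :
    ∃ h ∈ C, IsSelfAdjoint h ∧ ∀ x ∈ G n, HasConjGen α y x (adI h x) := by
  have := hC.finDim n
  obtain ⟨k, v, hv⟩ := exists_matrixUnits (hC.isMaxAb n)
  -- `G n` is spanned by the products `v i * star (v j)`, so differentiability on the `v i`
  -- suffices.
  have hle : G n ≤ hy.conjDomain := by
    intro x hx
    choose c hc _ using hv.eq_smul x hx
    have hxv : ∀ j, x * v j = ∑ i, c i j • v i := by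
      intro j
      rw [hv.sum_mul (x * v j)]
      refine Finset.sum_congr rfl fun i _ => ?_
      rw [← mul_assoc (star (v i)), hc, mul_smul_comm, ← mul_assoc, hv.mul_star_mul]
    have hvm : ∀ i, v i ∈ hy.conjDomain := fun i =>
      let ⟨d, hd, _⟩ := hy.exists_hasConjGen_matrixUnit hC hv i
      ⟨d, hd⟩
    rw [hv.mul_sum x]
    refine sum_mem fun j _ => mul_mem ?_ (star_mem (hvm j))
    rw [hxv]
    exact sum_mem fun i _ => SMulMemClass.smul_mem _ (hvm i)
  choose D hD using fun x : G n => hle x.2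
  let d : G n →ₗ[ℂ] A :=
    { toFun := D
      map_add' := fun x x' => (hD (x + x')).unique ((hD x).add (hD x'))
      map_smul' := fun c x => (hD (c • x)).unique ((hD x).smul c) }
  obtain ⟨h, hsa, hh, hS⟩ := hv.exists_adI d
    (fun x x' => (hD (x * x')).unique (hy.hasConjGen_mul (hD x) (hD x')))
    (fun x => (hD (star x)).unique (hD x).star)
  refine ⟨h, hS C fun i => ?_, hsa, fun x hx => ?_⟩
  · obtain ⟨d', hd', hd'C⟩ := hy.exists_hasConjGen_matrixUnit hC hv i
    have : d ⟨v i, hv.mem i⟩ = d' := (hD ⟨v i, hv.mem i⟩).unique hd'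
    rwa [this]
  · have := hh ⟨x, hx⟩
    simp only at this
    rw [this]
    exact hD ⟨x, hx⟩

/-- Transport of the generator to the conjugated picture. -/
theorem hasGen_conj (hy : IsLocalCocycle α C y τ) {U W : A}
    (hW : HasDerivWithinAt (fun t => α t U * y t) W (Set.Ici 0) 0) (h : HasConjGen α y x d) :
    α.HasGen (U * x * star U) (W * x * star U + U * d * star U + U * x * star W) := by
  refine hasGen_of_hasDerivWithinAt ?_
  have h1 := (hW.mul h).mul hW.star
  simp only [Pi.mul_apply, hy.conjAct_zero, hy.zero, α.map_zero', mul_one] at h1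
  rw [add_mul] at h1
  refine h1.congr_of_mem (fun t _ => ?_) Set.self_mem_Ici
  calc α t (U * x * star U) = α t U * 1 * α t x * 1 * star (α t U) := by
        simp only [map_mul, map_star, mul_one]
    _ = _ := by
        rw [← hy.mul_star_self t]
        simp only [conjAct, Pi.mul_apply, star_mul, mul_assoc]

end IsLocalCocycle

/-! ### Invariant algebras and transport back to the original group. -/

theorem commute_sub_of_adI_eq {k l x : A} (h : adI k x = adI l x) :
    (l - k) * x = x * (l - k) := by
  rw [adI_apply, adI_apply] at h
  have h2 : k * x - x * k = l * x - x * l := smul_right_injective A Complex.I_ne_zero h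
  rw [sub_mul, mul_sub, sub_eq_sub_iff_sub_eq_sub, h2]

namespace IsMasaTower

variable {G : ℕ → StarSubalgebra ℂ A} {C : StarSubalgebra ℂ A}

/-- Approximation of elements of the masa in a relative commutant. -/
theorem exists_close (hC : IsMasaTower G C) (n : ℕ) {p : A} (hp : p ∈ C) (hsa : IsSelfAdjoint p)
    (hpn : ∀ x ∈ G n, p * x = x * p) {ε : ℝ} (hε : 0 < ε) :
    ∃ m, ∃ q ∈ C, q ∈ G m ∧ IsSelfAdjoint q ∧ (∀ x ∈ G n, q * x = x * q) ∧ ‖p - q‖ ≤ ε := by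
  have := hC.finDim n
  obtain ⟨k, v, hv⟩ := exists_matrixUnits (hC.isMaxAb n)
  obtain ⟨K, hK, hΦ⟩ := IsMatrixUnits.norm_toCommutant_le v
  -- The map `toCommutant v` fixes `p`, sends the approximant into the commutant of `G n` without
  -- leaving `C`, and enlarges errors by at most `K`.
  obtain ⟨c, hc, hcp⟩ := Metric.mem_closure_iff.1 (hC.mem_closure hp) (ε / K) (by positivity)
  obtain ⟨m, hcm⟩ := Set.mem_iUnion.1 hc
  set r := toCommutant v c with hr
  have hrC : r ∈ C := hC.toCommutant_mem_of_mem hv fun d hd _ => hC.comm d hd c hcm.1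
  have hrG : r ∈ G (max n m) :=
    hv.toCommutant_mem (hC.mono (le_max_left _ _)) (hC.mono (le_max_right _ _) hcm.2)
  have hrn : ∀ x ∈ G n, r * x = x * r := fun x hx => hv.toCommutant_comm c hx
  have hrp : ‖p - r‖ ≤ ε := by
    rw [← hv.toCommutant_eq_self hpn, hr, ← IsMatrixUnits.toCommutant_sub]
    rw [dist_eq_norm] at hcp
    calc _ ≤ K * ‖p - c‖ := hΦ _
      _ ≤ K * (ε / K) := by gcongr
      _ = ε := by field_simp
  have hrn' : ∀ x ∈ G n, star r * x = x * star r := fun x hx => by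
    have := congrArg star (hrn _ (star_mem hx))
    simpa using this.symm
  refine ⟨max n m, (2⁻¹ : ℂ) • (r + star r), SMulMemClass.smul_mem _ (add_mem hrC (star_mem hrC)),
    SMulMemClass.smul_mem _ (add_mem hrG (star_mem hrG)), ?_, fun x hx => ?_, ?_⟩
  · rw [IsSelfAdjoint, star_smul, star_add, star_star, add_comm]; simp
  · rw [smul_mul_assoc, mul_smul_comm, add_mul, mul_add, hrn x hx, hrn' x hx]
  · have h1 : p - (2⁻¹ : ℂ) • (r + star r) = (2⁻¹ : ℂ) • ((p - r) + star (p - r)) := by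
      rw [star_sub, hsa.star_eq]; module
    rw [h1, norm_smul]
    have h2 : ‖(2⁻¹ : ℂ)‖ = 2⁻¹ := by simp
    have h3 := norm_add_le (p - r) (star (p - r))
    rw [norm_star] at h3
    rw [h2]; linarith

/-- Derivations of the tower implemented by elements of the masa leave, up to perturbation by an
element of the masa, an increasing sequence of finite-dimensional subalgebras invariant. -/
theorem exists_invariant_algebras (hC : IsMasaTower G C) {h : ℕ → A} (hhC : ∀ n, h n ∈ C)
    (hsa : ∀ n, IsSelfAdjoint (h n))
    (hh : ∀ n, ∀ x ∈ G n, (h (n + 1) - h n) * x = x * (h (n + 1) - h n)) :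
    ∃ k ∈ C, IsSelfAdjoint k ∧ ∃ (B : ℕ → StarSubalgebra ℂ A) (m : ℕ → ℕ), Monotone B ∧
      (∀ n, G n ≤ B n) ∧ (∀ n, B n ≤ G (m n)) ∧
      ∀ n, ∀ x ∈ B n, adI (h (m n)) x - adI k x ∈ B n := by
  -- The errors `(1 / 2) ^ n` are summable, so `h n` minus the partial sums of `q` converges.
  choose M q hqC hqM hqsa hqn hq using fun n => hC.exists_close n (sub_mem (hhC (n + 1)) (hhC n))
    ((hsa (n + 1)).sub (hsa n)) (hh n) (show (0 : ℝ) < (1 / 2) ^ n by positivity)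
  let h' : ℕ → A := fun n => ∑ j ∈ Finset.range n, q j
  -- Monotone, at least `n`, and beyond every stage containing a `q j` with `j < n`.
  let m : ℕ → ℕ := fun n => n + ∑ j ∈ Finset.range n, M j
  have hm : Monotone m := fun a b hab =>
    add_le_add hab (Finset.sum_le_sum_of_subset (Finset.range_mono hab))
  have hh'C : ∀ n, h' n ∈ C := fun n => sum_mem fun j _ => hqC j
  have hh'm : ∀ n, h' n ∈ G (m n) := fun n => sum_mem fun j hj =>
    hC.mono ((Finset.single_le_sum (f := M) (fun _ _ => Nat.zero_le _) hj).trans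
      (Nat.le_add_left _ _)) (hqM j)
  let a : ℕ → A := fun n => h n - h' n
  have hak : ∀ n, a (n + 1) - a n = h (n + 1) - h n - q n := fun n => by
    simp only [a, h', Finset.sum_range_succ]; abel
  obtain ⟨k, hk⟩ := cauchySeq_tendsto_of_complete
    (cauchySeq_of_le_geometric (f := a) (1 / 2) 1 (by norm_num) fun n => by
      rw [dist_comm, dist_eq_norm, hak, one_mul]; exact hq n)
  have haC : ∀ n, a n ∈ C := fun n => sub_mem (hhC n) (hh'C n)
  have hasa : ∀ n, IsSelfAdjoint (a n) := fun n =>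
    (hsa n).sub (isSelfAdjoint_sum _ fun j _ => hqsa j)
  have hkC : k ∈ C := hC.closed.mem_of_tendsto hk (Eventually.of_forall haC)
  have hksa : IsSelfAdjoint k := tendsto_nhds_unique
    (hk.star.congr fun n => (hasa n).star_eq) hk
  have hcomm : ∀ n x, x ∈ G n → ∀ j, n ≤ j →
      (a j - a n) * x = x * (a j - a n) ∧ (h j - h n) * x = x * (h j - h n) := by
    intro n x hx j hj
    induction j, hj using Nat.le_induction with
    | base => simp
    | succ j hj ih =>
      have hxj : x ∈ G j := hC.mono hj hx
      have e1 : a (j + 1) - a n = (h (j + 1) - h j - q j) + (a j - a n) := by rw [← hak]; abel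
      have e2 : h (j + 1) - h n = (h (j + 1) - h j) + (h j - h n) := by abel
      rw [e1, e2, add_mul, mul_add, add_mul, mul_add, ih.1, ih.2, hh j x hxj,
        sub_mul (h (j + 1) - h j), mul_sub x (h (j + 1) - h j), hh j x hxj, hqn j x hxj]
      exact ⟨rfl, rfl⟩
  have hkn : ∀ n, ∀ x ∈ G n, (k - a n) * x = x * (k - a n) := by
    intro n x hx
    have h1 : Tendsto (fun j => a j - a n) atTop (𝓝 (k - a n)) := hk.sub_const _
    refine tendsto_nhds_unique (h1.mul_const x) ((h1.const_mul x).congr' ?_)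
    filter_upwards [eventually_ge_atTop n] with j hj
    exact (hcomm n x hx j hj).1.symm
  have hle : ∀ n, StarAlgebra.adjoin ℂ ((G n : Set A) ∪ (C ⊓ G (m n) : StarSubalgebra ℂ A)) ≤
      G (m n) := fun n => StarAlgebra.adjoin_le (Set.union_subset
        (hC.mono (Nat.le_add_right _ _)) (inf_le_right : C ⊓ G (m n) ≤ G (m n)))
  refine ⟨k, hkC, hksa, fun n => StarAlgebra.adjoin ℂ
    ((G n : Set A) ∪ (C ⊓ G (m n) : StarSubalgebra ℂ A)), m, fun i j hij => ?_, fun n x hx => ?_,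
    hle, fun n x hx => ?_⟩
  · refine StarAlgebra.adjoin_mono (Set.union_subset_union (hC.mono hij) ?_)
    exact (inf_le_inf_left C (hC.mono (hm hij)) : C ⊓ G (m i) ≤ C ⊓ G (m j))
  · exact StarAlgebra.subset_adjoin ℂ _ (Or.inl hx)
  -- `l` is `(h (m n) - h n) - (k - a n)`, where both differences commute with `G n`; it also lies
  -- in `C`. So it commutes with the algebra generated by `G n` and `C ⊓ G (m n)`, and there the
  -- perturbed derivation is implemented by `h' n`, an element of that algebra.
  · set l := h (m n) - k - h' n with hl
    have hlC : l ∈ C := sub_mem (sub_mem (hhC _) hkC) (hh'C n)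
    have hlsa : IsSelfAdjoint l :=
      ((hsa _).sub hksa).sub (isSelfAdjoint_sum _ fun j _ => hqsa j)
    have hB : StarAlgebra.adjoin ℂ ((G n : Set A) ∪ (C ⊓ G (m n) : StarSubalgebra ℂ A)) ≤
        StarSubalgebra.centralizer ℂ {l} := by
      refine StarAlgebra.adjoin_le ?_
      rintro z (hz | hz)
      · have h1 : l * z = z * l := by
          have e : l = (h (m n) - h n) - (k - a n) := by simp only [hl, a]; abel
          rw [e, sub_mul, mul_sub, hkn n z hz, (hcomm n z hz _ (Nat.le_add_right _ _)).2]
        refine (StarSubalgebra.mem_centralizer_iff ℂ).2 fun g hg => ?_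
        rw [Set.mem_singleton_iff.1 hg, hlsa.star_eq]
        exact ⟨h1, h1⟩
      · have h1 : l * z = z * l := hC.comm l hlC z hz.1
        refine (StarSubalgebra.mem_centralizer_iff ℂ).2 fun g hg => ?_
        rw [Set.mem_singleton_iff.1 hg, hlsa.star_eq]
        exact ⟨h1, h1⟩
    have hlx : l * x = x * l :=
      ((StarSubalgebra.mem_centralizer_iff ℂ).1 (hB hx) l rfl).1
    have h'B : h' n ∈ StarAlgebra.adjoin ℂ ((G n : Set A) ∪ (C ⊓ G (m n) : StarSubalgebra ℂ A)) :=
      StarAlgebra.subset_adjoin ℂ _ (Or.inr ⟨hh'C n, hh'm n⟩)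
    have e : adI (h (m n)) x - adI k x = adI (h' n) x := by
      have e1 : h (m n) = l + k + h' n := by simp only [hl]; abel
      simp only [adI_apply]
      rw [e1, ← smul_sub]
      congr 1
      simp only [add_mul, mul_add, hlx]
      abel
    rw [e]
    exact SMulMemClass.smul_mem _ (sub_mem (mul_mem h'B hx) (mul_mem hx h'B))

end IsMasaTower

/-- If the domain of the generator contains a canonical masa, then some inner perturbation of the
generator leaves an increasing sequence of finite-dimensional subalgebras invariant. -/
theorem exists_invariant_of_isMasaTower (hA : IsSimpleCStar A) {α : OneParamAutGroup A}
    {G : ℕ → StarSubalgebra ℂ A} {C : StarSubalgebra ℂ A} (hC : IsMasaTower G C)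
    (hdom : (C : Set A) ⊆ α.generator.domain) :
    ∃ h : A, IsSelfAdjoint h ∧ ∃ F : ℕ → NonUnitalStarSubalgebra ℂ A, IsIncreasingFinDim F ∧
      IsDenseInDomain α.generator (⋃ n, (F n : Set A)) ∧
      ∀ n, LeavesInvariant (innerPerturbation α.generator h) (F n) := by
  have := hA.1
  obtain ⟨τ, hτ, y, hyc, hyu, hcoc, hint⟩ := hC.exists_cocycle hA hdom
  have hy : IsLocalCocycle α C y τ := ⟨hτ, hyc, hyu, hcoc, hint⟩
  obtain ⟨U, hU, hWd⟩ := exists_differentiable_cocycle hτ hyc hyu hy.zero hcoc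
  have hW := hWd.hasDerivWithinAt
  set W := derivWithin (fun t => α t U * y t) (Set.Ici 0) 0
  choose l hlC hlsa hl using fun n => hy.exists_adI_eq hC n
  obtain ⟨k, hkC, hksa, B, m, hBmono, hGB, hBG, hB⟩ := hC.exists_invariant_algebras hlC hlsa
    fun n x hx => commute_sub_of_adI_eq ((hl n x hx).unique (hl (n + 1) x (hC.mono n.le_succ hx)))
  have hUU : U * star U = 1 := (Unitary.mem_iff.1 hU).2
  have hUU' : star U * U = 1 := (Unitary.mem_iff.1 hU).1
  -- Differentiate `U * 1 * star U = 1`.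
  have hskew : U * star W = -(W * star U) := by
    have h1 := hy.hasGen_conj hW (hy.hasConjGen_of_mem (one_mem C))
    simp only [mul_one, mul_zero, zero_mul, add_zero, hUU] at h1
    have h2 := h1.unique (by simpa using hasGen_algebraMap (α := α) 1)
    exact eq_neg_of_add_eq_zero_right h2
  -- In the conjugated picture `δ` acquires the inner term given by the commutator with `W * star
  -- U`. The first summand cancels it; the second is the perturbation by `-k` carried over by `U`.
  set h : A := Complex.I • (W * star U) - U * k * star U with hh
  have hhsa : IsSelfAdjoint h := by
    have h1 : star (W * star U) = -(W * star U) := by rw [star_mul, star_star, hskew]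
    rw [IsSelfAdjoint, hh, star_sub, star_smul, h1, star_mul, star_mul, star_star, hksa.star_eq,
      smul_neg, ← neg_smul, ← mul_assoc]
    simp
  have hpert : ∀ n, ∀ x ∈ B n, HasPert α h (U * x * star U)
      (U * (adI (l (m n)) x - adI k x) * star U) := by
    intro n x hx
    have h1 := hy.hasGen_conj hW (hl (m n) x (hBG n hx))
    rw [HasPert]
    convert h1 using 1
    have e1 : W * x * star U = W * star U * (U * x * star U) := by
      calc _ = W * 1 * x * star U := by rw [mul_one]
        _ = _ := by rw [← hUU']; simp only [mul_assoc]
    have e2 : U * x * star W = -(U * x * star U * (W * star U)) := by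
      rw [← mul_neg, ← hskew]
      calc _ = U * x * 1 * star W := by rw [mul_one]
        _ = _ := by rw [← hUU']; simp only [mul_assoc]
    have e3 : U * adI k x * star U =
        Complex.I • (U * k * star U * (U * x * star U) - U * x * star U * (U * k * star U)) := by
      have : ∀ a b : A, U * a * star U * (U * b * star U) = U * (a * b) * star U := by
        intro a b
        calc _ = U * a * (star U * U) * b * star U := by simp only [mul_assoc]
          _ = _ := by rw [hUU', mul_one]; simp only [mul_assoc]
      rw [this, this, adI_apply, mul_smul_comm, smul_mul_assoc, mul_sub, sub_mul]
    rw [e1, e2, mul_sub, sub_mul, e3, adI_apply h, hh]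
    simp only [sub_mul, mul_sub, smul_mul_assoc, mul_smul_comm, smul_sub, smul_smul,
      Complex.I_mul_I]
    module
  let φ : A ≃⋆ₐ[ℂ] A := Unitary.conjStarAlgAut ℂ A ⟨U, hU⟩
  have hφ : ∀ x, φ x = U * x * star U := fun x => rfl
  let F : ℕ → NonUnitalStarSubalgebra ℂ A := fun n =>
    NonUnitalStarSubalgebra.map φ (B n).toNonUnitalStarSubalgebra
  have hF : IsIncreasingFinDim F := by
    refine ⟨fun i j hij => NonUnitalStarSubalgebra.map_mono (hBmono hij), fun n => ?_⟩
    have := hC.finDim (m n)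
    have : FiniteDimensional ℂ (B n) := IsMasaTower.finiteDimensional_of_le (hBG n)
    have : FiniteDimensional ℂ (Subalgebra.toSubmodule (B n).toSubalgebra) := this
    exact Module.Finite.map (Subalgebra.toSubmodule (B n).toSubalgebra) (φ : A →ₗ[ℂ] A)
  have hd : Dense (⋃ n, (F n : Set A)) := by
    have hcont : Continuous φ := (AddMonoidHomClass.isometry_of_norm φ (norm_map_aut φ)).continuous
    refine (φ.surjective.denseRange.dense_image hcont hC.dense).mono ?_
    rintro _ ⟨x, hx, rfl⟩
    obtain ⟨n, hn⟩ := Set.mem_iUnion.1 hx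
    exact Set.mem_iUnion.2 ⟨n, ⟨x, hGB n hn, rfl⟩⟩
  refine ⟨h, hhsa, F, hF, invariant_of_hasPert hhsa hF hd ?_⟩
  rintro n _ ⟨x, hx, rfl⟩
  exact ⟨_, ⟨_, hB n x hx, rfl⟩, hpert n x hx⟩

end AFAction

end

theorem mainTheorem2 {A : Type*} [CStarAlgebra A]
    (hsimple : AFAction.IsSimpleCStar A) (hAF : AFAction.IsAFAlgebra A)
    (α : AFAction.OneParamAutGroup A) :
    List.TFAE [
      -- the domain of the generator contains a canonical AF masa of `A`
      ∃ C : NonUnitalStarSubalgebra ℂ A,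
        AFAction.IsCanonicalAFMasa C ∧ (C : Set A) ⊆ α.generator.domain,
      -- some inner perturbation of the generator leaves invariant each member of an increasing
      -- sequence of finite-dimensional C*-subalgebras with union dense in the domain
      ∃ h : A, IsSelfAdjoint h ∧ ∃ F : ℕ → NonUnitalStarSubalgebra ℂ A,
        AFAction.IsIncreasingFinDim F ∧
        AFAction.IsDenseInDomain α.generator (⋃ n, (F n : Set A)) ∧
        ∀ n, AFAction.LeavesInvariant (AFAction.innerPerturbation α.generator h) (F n),
      -- some inner perturbation of the generator generates an AF locally representable
      -- one-parameter automorphism group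
      ∃ h : A, IsSelfAdjoint h ∧ ∃ β : AFAction.OneParamAutGroup A,
        β.generator = AFAction.innerPerturbation α.generator h ∧
        AFAction.IsAFLocallyRepresentable β] := by
  tfae_have 1 → 2 := by
    rintro ⟨C, hC, hdom⟩
    obtain ⟨G, C', hC', hCC'⟩ := hC.exists_isMasaTower
    exact AFAction.exists_invariant_of_isMasaTower hsimple hC' (hCC' ▸ hdom)
  tfae_have 2 → 3 := by
    rintro ⟨h, hh, F, hF, hd, hinv⟩
    exact ⟨h, hh, AFAction.exists_locallyRepresentable_of_invariant hh hF hd hinv⟩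
  tfae_have 3 → 2 := by
    rintro ⟨h, hh, β, hβ, hrep⟩
    exact ⟨h, hh, AFAction.exists_invariant_of_locallyRepresentable hh hβ hrep⟩
  tfae_have 2 → 1 := by
    rintro ⟨h, hh, F, hF, hd, hinv⟩
    exact AFAction.exists_canonicalAFMasa_of_invariant hh hF hd hinv
  tfae_finish
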